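/- **Setting.** Let $d_x,d_u\ge 1$, $A_\star\in\mathbb R^{d_x\times d_x}$, $B_\star\in\mathbb R^{d_x\times d_u}$, and consider the system $x_{t+1}=A_\star x_t+B_\star u_t+w_t$, $x_0=0$, where the $w_t$ are i.i.d. with $\mathbb E w_t=0$, $\|w_t\|\le W$ almost surely and $\mathbb E w_tw_t^{\mathsf T}\succ\sigma^2 I$ for some $\sigma,W>0$. The cost at time $t$ is $x_t^{\mathsf T}Qx_t+u_t^{\mathsf T}Ru_t$ with $0\prec Q,R\preceq I$. For a controller $K\in\mathbb R^{d_u\times d_x}$ let $$J(K)=\lim_{n\to\infty}\frac1n\,\mathbb E\Big[\sum_{t=1}^n x_t^{\mathsf T}(Q+K^{\mathsf T}RK)x_t\Big]\in[0,\infty],\qquad u_t=Kx_t .$$ Let $\alpha_0>0$, $\psi\ge1$, $\nu>0$ satisfy $\|Q^{-1}\|,\|R^{-1}\|\le 1/\alpha_0$ and $\|B_\star\|\le\psi$ (spectral norms), let $K_0$ be a controller with $J(K_0)\le\nu/4$, and let $T\ge1$ be an integer and $\delta\in(0,1)$. Set $\kappa=\sqrt{\nu/(\alpha_0\sigma^2)}$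 and $$\eta=\frac{\alpha_0}{128\,\nu\psi^2\kappa^{10}},\quad \tau=\lceil 2\kappa^2\log(7\kappa T)\rceil,\quad \mu=\frac{4\nu}{\kappa^4},\quad r_0=\frac{\alpha_0}{448\sqrt{d_x}\,\psi^2\kappa^{10}},\quad \sqrt{\bar m_0}=\frac{2^{17}d_ud_x^{3/2}\psi^2\kappa^{20}W^2}{\alpha_0\sigma^2}\sqrt{\log\frac{240T^4}{\delta}},$$ and for $j\ge0$ let $r_j=r_0(1-\mu\eta/3)^{j/2}$ and $m_j=\lceil \bar m_0(1-\mu\eta/3)^{-2j}\rceil$. **Algorithm.** Start with the controller $K_0$ at state $x_0=0$. In epoch $j=0,1,2,\dots$, for $i=1,\dots,m_j$: draw a matrix $G_{j,i}\in\mathbb R^{d_u\times d_x}$ with i.i.d. standard normal entries (all draws mutually independent and independent of the noise), put $U_{j,i}=G_{j,i}/\|G_{j,i}\|_F$, play $u_t=K_{j,i}x_t$ with $K_{j,i}=K_j+r_jU_{j,i}$ for $\tau$ rounds (without resetting the state), and let $c_{j,i,\tau}$ be the cost of the last of these rounds. At the end of the epoch set $K_{j+1}=K_j-\eta\,\frac{d_xd_u}{m_jr_j}\sum_{i=1}^{m_j}c_{j,i,\tau}U_{j,i}$.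 **Claim.** There is an absolute constant $C>0$ such that, in every such setting and for every epoch $j\ge0$ that begins within the first $T$ rounds (that is, $\tau\sum_{k<j}m_k\le T$), with probability at least $1-\delta/(4T)$ the costs $J(K_j)$ and $J(K_{j,i})$, $1\le i\le m_j$, are finite and $$\sum_{i=1}^{m_j}\big(J(K_{j,i})-J(K_j)\big)\le C\left(\frac{\sqrt{d_x}\,\nu\psi^2\kappa^8}{\alpha_0}\,r_j^2m_j+\nu\sqrt{m_j\log\frac T\delta}\right).$$ -/

import Mathlib

open MeasureTheory ProbabilityTheory Filter
open scoped Matrix ENNReal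

noncomputable section

namespace OnlineLQR

/-- Euclidean norm of a coordinate vector. -/
def euclNorm {n : ℕ} (x : Fin n → ℝ) : ℝ := ‖WithLp.toLp 2 x‖

/-- Spectral norm of a matrix: operator norm between Euclidean spaces. -/
def specNorm {m n : ℕ} (M : Matrix (Fin m) (Fin n) ℝ) : ℝ :=
  ‖LinearMap.toContinuousLinearMap (Matrix.toEuclideanLin M)‖

/-- Frobenius norm of a matrix. -/
def frobNorm {m n : ℕ} (M : Matrix (Fin m) (Fin n) ℝ) : ℝ :=
  Real.sqrt (∑ a, ∑ b, M a b ^ 2)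

/-- The matrices of a linear-quadratic control problem with `dx`-dimensional states and
`du`-dimensional actions. -/
structure LQR (dx du : ℕ) where
  /-- state-state transition matrix -/
  A : Matrix (Fin dx) (Fin dx) ℝ
  /-- state-action transition matrix -/
  B : Matrix (Fin dx) (Fin du) ℝ
  /-- state cost -/
  Q : Matrix (Fin dx) (Fin dx) ℝ
  /-- action cost -/
  R : Matrix (Fin du) (Fin du) ℝ

namespace LQR

variable {dx du : ℕ}

/-- The cost `xᵀ Q x + uᵀ R u` of one round at state `x` with action `u = K x`. -/
def stageCost (S : LQR dx du) (K : Matrix (Fin du) (Fin dx) ℝ) (x : Fin dx → ℝ) : ℝ :=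
  x ⬝ᵥ (S.Q *ᵥ x) + (K *ᵥ x) ⬝ᵥ (S.R *ᵥ (K *ᵥ x))

/-- The state reached from `x₀` at time `t₀` after `s` rounds of the controller `K`, where
`w t` is the noise that enters at time `t`. -/
def state (S : LQR dx du) (K : Matrix (Fin du) (Fin dx) ℝ) (w : ℕ → Fin dx → ℝ)
    (t₀ : ℕ) (x₀ : Fin dx → ℝ) : ℕ → Fin dx → ℝ
  | 0 => x₀
  | s + 1 =>
      S.A *ᵥ (state S K w t₀ x₀ s) + S.B *ᵥ (K *ᵥ (state S K w t₀ x₀ s)) + w (t₀ + s)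

/-- The infinite horizon expected cost `lim_n (1/n) 𝔼 ∑_{t=1}^n (x_tᵀ Q x_t + u_tᵀ R u_t)` of
the controller `K` started at `x_0 = 0`, with values in `[0, ∞]`. (The summands are
nonnegative. For centred i.i.d. noise the expected cost is nondecreasing in `t`, so
the limit exists in `[0, ∞]`; it is `∞` for controllers that do not stabilize the system.) -/
def J (S : LQR dx du) {Ω : Type*} [MeasurableSpace Ω] (P : Measure Ω)
    (w : ℕ → Ω → Fin dx → ℝ) (K : Matrix (Fin du) (Fin dx) ℝ) : ℝ≥0∞ :=
  limUnder atTop fun n : ℕ =>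
    (∫⁻ ω, ENNReal.ofReal
      (∑ t ∈ Finset.Icc 1 n, S.stageCost K (S.state K (fun s => w s ω) 0 0 t)) ∂P) / (n : ℝ≥0∞)

end LQR

/-- The constants known to the learner: `α = α₀`, `ψ`, `ν`, the noise constants `σ`, `W`, the
confidence parameter `δ` and the horizon `T`. -/
structure Consts where
  α : ℝ
  ψ : ℝ
  ν : ℝ
  σ : ℝ
  W : ℝ
  δ : ℝ
  T : ℕ

namespace Consts

/-- `κ = √(ν / (α₀ σ²))`. -/
def κ (c : Consts) : ℝ := Real.sqrt (c.ν / (c.α * c.σ ^ 2))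

/-- Step size `η = α₀ / (128 ν ψ² κ¹⁰)`. -/
def η (c : Consts) : ℝ := c.α / (128 * c.ν * c.ψ ^ 2 * c.κ ^ 10)

/-- Mixing length `τ = 2 κ² log (7 κ T)`, rounded up to an integer. -/
def τ (c : Consts) : ℕ := ⌈2 * c.κ ^ 2 * Real.log (7 * c.κ * (c.T : ℝ))⌉₊

/-- `μ = 4 ν / κ⁴`. -/
def μ (c : Consts) : ℝ := 4 * c.ν / c.κ ^ 4

/-- The decay factor `1 - μ η / 3`. -/
def ρ (c : Consts) : ℝ := 1 - c.μ * c.η / 3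

/-- Initial exploration radius `r₀ = α₀ / (448 √dx ψ² κ¹⁰)`. -/
def r₀ (c : Consts) (dx : ℕ) : ℝ :=
  c.α / (448 * Real.sqrt (dx : ℝ) * c.ψ ^ 2 * c.κ ^ 10)

/-- Initial epoch length before rounding, given by
`√m₀ = (2¹⁷ du dx^{3/2} ψ² κ²⁰ W² / (α₀ σ²)) √(log (240 T⁴ / δ))`. -/
def m₀ (c : Consts) (dx du : ℕ) : ℝ :=
  (2 ^ 17 * (du : ℝ) * (dx : ℝ) ^ (3 / 2 : ℝ) * c.ψ ^ 2 * c.κ ^ 20 * c.W ^ 2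
      / (c.α * c.σ ^ 2) * Real.sqrt (Real.log (240 * (c.T : ℝ) ^ 4 / c.δ))) ^ 2

/-- Exploration radius of epoch `j`: `r_j = r₀ (1 - μ η / 3)^{j/2}`. -/
def r (c : Consts) (dx : ℕ) (j : ℕ) : ℝ := c.r₀ dx * c.ρ ^ ((j : ℝ) / 2)

/-- Number of sub-epochs of epoch `j`: `m_j = m₀ (1 - μ η / 3)^{-2j}`, rounded up to an
integer. -/
def m (c : Consts) (dx du : ℕ) (j : ℕ) : ℕ := ⌈c.m₀ dx du * (c.ρ ^ (2 * j))⁻¹⌉₊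

/-- The time at which sub-epoch `i` (counted from `0`) of epoch `j` begins; every sub-epoch
takes `τ` rounds. -/
def startTime (c : Consts) (dx du : ℕ) (j i : ℕ) : ℕ :=
  c.τ * (∑ k ∈ Finset.range j, c.m dx du k + i)

end Consts

/-! The policy gradient method. Below, `w t` is the noise at time `t`, and `G j i` is the
Gaussian matrix drawn in sub-epoch `i` of epoch `j`, for `i = 0, …, m_j - 1`. -/

section Algorithm

variable {dx du : ℕ}

/-- The perturbed controller `K + r_j U` with `U = G / ‖G‖_F`. -/
def perturb (c : Consts) (j : ℕ) (K G : Matrix (Fin du) (Fin dx) ℝ) :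
    Matrix (Fin du) (Fin dx) ℝ :=
  K + c.r dx j • ((frobNorm G)⁻¹ • G)

/-- The state at the beginning of sub-epoch `i` of epoch `j`, if the epoch begins at state `x`
with underlying controller `K`. -/
def subState (S : LQR dx du) (c : Consts) (w : ℕ → Fin dx → ℝ)
    (G : ℕ → ℕ → Matrix (Fin du) (Fin dx) ℝ) (j : ℕ) (K : Matrix (Fin du) (Fin dx) ℝ)
    (x : Fin dx → ℝ) : ℕ → Fin dx → ℝ
  | 0 => x
  | i + 1 =>
      S.state (perturb c j K (G j i)) w (c.startTime dx du j i) (subState S c w G j K x i) c.τ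

/-- The cost observed in the final (that is, the `τ`-th) round of sub-epoch `i` of epoch `j`. -/
def finalCost (S : LQR dx du) (c : Consts) (w : ℕ → Fin dx → ℝ)
    (G : ℕ → ℕ → Matrix (Fin du) (Fin dx) ℝ) (j : ℕ) (K : Matrix (Fin du) (Fin dx) ℝ)
    (x : Fin dx → ℝ) (i : ℕ) : ℝ :=
  S.stageCost (perturb c j K (G j i))
    (S.state (perturb c j K (G j i)) w (c.startTime dx du j i)
      (subState S c w G j K x i) (c.τ - 1))

/-- The gradient estimate `(dx du / (m_j r_j)) ∑_i cost_i U_i` of epoch `j`. -/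
def gradEst (S : LQR dx du) (c : Consts) (w : ℕ → Fin dx → ℝ)
    (G : ℕ → ℕ → Matrix (Fin du) (Fin dx) ℝ) (j : ℕ) (K : Matrix (Fin du) (Fin dx) ℝ)
    (x : Fin dx → ℝ) : Matrix (Fin du) (Fin dx) ℝ :=
  ((dx : ℝ) * (du : ℝ) / ((c.m dx du j : ℝ) * c.r dx j)) •
    ∑ i ∈ Finset.range (c.m dx du j),
      finalCost S c w G j K x i • ((frobNorm (G j i))⁻¹ • G j i)

/-- Underlying controller and system state at the beginning of epoch `j`. -/
def run (S : LQR dx du) (c : Consts) (K₀ : Matrix (Fin du) (Fin dx) ℝ)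
    (w : ℕ → Fin dx → ℝ) (G : ℕ → ℕ → Matrix (Fin du) (Fin dx) ℝ) :
    ℕ → Matrix (Fin du) (Fin dx) ℝ × (Fin dx → ℝ)
  | 0 => (K₀, 0)
  | j + 1 =>
      ((run S c K₀ w G j).1
          - c.η • gradEst S c w G j (run S c K₀ w G j).1 (run S c K₀ w G j).2,
        subState S c w G j (run S c K₀ w G j).1 (run S c K₀ w G j).2 (c.m dx du j))

/-- The underlying controller `K_j` of epoch `j`. -/
def ctrl (S : LQR dx du) (c : Consts) (K₀ : Matrix (Fin du) (Fin dx) ℝ)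
    (w : ℕ → Fin dx → ℝ) (G : ℕ → ℕ → Matrix (Fin du) (Fin dx) ℝ) (j : ℕ) :
    Matrix (Fin du) (Fin dx) ℝ :=
  (run S c K₀ w G j).1

/-- The perturbed controller `K_{j,i}` played in sub-epoch `i` of epoch `j`. -/
def subCtrl (S : LQR dx du) (c : Consts) (K₀ : Matrix (Fin du) (Fin dx) ℝ)
    (w : ℕ → Fin dx → ℝ) (G : ℕ → ℕ → Matrix (Fin du) (Fin dx) ℝ) (j i : ℕ) :
    Matrix (Fin du) (Fin dx) ℝ :=
  perturb c j (ctrl S c K₀ w G j) (G j i)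

end Algorithm

/-- The second moment matrix `𝔼 v vᵀ`. -/
def secondMoment {Ω : Type*} [MeasurableSpace Ω] (P : Measure Ω) {n : ℕ}
    (v : Ω → Fin n → ℝ) : Matrix (Fin n) (Fin n) ℝ :=
  Matrix.of fun a b => ∫ ω, v ω a * v ω b ∂P

end OnlineLQR

end

/-! In epoch `j` every perturbed controller lies within Frobenius distance `r_j` of `K_j`. If
`J(K_j) ≤ ν/2`, then on that ball the cost is its linearization at `K_j` up to a remainder whose
Lipschitz constant is proportional to `r_j` (`cost_linearization`). Summing over the epoch, the
regret is at most `r_j ⟨∇J(K_j), ∑ U_{j,i}⟩` plus a multiple of `m_j r_j²`. The gradient is the same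
in all sub-epochs and the directions are independent and centred, so Azuma's inequality in Hilbert
space (`azuma`) bounds `‖∑ U_{j,i}‖` by `√(2 m_j log(240 T⁴/δ))` with high probability.
`regret_bound` turns this into the claimed form; the constant inside the logarithm is absorbed by
the quadratic term because `r_j √m_j ≥ 1`.

It remains to see that `J(K_j) ≤ ν/2` persists (`good_succ`, `measure_goodEvent_compl_le`). The
gradient estimate of a completed epoch has three errors: a martingale deviation, again bounded by
`azuma`; a mixing error, because a cost is observed after finitely many rounds; and the bias of
one-point estimation on a sphere. The choices of `m_j`, `τ` and `r_j` make their sum at most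
`ν/(16κ²)` (`grad_error_le`). With such an error a gradient step either does not increase the cost,
or the gradient is so small that gradient domination puts the cost near `ν/4` already (`step_mem`).
The comparator in gradient domination is `K₀` itself, so no optimal controller is needed. A union
bound over at most `T` earlier epochs finishes the argument.

The control theory rests on comparing solutions of discrete Lyapunov equations: a source term
dominated by that of the covariance or of the value matrix has a solution dominated by it, and the
traces of these matrices are bounded by the cost (`frobNorm_lyap_le`). Stability of nearby
controllers is a conclusion, since the value matrix of `K_j` remains a Lyapunov function for them
(`near_mem`).

The bias estimate avoids smoothing and integration by parts: reflecting the direction in a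
hyperplane shows that a Lipschitz function is nearly uncorrelated with a uniform direction
(`abs_integral_lip_le`). Azuma's inequality uses that `cosh (l ‖S‖)` grows in conditional mean by at
most a factor `cosh (l c)`, because `cosh x` is convex in `x²`. -/

noncomputable section

open scoped Matrix.Norms.L2Operator Topology

namespace OnlineLQR

/-! ### Matrix norms and positive semidefinite matrices -/

section MatrixNorms

variable {k m n : ℕ}

/-- The entries of a matrix as a Euclidean vector. -/
def vecE (M : Matrix (Fin m) (Fin n) ℝ) : EuclideanSpace ℝ (Fin m × Fin n) :=
  WithLp.toLp 2 fun p => M p.1 p.2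

@[simp] lemma vecE_apply (M : Matrix (Fin m) (Fin n) ℝ) (p : Fin m × Fin n) :
    vecE M p = M p.1 p.2 := rfl

lemma vecE_add (M N : Matrix (Fin m) (Fin n) ℝ) : vecE (M + N) = vecE M + vecE N := by
  ext p; simp

lemma vecE_sub (M N : Matrix (Fin m) (Fin n) ℝ) : vecE (M - N) = vecE M - vecE N := by
  ext p; simp

lemma vecE_smul (a : ℝ) (M : Matrix (Fin m) (Fin n) ℝ) : vecE (a • M) = a • vecE M := by
  ext p; simp

/-- The Frobenius inner product. -/
def fip (M N : Matrix (Fin m) (Fin n) ℝ) : ℝ := ∑ a, ∑ b, M a b * N a b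

lemma frobNorm_eq (M : Matrix (Fin m) (Fin n) ℝ) : frobNorm M = ‖vecE M‖ := by
  rw [frobNorm, EuclideanSpace.norm_eq, Fintype.sum_prod_type]; simp

lemma fip_eq (M N : Matrix (Fin m) (Fin n) ℝ) : fip M N = inner ℝ (vecE M) (vecE N) := by
  rw [fip, PiLp.inner_apply, Fintype.sum_prod_type]
  simp [mul_comm]

lemma fip_eq_trace (M N : Matrix (Fin m) (Fin n) ℝ) : fip M N = (M * Nᵀ).trace := by
  simp [fip, Matrix.trace, Matrix.mul_apply]

lemma fip_eq_trace' (M N : Matrix (Fin m) (Fin n) ℝ) : fip M N = (Mᵀ * N).trace := by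
  rw [fip, Finset.sum_comm]
  simp [Matrix.trace, Matrix.mul_apply]

lemma frobNorm_nonneg (M : Matrix (Fin m) (Fin n) ℝ) : 0 ≤ frobNorm M := Real.sqrt_nonneg _

lemma frobNorm_sq (M : Matrix (Fin m) (Fin n) ℝ) : frobNorm M ^ 2 = ∑ a, ∑ b, M a b ^ 2 :=
  Real.sq_sqrt (Finset.sum_nonneg fun _ _ => Finset.sum_nonneg fun _ _ => sq_nonneg _)

lemma fip_self (M : Matrix (Fin m) (Fin n) ℝ) : fip M M = frobNorm M ^ 2 := by
  rw [frobNorm_sq, fip]; simp [sq]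

lemma abs_fip_le (M N : Matrix (Fin m) (Fin n) ℝ) : |fip M N| ≤ frobNorm M * frobNorm N := by
  rw [fip_eq, frobNorm_eq, frobNorm_eq]; exact abs_real_inner_le_norm _ _

lemma fip_le (M N : Matrix (Fin m) (Fin n) ℝ) : fip M N ≤ frobNorm M * frobNorm N :=
  (le_abs_self _).trans (abs_fip_le M N)

lemma fip_comm (M N : Matrix (Fin m) (Fin n) ℝ) : fip M N = fip N M := by
  simp [fip, mul_comm]

lemma fip_add_right (M N N' : Matrix (Fin m) (Fin n) ℝ) :
    fip M (N + N') = fip M N + fip M N' := by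
  simp only [fip_eq, vecE_add, inner_add_right]

lemma fip_sub_right (M N N' : Matrix (Fin m) (Fin n) ℝ) :
    fip M (N - N') = fip M N - fip M N' := by
  simp only [fip_eq, vecE_sub, inner_sub_right]

lemma fip_smul_right (a : ℝ) (M N : Matrix (Fin m) (Fin n) ℝ) : fip M (a • N) = a * fip M N := by
  simp only [fip_eq, vecE_smul, real_inner_smul_right]

lemma frobNorm_add_le (M N : Matrix (Fin m) (Fin n) ℝ) :
    frobNorm (M + N) ≤ frobNorm M + frobNorm N := by
  simp only [frobNorm_eq, vecE_add]; exact norm_add_le _ _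

lemma frobNorm_sub_le (M N : Matrix (Fin m) (Fin n) ℝ) :
    frobNorm (M - N) ≤ frobNorm M + frobNorm N := by
  simp only [frobNorm_eq, vecE_sub]; exact norm_sub_le _ _

lemma frobNorm_smul (a : ℝ) (M : Matrix (Fin m) (Fin n) ℝ) :
    frobNorm (a • M) = |a| * frobNorm M := by
  simp only [frobNorm_eq, vecE_smul, norm_smul, Real.norm_eq_abs]

lemma frobNorm_zero : frobNorm (0 : Matrix (Fin m) (Fin n) ℝ) = 0 := by simp [frobNorm]

lemma frobNorm_transpose (M : Matrix (Fin m) (Fin n) ℝ) : frobNorm Mᵀ = frobNorm M := by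
  rw [frobNorm, frobNorm, Finset.sum_comm]; rfl

lemma euclNorm_nonneg (x : Fin n → ℝ) : 0 ≤ euclNorm x := norm_nonneg _

lemma euclNorm_sq (x : Fin n → ℝ) : euclNorm x ^ 2 = x ⬝ᵥ x := by
  rw [euclNorm, EuclideanSpace.norm_sq_eq]; simp [dotProduct, sq]

lemma euclNorm_add_le (x y : Fin n → ℝ) : euclNorm (x + y) ≤ euclNorm x + euclNorm y := by
  rw [euclNorm, WithLp.toLp_add]; exact norm_add_le _ _

lemma abs_dotProduct_le (x y : Fin n → ℝ) : |x ⬝ᵥ y| ≤ euclNorm x * euclNorm y := by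
  have := abs_real_inner_le_norm (WithLp.toLp 2 x) (WithLp.toLp 2 y)
  rwa [EuclideanSpace.inner_eq_star_dotProduct, star_trivial, dotProduct_comm] at this

lemma specNorm_eq (M : Matrix (Fin m) (Fin n) ℝ) : specNorm M = ‖M‖ := by
  rw [specNorm, Matrix.l2_opNorm_def]; rfl

lemma euclNorm_mulVec_le (M : Matrix (Fin m) (Fin n) ℝ) (x : Fin n → ℝ) :
    euclNorm (M *ᵥ x) ≤ ‖M‖ * euclNorm x :=
  Matrix.l2_opNorm_mulVec M (WithLp.toLp 2 x)

lemma norm_le_of_mulVec (M : Matrix (Fin m) (Fin n) ℝ) {c : ℝ} (hc : 0 ≤ c)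
    (h : ∀ x, euclNorm (M *ᵥ x) ≤ c * euclNorm x) : ‖M‖ ≤ c := by
  rw [← specNorm_eq, specNorm]
  exact ContinuousLinearMap.opNorm_le_bound _ hc fun x => h x.ofLp

lemma norm_transpose (M : Matrix (Fin m) (Fin n) ℝ) : ‖Mᵀ‖ = ‖M‖ := by
  rw [← Matrix.conjTranspose_eq_transpose_of_trivial, Matrix.l2_opNorm_conjTranspose]

lemma dotProduct_mulVec_le (M : Matrix (Fin m) (Fin n) ℝ) (x : Fin m → ℝ) (y : Fin n → ℝ) :
    |x ⬝ᵥ M *ᵥ y| ≤ ‖M‖ * (euclNorm x * euclNorm y) :=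
  (abs_dotProduct_le _ _).trans <| by
    nlinarith [mul_le_mul_of_nonneg_left (euclNorm_mulVec_le M y) (euclNorm_nonneg x)]

lemma frobNorm_sq_eq_sum_col (M : Matrix (Fin m) (Fin n) ℝ) :
    frobNorm M ^ 2 = ∑ b, euclNorm (fun a => M a b) ^ 2 := by
  rw [frobNorm_sq, Finset.sum_comm]
  simp_rw [euclNorm_sq, dotProduct, sq]

lemma frobNorm_mul_le (M : Matrix (Fin k) (Fin m) ℝ) (N : Matrix (Fin m) (Fin n) ℝ) :
    frobNorm (M * N) ≤ ‖M‖ * frobNorm N := by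
  refine abs_le_of_sq_le_sq' ?_ (mul_nonneg (norm_nonneg _) (frobNorm_nonneg _)) |>.2
  rw [mul_pow, frobNorm_sq_eq_sum_col, frobNorm_sq_eq_sum_col, Finset.mul_sum]
  refine Finset.sum_le_sum fun b _ => ?_
  rw [← mul_pow]
  exact pow_le_pow_left₀ (euclNorm_nonneg _) (euclNorm_mulVec_le M fun a => N a b) 2

lemma frobNorm_mul_le' (M : Matrix (Fin k) (Fin m) ℝ) (N : Matrix (Fin m) (Fin n) ℝ) :
    frobNorm (M * N) ≤ frobNorm M * ‖N‖ := by
  rw [← frobNorm_transpose, Matrix.transpose_mul, ← frobNorm_transpose M, ← norm_transpose N,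
    mul_comm]
  exact frobNorm_mul_le _ _

lemma norm_le_frobNorm (M : Matrix (Fin m) (Fin n) ℝ) : ‖M‖ ≤ frobNorm M := by
  refine norm_le_of_mulVec M (frobNorm_nonneg M) fun x => ?_
  refine abs_le_of_sq_le_sq' ?_ (mul_nonneg (frobNorm_nonneg _) (euclNorm_nonneg _)) |>.2
  rw [mul_pow, frobNorm_sq, euclNorm_sq, euclNorm_sq, Finset.sum_mul]
  refine Finset.sum_le_sum fun a _ => ?_
  have := Finset.sum_mul_sq_le_sq_mul_sq Finset.univ (M a) x
  simp only [Matrix.mulVec, dotProduct, ← sq]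
  exact this

lemma norm_mul_le_of_le {M : Matrix (Fin k) (Fin m) ℝ} {N : Matrix (Fin m) (Fin n) ℝ} {a b : ℝ}
    (hM : ‖M‖ ≤ a) (hN : ‖N‖ ≤ b) : ‖M * N‖ ≤ a * b :=
  (Matrix.l2_opNorm_mul M N).trans
    (mul_le_mul hM hN (norm_nonneg _) ((norm_nonneg _).trans hM))

lemma mulVec_dotProduct_mulVec (M : Matrix (Fin m) (Fin n) ℝ) (N : Matrix (Fin m) (Fin k) ℝ)
    (x : Fin n → ℝ) (y : Fin k → ℝ) : (M *ᵥ x) ⬝ᵥ (N *ᵥ y) = x ⬝ᵥ ((Mᵀ * N) *ᵥ y) := by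
  rw [← Matrix.mulVec_mulVec, Matrix.dotProduct_mulVec x, Matrix.vecMul_transpose]

/-- Real matrices: positive semidefinite means symmetric with nonnegative quadratic form. -/
lemma posSemidef_iff_real {M : Matrix (Fin n) (Fin n) ℝ} :
    M.PosSemidef ↔ Mᵀ = M ∧ ∀ x : Fin n → ℝ, 0 ≤ x ⬝ᵥ M *ᵥ x := by
  rw [Matrix.posSemidef_iff_dotProduct_mulVec, Matrix.IsHermitian,
    Matrix.conjTranspose_eq_transpose_of_trivial]
  simp

lemma dot_nonneg {M : Matrix (Fin n) (Fin n) ℝ} (h : M.PosSemidef) (x : Fin n → ℝ) :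
    0 ≤ x ⬝ᵥ M *ᵥ x := (posSemidef_iff_real.1 h).2 x

lemma PosSemidef.symm' {M : Matrix (Fin n) (Fin n) ℝ} (h : M.PosSemidef) : Mᵀ = M :=
  (posSemidef_iff_real.1 h).1

lemma PosSemidef.conj {M : Matrix (Fin n) (Fin n) ℝ} (h : M.PosSemidef)
    (A : Matrix (Fin m) (Fin n) ℝ) : (A * M * Aᵀ).PosSemidef := by
  have := h.mul_mul_conjTranspose_same A
  rwa [Matrix.conjTranspose_eq_transpose_of_trivial] at this

lemma PosSemidef.conj' {M : Matrix (Fin n) (Fin n) ℝ} (h : M.PosSemidef)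
    (A : Matrix (Fin n) (Fin m) ℝ) : (Aᵀ * M * A).PosSemidef := by
  have := h.conjTranspose_mul_mul_same A
  rwa [Matrix.conjTranspose_eq_transpose_of_trivial] at this

/-- Decompose `N` into rank-one terms `v vᵀ`; each contributes the quadratic form of `M` at `v`. -/
lemma trace_mul_nonneg {M N : Matrix (Fin n) (Fin n) ℝ} (hM : M.PosSemidef)
    (hN : N.PosSemidef) : 0 ≤ (M * N).trace := by
  obtain ⟨q, v, rfl⟩ := Matrix.posSemidef_iff_eq_sum_vecMulVec.1 hN
  rw [Finset.mul_sum, Matrix.trace_sum]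
  refine Finset.sum_nonneg fun i _ => ?_
  rw [Matrix.mul_vecMulVec, Matrix.trace_vecMulVec, star_trivial, dotProduct_comm]
  exact dot_nonneg hM _

lemma trace_mul_mono {M M' N : Matrix (Fin n) (Fin n) ℝ} (hM : (M' - M).PosSemidef)
    (hN : N.PosSemidef) : (M * N).trace ≤ (M' * N).trace := by
  have := trace_mul_nonneg hM hN
  rw [Matrix.sub_mul, Matrix.trace_sub] at this
  linarith

/-- Test the two forms at `e_a + s e_b` and `e_a - s e_b` and add: the diagonal entries of `D` and
the off-diagonal entries of `X` cancel. -/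
lemma sandwich_dot_le {X D : Matrix (Fin n) (Fin n) ℝ} {t : ℝ} (hD : Dᵀ = D)
    (h1 : (t • X - D).PosSemidef) (h2 : (t • X + D).PosSemidef) (a b : Fin n) (s : ℝ) :
    2 * s * D a b ≤ t * (X a a + s ^ 2 * X b b) := by
  have e1 := dot_nonneg h1 (Pi.single a 1 + s • Pi.single b 1)
  have e2 := dot_nonneg h2 (Pi.single a 1 - s • Pi.single b 1)
  have hs : D b a = D a b := congrFun (congrFun hD a) b
  simp [Matrix.mulVec_add, Matrix.mulVec_sub, Matrix.mulVec_smul, add_dotProduct,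
    sub_dotProduct, hs] at e1 e2
  linarith

/-- The preceding inequality is a quadratic in `s` without sign change, so its discriminant gives
`D_ab² ≤ t² X_aa X_bb`. The sum over `a, b` is the square of `t` times the trace. -/
lemma frobNorm_le_of_sandwich {X D : Matrix (Fin n) (Fin n) ℝ} {t : ℝ} (ht : 0 ≤ t)
    (hX : X.PosSemidef) (hD : Dᵀ = D)
    (h1 : (t • X - D).PosSemidef) (h2 : (t • X + D).PosSemidef) :
    frobNorm D ≤ t * X.trace := by
  have hd : ∀ a, 0 ≤ X a a := fun a => hX.diag_nonneg
  have key : ∀ a b, D a b ^ 2 ≤ t ^ 2 * (X a a * X b b) := by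
    intro a b
    have h : ∀ s : ℝ, 0 ≤ (t * X b b) * (s * s) + (-2 * D a b) * s + t * X a a := fun s => by
      have := sandwich_dot_le hD h1 h2 a b s
      nlinarith
    have := discrim_le_zero h
    rw [discrim] at this
    nlinarith
  refine abs_le_of_sq_le_sq' ?_ (mul_nonneg ht hX.trace_nonneg) |>.2
  rw [frobNorm_sq, mul_pow, Matrix.trace, sq (∑ i, _), Finset.sum_mul_sum, Finset.mul_sum]
  refine Finset.sum_le_sum fun a _ => ?_
  rw [Finset.mul_sum]
  exact Finset.sum_le_sum fun b _ => key a b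

lemma frobNorm_le_trace {X : Matrix (Fin n) (Fin n) ℝ} (hX : X.PosSemidef) :
    frobNorm X ≤ X.trace := by
  have := frobNorm_le_of_sandwich zero_le_one hX (PosSemidef.symm' hX)
    (by rw [one_smul, sub_self]; exact .zero) (by rw [one_smul]; exact hX.add hX)
  rwa [one_mul] at this

lemma norm_le_trace {X : Matrix (Fin n) (Fin n) ℝ} (hX : X.PosSemidef) : ‖X‖ ≤ X.trace :=
  (norm_le_frobNorm X).trans (frobNorm_le_trace hX)

lemma dot_le_norm (M : Matrix (Fin n) (Fin n) ℝ) (x : Fin n → ℝ) :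
    |x ⬝ᵥ M *ᵥ x| ≤ ‖M‖ * (x ⬝ᵥ x) := by
  rw [← euclNorm_sq, sq]; exact dotProduct_mulVec_le M x x

/-- A symmetric matrix of norm at most `c` is at most `(c / s) S` if `s I ≤ S`. -/
lemma posSemidef_smul_sub {S N : Matrix (Fin n) (Fin n) ℝ} {s c : ℝ} (hs : 0 < s)
    (hSs : Sᵀ = S) (hS : ∀ x : Fin n → ℝ, s * (x ⬝ᵥ x) ≤ x ⬝ᵥ S *ᵥ x) (hN : Nᵀ = N) (hc : ‖N‖ ≤ c) :
    ((c / s) • S - N).PosSemidef := by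
  refine posSemidef_iff_real.2 ⟨by simp [hSs, hN], fun x => ?_⟩
  have hc0 : 0 ≤ c := (norm_nonneg _).trans hc
  have h1 := (abs_le.1 (dot_le_norm N x)).2
  have hx : 0 ≤ x ⬝ᵥ x := by rw [← euclNorm_sq]; positivity
  have h2 : c * (x ⬝ᵥ x) ≤ (c / s) * (x ⬝ᵥ S *ᵥ x) := by
    have := mul_le_mul_of_nonneg_left (hS x) (div_nonneg hc0 hs.le)
    rwa [← mul_assoc, div_mul_cancel₀ _ hs.ne'] at this
  rw [Matrix.sub_mulVec, Matrix.smul_mulVec, dotProduct_sub, dotProduct_smul, smul_eq_mul]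
  nlinarith

end MatrixNorms

/-! ### Discrete Lyapunov equations -/

section Lyapunov

variable {n : ℕ}

/-- A matrix with square summable powers. -/
def StableMat (L : Matrix (Fin n) (Fin n) ℝ) : Prop := Summable fun k : ℕ => ‖L ^ k‖ ^ 2

/-- The solution `∑ Lᵏ M (Lᵏ)ᵀ` of the Lyapunov equation `X = M + L X Lᵀ`. -/
def lyap (L M : Matrix (Fin n) (Fin n) ℝ) : Matrix (Fin n) (Fin n) ℝ :=
  ∑' k : ℕ, L ^ k * M * (L ^ k)ᵀ

lemma StableMat.transpose {L : Matrix (Fin n) (Fin n) ℝ} (h : StableMat L) : StableMat Lᵀ := by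
  unfold StableMat at *
  simpa only [← Matrix.transpose_pow, norm_transpose] using h

lemma StableMat.tendsto {L : Matrix (Fin n) (Fin n) ℝ} (h : StableMat L) :
    Tendsto (fun k : ℕ => ‖L ^ k‖ ^ 2) atTop (𝓝 0) := h.tendsto_atTop_zero

lemma StableMat.summable {L : Matrix (Fin n) (Fin n) ℝ} (h : StableMat L)
    (M : Matrix (Fin n) (Fin n) ℝ) : Summable fun k : ℕ => L ^ k * M * (L ^ k)ᵀ := by
  refine Summable.of_norm_bounded (h.mul_left ‖M‖) fun k => ?_
  refine (norm_mul_le_of_le (norm_mul_le_of_le le_rfl le_rfl) (norm_transpose _).le).trans ?_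
  rw [sq]; linarith [mul_comm (‖L ^ k‖ * ‖M‖) ‖L ^ k‖, mul_comm ‖L ^ k‖ ‖M‖,
    mul_left_comm ‖L ^ k‖ ‖L ^ k‖ ‖M‖, mul_assoc ‖M‖ ‖L ^ k‖ ‖L ^ k‖,
    mul_assoc ‖L ^ k‖ ‖L ^ k‖ ‖M‖, mul_comm (‖L ^ k‖ * ‖L ^ k‖) ‖M‖]

lemma lyap_eq {L : Matrix (Fin n) (Fin n) ℝ} (h : StableMat L) (M : Matrix (Fin n) (Fin n) ℝ) :
    lyap L M = M + L * lyap L M * Lᵀ := by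
  have hs := h.summable M
  conv_lhs => rw [lyap, hs.tsum_eq_zero_add]
  simp only [pow_zero, one_mul, Matrix.transpose_one, mul_one]
  rw [lyap, ← hs.tsum_mul_left, ← (hs.mul_left L).tsum_mul_right]
  congr 1
  refine tsum_congr fun k => ?_
  rw [pow_succ', Matrix.transpose_mul]
  simp only [mul_assoc]

lemma lyap_symm (L : Matrix (Fin n) (Fin n) ℝ) {M : Matrix (Fin n) (Fin n) ℝ} (hM : Mᵀ = M) :
    (lyap L M)ᵀ = lyap L M := by
  rw [lyap, Matrix.transpose_tsum]
  refine tsum_congr fun k => ?_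
  simp [Matrix.transpose_mul, hM, mul_assoc]

/-- Supersolutions of the homogeneous Lyapunov equation are positive semidefinite. -/
lemma posSemidef_of_lyap {L Z : Matrix (Fin n) (Fin n) ℝ} (h : StableMat L) (hZ : Zᵀ = Z)
    (hL : (Z - L * Z * Lᵀ).PosSemidef) : Z.PosSemidef := by
  refine posSemidef_iff_real.2 ⟨hZ, fun x => ?_⟩
  have step : ∀ k : ℕ, (Z - L ^ k * Z * (L ^ k)ᵀ).PosSemidef := by
    intro k
    induction k with
    | zero => simpa using Matrix.PosSemidef.zero
    | succ k ih =>
      have := ih.add (PosSemidef.conj hL (L ^ k))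
      convert this using 1
      rw [pow_succ, Matrix.transpose_mul]
      noncomm_ring
  have hk : ∀ k : ℕ, -(‖L ^ k‖ ^ 2 * (‖Z‖ * (x ⬝ᵥ x))) ≤ x ⬝ᵥ Z *ᵥ x := by
    intro k
    have h1 := dot_nonneg (step k) x
    rw [Matrix.sub_mulVec, dotProduct_sub] at h1
    have h2 := (abs_le.1 (dot_le_norm (L ^ k * Z * (L ^ k)ᵀ) x)).1
    have h3 : ‖L ^ k * Z * (L ^ k)ᵀ‖ ≤ ‖L ^ k‖ * ‖Z‖ * ‖L ^ k‖ :=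
      norm_mul_le_of_le (norm_mul_le_of_le le_rfl le_rfl) (norm_transpose _).le
    have hx : 0 ≤ x ⬝ᵥ x := by rw [← euclNorm_sq]; positivity
    nlinarith [mul_le_mul_of_nonneg_right h3 hx]
  have hlim : Tendsto (fun k : ℕ => -(‖L ^ k‖ ^ 2 * (‖Z‖ * (x ⬝ᵥ x)))) atTop (𝓝 0) := by
    simpa using (h.tendsto.mul_const (‖Z‖ * (x ⬝ᵥ x))).neg
  exact le_of_tendsto' hlim hk

lemma lyap_posSemidef {L M : Matrix (Fin n) (Fin n) ℝ} (h : StableMat L) (hM : M.PosSemidef) :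
    (lyap L M).PosSemidef := by
  refine posSemidef_of_lyap h (lyap_symm L (PosSemidef.symm' hM)) ?_
  rw [sub_eq_of_eq_add (lyap_eq h M)]
  exact hM

/-- If `D = N + L D Lᵀ` and `N ≤ t M` then `D ≤ t X` for the solution `X` of
`X = M + L X Lᵀ`. -/
lemma lyap_le {L M N D X : Matrix (Fin n) (Fin n) ℝ} {t : ℝ} (h : StableMat L)
    (hX : X = M + L * X * Lᵀ) (hXs : Xᵀ = X) (hD : D = N + L * D * Lᵀ) (hDs : Dᵀ = D)
    (hN : (t • M - N).PosSemidef) : (t • X - D).PosSemidef := by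
  refine posSemidef_of_lyap h (by simp [hXs, hDs]) ?_
  have : t • X - D - L * (t • X - D) * Lᵀ = t • M - N := by
    conv_lhs =>
      enter [1]; rw [hX, hD]
    simp only [Matrix.mul_sub, Matrix.sub_mul, smul_add, Matrix.mul_smul, Matrix.smul_mul]
    abel
  rwa [this]

/-- Since `M ⪰ s I`, both `N` and `-N` lie below `(c/s) M`; by comparison `D` and `-D` lie below
`(c/s) X`. The bound features the trace of `X`, which the cost controls, so neither the dimension
nor the decay rate of the powers of `L` enters separately. -/
lemma frobNorm_lyap_le {L M N D X : Matrix (Fin n) (Fin n) ℝ} {s c : ℝ} (h : StableMat L)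
    (hX : X = M + L * X * Lᵀ) (hXp : X.PosSemidef) (hD : D = N + L * D * Lᵀ) (hDs : Dᵀ = D)
    (hs : 0 < s) (hMs : Mᵀ = M) (hM : ∀ x : Fin n → ℝ, s * (x ⬝ᵥ x) ≤ x ⬝ᵥ M *ᵥ x)
    (hNs : Nᵀ = N) (hc : ‖N‖ ≤ c) : frobNorm D ≤ c / s * X.trace := by
  have hXs := PosSemidef.symm' hXp
  refine frobNorm_le_of_sandwich (div_nonneg ((norm_nonneg _).trans hc) hs.le) hXp hDs
    (lyap_le h hX hXs hD hDs (posSemidef_smul_sub hs hMs hM hNs hc)) ?_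
  have := lyap_le (D := -D) (N := -N) h hX hXs
    (by conv_lhs => rw [hD]
        rw [Matrix.mul_neg, Matrix.neg_mul, neg_add])
    (by rw [Matrix.transpose_neg, hDs])
    (posSemidef_smul_sub (c := c) hs hMs hM (by rw [Matrix.transpose_neg, hNs])
      (by rw [norm_neg]; exact hc))
  rwa [sub_neg_eq_add] at this

end Lyapunov

/-! ### Cost of a stabilizing controller -/

section Cost

variable {dx du : ℕ}

namespace LQR

/-- The closed loop matrix `A + B K`. -/
def cl (S : LQR dx du) (K : Matrix (Fin du) (Fin dx) ℝ) : Matrix (Fin dx) (Fin dx) ℝ :=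
  S.A + S.B * K

/-- The closed loop cost matrix `Q + Kᵀ R K`. -/
def cm (S : LQR dx du) (K : Matrix (Fin du) (Fin dx) ℝ) : Matrix (Fin dx) (Fin dx) ℝ :=
  S.Q + Kᵀ * S.R * K

/-- The expected cost after `n` rounds started from the origin, for noise covariance `N`. -/
def costN (S : LQR dx du) (N : Matrix (Fin dx) (Fin dx) ℝ) (K : Matrix (Fin du) (Fin dx) ℝ)
    (n : ℕ) : ℝ :=
  ∑ s ∈ Finset.range n, (S.cm K * (S.cl K ^ s * N * (S.cl K ^ s)ᵀ)).trace

/-- The stationary state covariance. -/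
def cov (S : LQR dx du) (N : Matrix (Fin dx) (Fin dx) ℝ) (K : Matrix (Fin du) (Fin dx) ℝ) :
    Matrix (Fin dx) (Fin dx) ℝ := lyap (S.cl K) N

/-- The value matrix. -/
def val (S : LQR dx du) (K : Matrix (Fin du) (Fin dx) ℝ) :
    Matrix (Fin dx) (Fin dx) ℝ := lyap (S.cl K)ᵀ (S.cm K)

/-- The real-valued long run average cost of a stabilizing controller. -/
def cost (S : LQR dx du) (N : Matrix (Fin dx) (Fin dx) ℝ) (K : Matrix (Fin du) (Fin dx) ℝ) : ℝ :=
  (S.cm K * S.cov N K).trace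

/-- The matrix `R + Bᵀ P B`. -/
def hess (S : LQR dx du) (K : Matrix (Fin du) (Fin dx) ℝ) : Matrix (Fin du) (Fin du) ℝ :=
  S.R + S.Bᵀ * S.val K * S.B

/-- The matrix `R K + Bᵀ P (A + B K)`. -/
def natGrad (S : LQR dx du) (K : Matrix (Fin du) (Fin dx) ℝ) : Matrix (Fin du) (Fin dx) ℝ :=
  S.R * K + S.Bᵀ * S.val K * S.cl K

/-- The gradient of the cost. -/
def grad (S : LQR dx du) (N : Matrix (Fin dx) (Fin dx) ℝ) (K : Matrix (Fin du) (Fin dx) ℝ) :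
    Matrix (Fin du) (Fin dx) ℝ := (2 : ℝ) • (S.natGrad K * S.cov N K)

end LQR

/-- The assumptions on the system, with noise covariance `N`, and on the constants. -/
structure Regular (S : LQR dx du) (N : Matrix (Fin dx) (Fin dx) ℝ) (α ψ σ κ ν : ℝ) : Prop where
  hα : 0 < α
  hα1 : α ≤ 1
  hψ : 1 ≤ ψ
  hσ : 0 < σ
  hκ : 2 ≤ κ
  hν : ν = κ ^ 2 * (α * σ ^ 2)
  Qs : S.Qᵀ = S.Q
  Rs : S.Rᵀ = S.R
  Ns : Nᵀ = N
  hQ : ∀ x : Fin dx → ℝ, α * (x ⬝ᵥ x) ≤ x ⬝ᵥ S.Q *ᵥ x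
  hR : ∀ x : Fin du → ℝ, α * (x ⬝ᵥ x) ≤ x ⬝ᵥ S.R *ᵥ x
  hN : ∀ x : Fin dx → ℝ, σ ^ 2 * (x ⬝ᵥ x) ≤ x ⬝ᵥ N *ᵥ x
  hR1 : ‖S.R‖ ≤ 1
  hB : ‖S.B‖ ≤ ψ

lemma posSemidef_of_lower {n : ℕ} {M : Matrix (Fin n) (Fin n) ℝ} {s : ℝ} (hs : 0 ≤ s)
    (hM : Mᵀ = M) (h : ∀ x : Fin n → ℝ, s * (x ⬝ᵥ x) ≤ x ⬝ᵥ M *ᵥ x) : M.PosSemidef :=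
  posSemidef_iff_real.2 ⟨hM, fun x => le_trans
    (mul_nonneg hs (by rw [← euclNorm_sq]; positivity)) (h x)⟩

lemma le_trace_mul {n : ℕ} {M Y : Matrix (Fin n) (Fin n) ℝ} {s : ℝ}
    (hM : Mᵀ = M) (h : ∀ x : Fin n → ℝ, s * (x ⬝ᵥ x) ≤ x ⬝ᵥ M *ᵥ x) (hY : Y.PosSemidef) :
    s * Y.trace ≤ (M * Y).trace := by
  have h1 : (M - s • (1 : Matrix (Fin n) (Fin n) ℝ)).PosSemidef := by
    refine posSemidef_iff_real.2 ⟨by simp [hM], fun x => ?_⟩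
    rw [Matrix.sub_mulVec, dotProduct_sub, Matrix.smul_mulVec, Matrix.one_mulVec, dotProduct_smul,
      smul_eq_mul]
    linarith [h x]
  have := trace_mul_mono h1 hY
  simpa using this

namespace Regular

variable {S : LQR dx du} {N : Matrix (Fin dx) (Fin dx) ℝ} {α ψ σ κ ν : ℝ}
  {K K' : Matrix (Fin du) (Fin dx) ℝ}

lemma N_psd (h : Regular S N α ψ σ κ ν) : N.PosSemidef :=
  posSemidef_of_lower (sq_nonneg σ) h.Ns h.hN

lemma Q_psd (h : Regular S N α ψ σ κ ν) : S.Q.PosSemidef :=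
  posSemidef_of_lower h.hα.le h.Qs h.hQ

lemma R_psd (h : Regular S N α ψ σ κ ν) : S.R.PosSemidef :=
  posSemidef_of_lower h.hα.le h.Rs h.hR

lemma cm_psd (h : Regular S N α ψ σ κ ν) (K : Matrix (Fin du) (Fin dx) ℝ) :
    (S.cm K).PosSemidef := h.Q_psd.add (PosSemidef.conj' h.R_psd K)

lemma cm_ge (h : Regular S N α ψ σ κ ν) (K : Matrix (Fin du) (Fin dx) ℝ) (x : Fin dx → ℝ) :
    α * (x ⬝ᵥ x) ≤ x ⬝ᵥ S.cm K *ᵥ x := by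
  rw [LQR.cm, Matrix.add_mulVec, dotProduct_add]
  linarith [h.hQ x, dot_nonneg (PosSemidef.conj' h.R_psd K) x]

/-- Each term of the cost series dominates the squared norm of a power of the closed loop matrix.
Bounded finite-horizon costs therefore force stability in the sense of `StableMat`. -/
lemma term_ge (h : Regular S N α ψ σ κ ν) (K : Matrix (Fin du) (Fin dx) ℝ)
    (M : Matrix (Fin dx) (Fin dx) ℝ) :
    α * σ ^ 2 * ‖M‖ ^ 2 ≤ (S.cm K * (M * N * Mᵀ)).trace := by
  have h1 := le_trace_mul (PosSemidef.symm' (h.cm_psd K)) (h.cm_ge K) (PosSemidef.conj h.N_psd M)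
  have h2 : σ ^ 2 * frobNorm M ^ 2 ≤ (M * N * Mᵀ).trace := by
    have := le_trace_mul h.Ns h.hN (PosSemidef.conj' (m := dx) .one M)
    have e1 : (Mᵀ * M).trace = frobNorm M ^ 2 := by
      rw [← fip_self, fip_eq_trace, Matrix.trace_mul_comm]
    have e2 : (N * (Mᵀ * M)).trace = (M * N * Mᵀ).trace := by
      rw [← Matrix.mul_assoc, Matrix.trace_mul_comm, ← Matrix.mul_assoc]
    rwa [Matrix.mul_one, e1, e2] at this
  have h3 : ‖M‖ ^ 2 ≤ frobNorm M ^ 2 := pow_le_pow_left₀ (norm_nonneg _) (norm_le_frobNorm M) 2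
  have := h.hα
  calc α * σ ^ 2 * ‖M‖ ^ 2 ≤ α * (σ ^ 2 * frobNorm M ^ 2) := by
        rw [mul_assoc]; gcongr
    _ ≤ α * (M * N * Mᵀ).trace := by gcongr
    _ ≤ _ := h1

lemma term_nonneg (h : Regular S N α ψ σ κ ν) (K : Matrix (Fin du) (Fin dx) ℝ)
    (M : Matrix (Fin dx) (Fin dx) ℝ) : 0 ≤ (S.cm K * (M * N * Mᵀ)).trace :=
  trace_mul_nonneg (h.cm_psd K) (PosSemidef.conj h.N_psd M)

lemma costN_mono (h : Regular S N α ψ σ κ ν) (K : Matrix (Fin du) (Fin dx) ℝ) :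
    Monotone (S.costN N K) :=
  monotone_nat_of_le_succ fun n => by
    rw [LQR.costN, LQR.costN, Finset.sum_range_succ]
    linarith [h.term_nonneg K (S.cl K ^ n)]

lemma stable_of_costN_le (h : Regular S N α ψ σ κ ν) {b : ℝ} (hb : ∀ n, S.costN N K n ≤ b) :
    StableMat (S.cl K) := by
  have hpos : 0 < α * σ ^ 2 := mul_pos h.hα (pow_pos h.hσ 2)
  have hs : Summable fun s : ℕ => (S.cm K * (S.cl K ^ s * N * (S.cl K ^ s)ᵀ)).trace :=
    summable_of_sum_range_le (c := b) (fun s => h.term_nonneg K _) hb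
  refine Summable.of_nonneg_of_le (fun k => sq_nonneg _) (fun k => ?_)
    (hs.mul_left (α * σ ^ 2)⁻¹)
  rw [← div_eq_inv_mul, le_div_iff₀ hpos, mul_comm]
  exact h.term_ge K _

lemma hasSum_cost (hK : StableMat (S.cl K)) :
    HasSum (fun s : ℕ => (S.cm K * (S.cl K ^ s * N * (S.cl K ^ s)ᵀ)).trace) (S.cost N K) := by
  have h1 := (hK.summable N).hasSum
  have hc : Continuous fun M : Matrix (Fin dx) (Fin dx) ℝ => (S.cm K * M).trace := by fun_prop
  exact h1.map (AddMonoidHom.mk' (fun M : Matrix (Fin dx) (Fin dx) ℝ => (S.cm K * M).trace)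
    (fun M M' => by simp [Matrix.mul_add])) hc

/-- Duality between covariance and value matrix: cyclicity of the trace matches the two series term
by term. -/
lemma cost_eq_val (hK : StableMat (S.cl K)) : S.cost N K = (S.val K * N).trace := by
  refine (hasSum_cost hK).unique ?_
  have h1 := (hK.transpose.summable (S.cm K)).hasSum
  have hc : Continuous fun M : Matrix (Fin dx) (Fin dx) ℝ => (M * N).trace := by fun_prop
  convert h1.map (AddMonoidHom.mk' (fun M : Matrix (Fin dx) (Fin dx) ℝ => (M * N).trace)
    (fun M M' => by simp [Matrix.add_mul])) hc using 2 with s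
  swap
  · rfl
  simp only [Function.comp, AddMonoidHom.mk'_apply, ← Matrix.transpose_pow,
    Matrix.transpose_transpose]
  rw [← Matrix.mul_assoc, Matrix.trace_mul_comm]
  simp only [Matrix.mul_assoc]

lemma tendsto_costN (hK : StableMat (S.cl K)) :
    Tendsto (S.costN N K) atTop (𝓝 (S.cost N K)) := (hasSum_cost hK).tendsto_sum_nat

lemma costN_le_cost (h : Regular S N α ψ σ κ ν) (hK : StableMat (S.cl K)) (n : ℕ) :
    S.costN N K n ≤ S.cost N K :=
  (h.costN_mono K).ge_of_tendsto (tendsto_costN hK) n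

lemma cost_le (hK : StableMat (S.cl K)) {b : ℝ} (hb : ∀ n, S.costN N K n ≤ b) :
    S.cost N K ≤ b := le_of_tendsto' (tendsto_costN hK) hb

/-- The controllers of cost at most `b`. -/
def _root_.OnlineLQR.LQR.sublevel (S : LQR dx du) (N : Matrix (Fin dx) (Fin dx) ℝ) (b : ℝ) :
    Set (Matrix (Fin du) (Fin dx) ℝ) := {K | ∀ n, S.costN N K n ≤ b}

/-- Sublevel sets are defined through finite-horizon costs, which are meaningful for every
controller. Stability is thus part of the conclusion, and membership is a countable family of closed
conditions. -/
lemma mem_sublevel (h : Regular S N α ψ σ κ ν) {b : ℝ} :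
    K ∈ S.sublevel N b ↔ StableMat (S.cl K) ∧ S.cost N K ≤ b :=
  ⟨fun hb => ⟨h.stable_of_costN_le hb, cost_le (h.stable_of_costN_le hb) hb⟩,
    fun hb n => (h.costN_le_cost hb.1 n).trans hb.2⟩

end Regular

end Cost

/-! ### Bounds on a sublevel set, contraction of the closed loop, and the cost difference formula -/

namespace Regular

variable {dx du : ℕ} {S : LQR dx du} {N : Matrix (Fin dx) (Fin dx) ℝ} {α ψ σ κ ν : ℝ}
  {K K' : Matrix (Fin du) (Fin dx) ℝ}

lemma κ_pos (h : Regular S N α ψ σ κ ν) : 0 < κ := by linarith [h.hκ]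

lemma ν_pos (h : Regular S N α ψ σ κ ν) : 0 < ν := by
  rw [h.hν]; have := h.κ_pos; have := h.hα; have := h.hσ; positivity

lemma cov_eq (hK : StableMat (S.cl K)) :
    S.cov N K = N + S.cl K * S.cov N K * (S.cl K)ᵀ := lyap_eq hK N

lemma cov_psd (h : Regular S N α ψ σ κ ν) (hK : StableMat (S.cl K)) : (S.cov N K).PosSemidef :=
  lyap_posSemidef hK h.N_psd

lemma val_eq (hK : StableMat (S.cl K)) :
    S.val K = S.cm K + (S.cl K)ᵀ * S.val K * S.cl K := by
  have := lyap_eq hK.transpose (S.cm K)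
  rwa [Matrix.transpose_transpose] at this

lemma val_psd (h : Regular S N α ψ σ κ ν) (hK : StableMat (S.cl K)) : (S.val K).PosSemidef :=
  lyap_posSemidef hK.transpose (h.cm_psd K)

lemma val_symm (h : Regular S N α ψ σ κ ν) (hK : StableMat (S.cl K)) :
    (S.val K)ᵀ = S.val K := PosSemidef.symm' (h.val_psd hK)

lemma dot_val (hK : StableMat (S.cl K)) (x : Fin dx → ℝ) :
    (S.cl K *ᵥ x) ⬝ᵥ S.val K *ᵥ (S.cl K *ᵥ x) = x ⬝ᵥ S.val K *ᵥ x - x ⬝ᵥ S.cm K *ᵥ x := by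
  have : x ⬝ᵥ S.val K *ᵥ x = x ⬝ᵥ (S.cm K + (S.cl K)ᵀ * S.val K * S.cl K) *ᵥ x := by
    rw [← val_eq hK]
  rw [this, Matrix.add_mulVec, dotProduct_add, add_sub_cancel_left,
    Matrix.mulVec_mulVec, mulVec_dotProduct_mulVec, Matrix.mul_assoc]

lemma dot_cm_le_val (h : Regular S N α ψ σ κ ν) (hK : StableMat (S.cl K)) (x : Fin dx → ℝ) :
    x ⬝ᵥ S.cm K *ᵥ x ≤ x ⬝ᵥ S.val K *ᵥ x := by
  have := dot_val hK x
  linarith [dot_nonneg (h.val_psd hK) (S.cl K *ᵥ x)]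

/-- `N ⪰ σ² I` gives `σ² tr P ≤ tr (P N) = J ≤ ν`, and `κ²` is `ν / (α σ²)` by definition. The dual
bound for the covariance uses `Q ⪰ α I` instead. -/
lemma trace_val_le (h : Regular S N α ψ σ κ ν) (hK : K ∈ S.sublevel N ν) :
    (S.val K).trace ≤ α * κ ^ 2 := by
  obtain ⟨hs, hc⟩ := h.mem_sublevel.1 hK
  have h1 := le_trace_mul h.Ns h.hN (h.val_psd hs)
  rw [Matrix.trace_mul_comm, ← cost_eq_val hs] at h1
  have h2 : σ ^ 2 * (S.val K).trace ≤ σ ^ 2 * (α * κ ^ 2) := by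
    rw [h.hν] at hc; linarith
  exact le_of_mul_le_mul_left h2 (pow_pos h.hσ 2)

lemma norm_val_le (h : Regular S N α ψ σ κ ν) (hK : K ∈ S.sublevel N ν) :
    ‖S.val K‖ ≤ α * κ ^ 2 :=
  (norm_le_trace (h.val_psd (h.mem_sublevel.1 hK).1)).trans (h.trace_val_le hK)

lemma trace_cov_le (h : Regular S N α ψ σ κ ν) (hK : StableMat (S.cl K)) :
    α * (S.cov N K).trace ≤ S.cost N K :=
  le_trace_mul (PosSemidef.symm' (h.cm_psd K)) (h.cm_ge K) (h.cov_psd hK)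

lemma trace_cov_le' (h : Regular S N α ψ σ κ ν) (hK : K ∈ S.sublevel N ν) :
    (S.cov N K).trace ≤ σ ^ 2 * κ ^ 2 := by
  obtain ⟨hs, hc⟩ := h.mem_sublevel.1 hK
  have h1 := h.trace_cov_le hs
  have h2 : α * (S.cov N K).trace ≤ α * (σ ^ 2 * κ ^ 2) := by
    rw [h.hν] at hc; linarith
  exact le_of_mul_le_mul_left h2 h.hα

lemma norm_cov_le (h : Regular S N α ψ σ κ ν) (hK : K ∈ S.sublevel N ν) :
    ‖S.cov N K‖ ≤ σ ^ 2 * κ ^ 2 :=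
  (norm_le_trace (h.cov_psd (h.mem_sublevel.1 hK).1)).trans (h.trace_cov_le' hK)

lemma dot_val_le (h : Regular S N α ψ σ κ ν) (hK : K ∈ S.sublevel N ν) (x : Fin dx → ℝ) :
    x ⬝ᵥ S.val K *ᵥ x ≤ α * κ ^ 2 * euclNorm x ^ 2 := by
  have h1 := (abs_le.1 (dot_le_norm (S.val K) x)).2
  rw [← euclNorm_sq] at h1
  exact h1.trans (mul_le_mul_of_nonneg_right (h.norm_val_le hK) (sq_nonneg _))

lemma le_dot_val (h : Regular S N α ψ σ κ ν) (hK : StableMat (S.cl K)) (x : Fin dx → ℝ) :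
    α * euclNorm x ^ 2 ≤ x ⬝ᵥ S.val K *ᵥ x := by
  rw [euclNorm_sq]; exact (h.cm_ge K x).trans (h.dot_cm_le_val hK x)

lemma one_sub_nonneg (h : Regular S N α ψ σ κ ν) : 0 ≤ 1 - (κ ^ 2)⁻¹ := by
  have : 1 ≤ κ ^ 2 := by nlinarith [h.hκ]
  linarith [inv_le_one_of_one_le₀ this]

/-- One step of the closed loop lowers `xᵀ P x` by the stage cost, which is at least `α |x|²`; this
is at least the fraction `κ⁻²` of `xᵀ P x`, because `‖P‖ ≤ α κ²`. -/
lemma dot_val_pow_le (h : Regular S N α ψ σ κ ν) (hK : K ∈ S.sublevel N ν) (x : Fin dx → ℝ)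
    (k : ℕ) : (S.cl K ^ k *ᵥ x) ⬝ᵥ S.val K *ᵥ (S.cl K ^ k *ᵥ x)
      ≤ (1 - (κ ^ 2)⁻¹) ^ k * (x ⬝ᵥ S.val K *ᵥ x) := by
  induction k with
  | zero => simp
  | succ k ih =>
    have hs := (h.mem_sublevel.1 hK).1
    rw [pow_succ', ← Matrix.mulVec_mulVec, dot_val hs]
    set y := S.cl K ^ k *ᵥ x
    have h1 := h.dot_val_le hK y
    have h2 := h.cm_ge K y
    rw [← euclNorm_sq] at h2
    have hκ2 : 0 < κ ^ 2 := pow_pos h.κ_pos 2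
    have h3 : (κ ^ 2)⁻¹ * (y ⬝ᵥ S.val K *ᵥ y) ≤ α * euclNorm y ^ 2 := by
      rw [inv_mul_le_iff₀ hκ2]; linarith
    have h4 := mul_le_mul_of_nonneg_left ih h.one_sub_nonneg
    rw [pow_succ', mul_assoc]
    linarith

/-- Geometric decay of the closed loop powers. -/
lemma euclNorm_pow_le (h : Regular S N α ψ σ κ ν) (hK : K ∈ S.sublevel N ν) (x : Fin dx → ℝ)
    (k : ℕ) : euclNorm (S.cl K ^ k *ᵥ x) ^ 2
      ≤ (1 - (κ ^ 2)⁻¹) ^ k * (κ ^ 2 * euclNorm x ^ 2) := by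
  have hs := (h.mem_sublevel.1 hK).1
  have h1 := h.le_dot_val hs (S.cl K ^ k *ᵥ x)
  have h2 := h.dot_val_pow_le hK x k
  have h3 := mul_le_mul_of_nonneg_left (h.dot_val_le hK x) (pow_nonneg h.one_sub_nonneg k)
  refine le_of_mul_le_mul_left ?_ h.hα
  linarith

lemma norm_cl_le (h : Regular S N α ψ σ κ ν) (hK : K ∈ S.sublevel N ν) : ‖S.cl K‖ ≤ κ := by
  have hκ := h.κ_pos
  refine norm_le_of_mulVec _ hκ.le fun x => ?_
  refine abs_le_of_sq_le_sq' ?_ (mul_nonneg hκ.le (euclNorm_nonneg _)) |>.2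
  have h1 := h.euclNorm_pow_le hK x 1
  rw [pow_one, pow_one] at h1
  rw [mul_pow]
  have h2 : 0 < (κ ^ 2)⁻¹ := by positivity
  have h3 : 0 ≤ κ ^ 2 * euclNorm x ^ 2 := by positivity
  nlinarith

/-- The change of the Lyapunov function of `K` under another controller. -/
lemma value_identity (h : Regular S N α ψ σ κ ν) (hK : StableMat (S.cl K))
    (K' : Matrix (Fin du) (Fin dx) ℝ) :
    S.cm K' + (S.cl K')ᵀ * S.val K * S.cl K' = S.val K +
      ((K' - K)ᵀ * S.natGrad K + (S.natGrad K)ᵀ * (K' - K) + (K' - K)ᵀ * S.hess K * (K' - K)) := by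
  have hP := val_eq hK
  have hPs := h.val_symm hK
  obtain ⟨D, rfl⟩ : ∃ D, K' = K + D := ⟨K' - K, by abel⟩
  rw [add_sub_cancel_left]
  conv_rhs => enter [1]; rw [hP]
  simp only [LQR.cm, LQR.cl, LQR.natGrad, LQR.hess, Matrix.transpose_add, Matrix.transpose_mul,
    Matrix.transpose_transpose, Matrix.mul_add, Matrix.add_mul, Matrix.mul_assoc, hPs, h.Rs]
  abel

/-- The quadratic-linear perturbation `Δᵀ E + Eᵀ Δ + Δᵀ H Δ`. -/
def _root_.OnlineLQR.LQR.pert (S : LQR dx du) (K D : Matrix (Fin du) (Fin dx) ℝ) :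
    Matrix (Fin dx) (Fin dx) ℝ :=
  Dᵀ * S.natGrad K + (S.natGrad K)ᵀ * D + Dᵀ * S.hess K * D

lemma hess_symm (h : Regular S N α ψ σ κ ν) (hK : StableMat (S.cl K)) :
    (S.hess K)ᵀ = S.hess K := by
  simp [LQR.hess, h.Rs, h.val_symm hK, Matrix.mul_assoc]

lemma pert_symm (h : Regular S N α ψ σ κ ν) (hK : StableMat (S.cl K))
    (D : Matrix (Fin du) (Fin dx) ℝ) : (S.pert K D)ᵀ = S.pert K D := by
  simp only [LQR.pert, Matrix.transpose_add, Matrix.transpose_mul, Matrix.transpose_transpose,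
    h.hess_symm hK, Matrix.mul_assoc]
  abel

/-- Writing `N` as `X' - A' X' A'ᵀ`, with `X'` the stationary covariance and `A'` the closed loop
matrix of `K'`, expresses both costs as traces against `X'`. The difference of the two weights is
given by `value_identity`. -/
lemma cost_diff_trace (h : Regular S N α ψ σ κ ν) (hK : StableMat (S.cl K))
    (hK' : StableMat (S.cl K')) :
    S.cost N K' - S.cost N K = (S.pert K (K' - K) * S.cov N K').trace := by
  have hX := cov_eq (N := N) hK'
  have e1 : S.cost N K = ((S.val K - (S.cl K')ᵀ * S.val K * S.cl K') * S.cov N K').trace := by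
    rw [cost_eq_val hK]
    generalize S.cov N K' = X at hX
    rw [eq_sub_of_add_eq hX.symm, Matrix.mul_sub, Matrix.sub_mul, Matrix.trace_sub,
      Matrix.trace_sub]
    congr 1
    rw [← Matrix.mul_assoc, Matrix.trace_mul_comm]
    simp only [Matrix.mul_assoc]
  rw [e1, LQR.cost, ← Matrix.trace_sub, ← Matrix.sub_mul]
  congr 2
  have := h.value_identity hK K'
  rw [LQR.pert, sub_sub_eq_add_sub, this]
  abel

lemma cost_diff (h : Regular S N α ψ σ κ ν) (hK : StableMat (S.cl K))
    (hK' : StableMat (S.cl K')) :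
    S.cost N K' - S.cost N K = 2 * fip (K' - K) (S.natGrad K * S.cov N K')
      + fip (K' - K) (S.hess K * (K' - K) * S.cov N K') := by
  have hXs := PosSemidef.symm' (h.cov_psd hK')
  rw [h.cost_diff_trace hK hK', LQR.pert, Matrix.add_mul, Matrix.add_mul, Matrix.trace_add, Matrix.trace_add]
  set D := K' - K
  have t1 : (Dᵀ * S.natGrad K * S.cov N K').trace = fip D (S.natGrad K * S.cov N K') := by
    rw [fip_eq_trace', Matrix.mul_assoc]
  have t2 : ((S.natGrad K)ᵀ * D * S.cov N K').trace = fip D (S.natGrad K * S.cov N K') := by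
    rw [fip_eq_trace, Matrix.transpose_mul, hXs, Matrix.mul_assoc, Matrix.trace_mul_comm,
      Matrix.mul_assoc]
  have t3 : (Dᵀ * S.hess K * D * S.cov N K').trace
      = fip D (S.hess K * D * S.cov N K') := by
    rw [fip_eq_trace']
    simp only [Matrix.mul_assoc]
  rw [t1, t2, t3]
  ring

lemma norm_hess_le (h : Regular S N α ψ σ κ ν) (hK : K ∈ S.sublevel N ν) :
    ‖S.hess K‖ ≤ 1 + ψ ^ 2 * (α * κ ^ 2) := by
  have hb : ‖S.Bᵀ‖ ≤ ψ := by rw [norm_transpose]; exact h.hB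
  refine (norm_add_le_of_le h.hR1
    (norm_mul_le_of_le (norm_mul_le_of_le hb (h.norm_val_le hK)) h.hB)).trans (le_of_eq (by ring))

lemma one_add_le (h : Regular S N α ψ σ κ ν) : 1 + ψ ^ 2 * (α * κ ^ 2) ≤ 5 / 4 * (ψ ^ 2 * κ ^ 2) := by
  have h1 : 1 ≤ ψ ^ 2 := by nlinarith [h.hψ]
  have h2 : 4 ≤ κ ^ 2 := by nlinarith [h.hκ]
  have h3 : 4 ≤ ψ ^ 2 * κ ^ 2 := by nlinarith
  have h4 : ψ ^ 2 * (α * κ ^ 2) ≤ ψ ^ 2 * κ ^ 2 := by nlinarith [h.hα1]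
  linarith

lemma norm_hess_le' (h : Regular S N α ψ σ κ ν) (hK : K ∈ S.sublevel N ν) :
    ‖S.hess K‖ ≤ 5 / 4 * (ψ ^ 2 * κ ^ 2) := (h.norm_hess_le hK).trans h.one_add_le

/-- The left side of `value_identity` is positive semidefinite for every `K'`. For `K' = K - H⁻¹ E`,
where `E` is `natGrad` and `H` bounds the norm of `hess`, this reads `H⁻¹ Eᵀ E ⪯ P`, so `‖E‖² ≤ H
‖P‖`. The factor `√α` comes from the bound on `P`. -/
lemma norm_natGrad_le (h : Regular S N α ψ σ κ ν) (hK : K ∈ S.sublevel N ν) :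
    ‖S.natGrad K‖ ≤ 3 / 2 * (√α * ψ * κ ^ 2) := by
  have hs := (h.mem_sublevel.1 hK).1
  have hψ := h.hψ
  have hκ := h.κ_pos
  set H := 5 / 4 * (ψ ^ 2 * κ ^ 2) with hH
  have hHpos : 0 < H := by positivity
  refine norm_le_of_mulVec _ (by positivity) fun x => ?_
  refine abs_le_of_sq_le_sq' ?_ (mul_nonneg (by positivity) (euclNorm_nonneg _)) |>.2
  have h0 := h.value_identity hs (K - H⁻¹ • S.natGrad K)
  rw [sub_sub_cancel_left] at h0
  have hpsd := (h.cm_psd (K - H⁻¹ • S.natGrad K)).add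
    (PosSemidef.conj' (h.val_psd hs) (S.cl (K - H⁻¹ • S.natGrad K)))
  rw [h0] at hpsd
  have h1 := dot_nonneg hpsd x
  set E := S.natGrad K
  simp only [Matrix.transpose_neg, Matrix.transpose_smul, Matrix.neg_mul, Matrix.mul_neg,
    Matrix.smul_mul, Matrix.mul_smul, Matrix.add_mulVec, Matrix.neg_mulVec,
    Matrix.smul_mulVec, dotProduct_add, dotProduct_neg, dotProduct_smul, smul_eq_mul] at h1
  rw [← mulVec_dotProduct_mulVec, Matrix.mul_assoc, ← mulVec_dotProduct_mulVec,
    ← Matrix.mulVec_mulVec, ← euclNorm_sq] at h1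
  have h2 := (abs_le.1 (dot_le_norm (S.hess K) (E *ᵥ x))).2
  rw [← euclNorm_sq] at h2
  have h3 := mul_le_mul_of_nonneg_right (h.norm_hess_le' hK) (sq_nonneg (euclNorm (E *ᵥ x)))
  have h4 := h.dot_val_le hK x
  rw [← hH] at h3
  set y := euclNorm (E *ᵥ x) ^ 2
  have h5 : H⁻¹ * (H⁻¹ * (E *ᵥ x ⬝ᵥ S.hess K *ᵥ E *ᵥ x)) ≤ H⁻¹ * y := by
    refine mul_le_mul_of_nonneg_left ?_ (inv_nonneg.2 hHpos.le)
    rw [inv_mul_le_iff₀ hHpos]; linarith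
  have h6 : H⁻¹ * y ≤ α * κ ^ 2 * euclNorm x ^ 2 := by linarith
  rw [inv_mul_le_iff₀ hHpos] at h6
  refine h6.trans ?_
  have : (3 / 2 * (√α * ψ * κ ^ 2) * euclNorm x) ^ 2
      = 9 / 4 * (α * ψ ^ 2 * κ ^ 4 * euclNorm x ^ 2) := by
    have := Real.sq_sqrt h.hα.le
    calc _ = 9 / 4 * (√α ^ 2 * ψ ^ 2 * κ ^ 4 * euclNorm x ^ 2) := by ring
      _ = _ := by rw [this]
  rw [this, hH]
  have : 0 ≤ α * ψ ^ 2 * κ ^ 4 * euclNorm x ^ 2 := by have := h.hα; positivity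
  nlinarith

end Regular

/-! ### Perturbation of the controller, gradient domination and descent -/

namespace Regular

variable {dx du : ℕ} {S : LQR dx du} {N : Matrix (Fin dx) (Fin dx) ℝ} {α ψ σ κ ν s : ℝ}
  {K K' K₁ K₂ : Matrix (Fin du) (Fin dx) ℝ}

lemma sublevel_mono {b b' : ℝ} (hb : b ≤ b') : S.sublevel N b ⊆ S.sublevel N b' :=
  fun _ hK n => (hK n).trans hb

lemma sublevel_half (h : Regular S N α ψ σ κ ν) : S.sublevel N (ν / 2) ⊆ S.sublevel N ν :=
  sublevel_mono (by linarith [h.ν_pos])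

lemma κ_pow_ge (h : Regular S N α ψ σ κ ν) (k : ℕ) : (2 : ℝ) ^ k ≤ κ ^ k :=
  pow_le_pow_left₀ (by norm_num) h.hκ k

/-- The radius condition on `s` makes the quadratic term of `pert` small against the linear terms,
which carry the factor `√α` of `norm_natGrad_le`. -/
lemma norm_pert_le (h : Regular S N α ψ σ κ ν) (hK : K ∈ S.sublevel N ν)
    {D : Matrix (Fin du) (Fin dx) ℝ} (hD : ‖D‖ ≤ s) (hs : s * (64 * ψ * κ ^ 8) ≤ √α) :
    ‖S.pert K D‖ ≤ 4 * s * (√α * ψ * κ ^ 2) := by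
  have hE := h.norm_natGrad_le hK
  have hH := h.norm_hess_le' hK
  have hDt : ‖Dᵀ‖ ≤ s := by rwa [norm_transpose]
  have hEt : ‖(S.natGrad K)ᵀ‖ ≤ 3 / 2 * (√α * ψ * κ ^ 2) := by rwa [norm_transpose]
  have hs0 : 0 ≤ s := (norm_nonneg _).trans hD
  have hψ := h.hψ
  have hκ := h.κ_pos
  refine (norm_add_le_of_le (norm_add_le_of_le (norm_mul_le_of_le hDt hE)
    (norm_mul_le_of_le hEt hD)) (norm_mul_le_of_le (norm_mul_le_of_le hDt hH) hD)).trans ?_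
  have h1 : ψ * s ≤ √α / 64 := by
    have := h.κ_pow_ge 8
    have h2 : s * (64 * ψ * 1) ≤ s * (64 * ψ * κ ^ 8) := by gcongr; linarith
    linarith
  have h3 : (ψ * s) * (s * (ψ * κ ^ 2)) ≤ √α / 64 * (s * (ψ * κ ^ 2)) := by gcongr
  have h4 : 0 ≤ √α * (s * (ψ * κ ^ 2)) := by positivity
  nlinarith

lemma norm_pert_le' (h : Regular S N α ψ σ κ ν) (hK : K ∈ S.sublevel N ν)
    {D : Matrix (Fin du) (Fin dx) ℝ} (hD : ‖D‖ ≤ s) (hs : s * (64 * ψ * κ ^ 8) ≤ √α) :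
    ‖S.pert K D‖ ≤ α / 2 := by
  refine (h.norm_pert_le hK hD hs).trans ?_
  have hs0 : 0 ≤ s := (norm_nonneg _).trans hD
  have hψ := h.hψ
  have hκ := h.κ_pos
  have h1 : κ ^ 2 ≤ κ ^ 8 := pow_le_pow_right₀ (by linarith [h.hκ]) (by norm_num)
  have h2 : s * (64 * ψ * κ ^ 2) ≤ √α := le_trans (by gcongr) hs
  have h3 := mul_le_mul_of_nonneg_left h2 (Real.sqrt_nonneg α)
  rw [← sq, Real.sq_sqrt h.hα.le] at h3
  linarith [h.hα]

/-- Controllers near a controller of cost at most `ν / 2` have cost at most `ν`. -/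
lemma near_mem (h : Regular S N α ψ σ κ ν) (hK : K ∈ S.sublevel N (ν / 2))
    (hD : ‖K' - K‖ ≤ s) (hs : s * (64 * ψ * κ ^ 8) ≤ √α) : K' ∈ S.sublevel N ν := by
  obtain ⟨hst, hc⟩ := h.mem_sublevel.1 hK
  have hP := h.val_psd hst
  -- The perturbation is at most `α/2`, hence at most half of the stage cost of `K'`. So the value
  -- matrix of `K` is a Lyapunov function for `K'` which loses at least the other half in every
  -- step.
  have hpsd : ((S.val K - (S.cl K')ᵀ * S.val K * S.cl K') - (1 / 2 : ℝ) • S.cm K').PosSemidef := by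
    refine posSemidef_iff_real.2 ⟨?_, fun x => ?_⟩
    · simp [PosSemidef.symm' hP, PosSemidef.symm' (h.cm_psd K'), Matrix.mul_assoc]
    · have e : (S.val K - (S.cl K')ᵀ * S.val K * S.cl K') - (1 / 2 : ℝ) • S.cm K'
          = (1 / 2 : ℝ) • S.cm K' - S.pert K (K' - K) := by
        have e1 : S.pert K (K' - K)
            = S.cm K' + (S.cl K')ᵀ * S.val K * S.cl K' - S.val K := by
          rw [h.value_identity hst K', LQR.pert]; abel
        rw [e1]
        have : S.cm K' = (1 / 2 : ℝ) • S.cm K' + (1 / 2 : ℝ) • S.cm K' := by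
          rw [← add_smul]; norm_num
        nth_rw 3 [this]
        abel
      rw [e, Matrix.sub_mulVec, dotProduct_sub, Matrix.smul_mulVec, dotProduct_smul, smul_eq_mul]
      have h1 := (abs_le.1 (dot_le_norm (S.pert K (K' - K)) x)).2
      have h2 := h.cm_ge K' x
      have h3 : 0 ≤ x ⬝ᵥ x := by rw [← euclNorm_sq]; positivity
      have h4 := mul_le_mul_of_nonneg_right (h.norm_pert_le' (h.sublevel_half hK) hD hs) h3
      linarith
  set L := S.cl K'
  -- Telescoping this decrease along the covariances of `K'` uses no stability of `K'`. The factor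
  -- `1/2` is what turns `ν/2` into `ν`.
  have key : ∀ n, 1 / 2 * S.costN N K' n
      ≤ (S.val K * N).trace - (S.val K * (L ^ n * N * (L ^ n)ᵀ)).trace := by
    intro n
    induction n with
    | zero => simp [LQR.costN]
    | succ n ih =>
      have h1 := trace_mul_nonneg hpsd (PosSemidef.conj h.N_psd (L ^ n))
      rw [Matrix.sub_mul, Matrix.sub_mul, Matrix.trace_sub, Matrix.trace_sub, Matrix.smul_mul,
        Matrix.trace_smul, smul_eq_mul] at h1
      have h2 : (Lᵀ * S.val K * L * (L ^ n * N * (L ^ n)ᵀ)).trace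
          = (S.val K * (L ^ (n + 1) * N * (L ^ (n + 1))ᵀ)).trace := by
        rw [pow_succ', Matrix.transpose_mul]
        simp only [Matrix.mul_assoc]
        rw [Matrix.trace_mul_comm]
        simp only [Matrix.mul_assoc]
      rw [LQR.costN, Finset.sum_range_succ, ← LQR.costN]
      linarith
  intro n
  have h1 := key n
  have h2 := trace_mul_nonneg hP (PosSemidef.conj h.N_psd (L ^ n))
  rw [← cost_eq_val hst] at h1
  linarith

/-- Stability of the stationary covariance under perturbation of the controller. -/
lemma cov_near (h : Regular S N α ψ σ κ ν) (hK : K ∈ S.sublevel N ν) (hK' : K' ∈ S.sublevel N ν)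
    (hD : ‖K' - K‖ ≤ s) (hs : s * (64 * ψ * κ ^ 8) ≤ √α) :
    frobNorm (S.cov N K' - S.cov N K) ≤ 3 * ψ * κ ^ 5 * σ ^ 2 * s := by
  have hst := (h.mem_sublevel.1 hK).1
  have hst' := (h.mem_sublevel.1 hK').1
  have hψ := h.hψ
  have hκ := h.κ_pos
  have hσ := h.hσ
  have hs0 : 0 ≤ s := (norm_nonneg _).trans hD
  have hXs := PosSemidef.symm' (h.cov_psd hst)
  have hXs' := PosSemidef.symm' (h.cov_psd hst')
  set X := S.cov N K with hX
  set X' := S.cov N K' with hX'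
  set A := S.cl K with hA
  set D := S.B * (K' - K) with hDef
  have hA' : S.cl K' = A + D := by simp [hA, hDef, LQR.cl, Matrix.mul_sub]
  have hDn : ‖D‖ ≤ ψ * s := norm_mul_le_of_le h.hB hD
  have hDt : ‖Dᵀ‖ ≤ ψ * s := by rwa [norm_transpose]
  have hAn : ‖A‖ ≤ κ := h.norm_cl_le hK
  have hAt : ‖Aᵀ‖ ≤ κ := by rwa [norm_transpose]
  have hX'n : ‖X'‖ ≤ σ ^ 2 * κ ^ 2 := h.norm_cov_le hK'
  set M := D * X' * Aᵀ + A * X' * Dᵀ + D * X' * Dᵀ with hM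
  have hMs : Mᵀ = M := by
    simp only [hM, Matrix.transpose_add, Matrix.transpose_mul, Matrix.transpose_transpose, hXs',
      Matrix.mul_assoc]
    abel
  -- The source is written with `X'`, so that the matrix acting on the difference is the closed loop
  -- of `K` alone and the comparison with `X` applies.
  have hrec : X' - X = M + A * (X' - X) * Aᵀ := by
    conv_lhs => rw [hX', hX, cov_eq (N := N) hst', cov_eq (N := N) hst, ← hX, ← hX', ← hA, hA']
    simp only [hM, Matrix.transpose_add, Matrix.mul_add, Matrix.add_mul, Matrix.mul_sub,
      Matrix.sub_mul]
    abel
  have hψs : ψ * s ≤ 1 := by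
    have := h.κ_pow_ge 8
    have h1 : √α ≤ 1 := Real.sqrt_le_one.2 h.hα1
    have h2 : s * (64 * ψ * 1) ≤ s * (64 * ψ * κ ^ 8) := by gcongr; linarith
    nlinarith
  have hMn : ‖M‖ ≤ 3 * ψ * κ ^ 3 * σ ^ 2 * s := by
    refine (norm_add_le_of_le (norm_add_le_of_le
      (norm_mul_le_of_le (norm_mul_le_of_le hDn hX'n) hAt)
      (norm_mul_le_of_le (norm_mul_le_of_le hAn hX'n) hDt))
      (norm_mul_le_of_le (norm_mul_le_of_le hDn hX'n) hDt)).trans ?_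
    have h1 : (ψ * s) * (ψ * s * (σ ^ 2 * κ ^ 2)) ≤ κ * (ψ * s * (σ ^ 2 * κ ^ 2)) :=
      mul_le_mul_of_nonneg_right (by linarith [h.hκ]) (by positivity)
    nlinarith
  have h1 := frobNorm_lyap_le hst (cov_eq (N := N) hst) (h.cov_psd hst) hrec
    (by rw [Matrix.transpose_sub, hXs, hXs']) (pow_pos h.hσ 2) h.Ns h.hN hMs hMn
  refine h1.trans ?_
  have h2 := h.trace_cov_le' hK
  calc _ ≤ 3 * ψ * κ ^ 3 * σ ^ 2 * s / σ ^ 2 * (σ ^ 2 * κ ^ 2) := by gcongr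
    _ = _ := by field_simp

/-- The difference of the value matrices solves the transposed Lyapunov equation of `K'` with source
`pert`. It is compared with the value matrix of `K'`, whose source `cm` is at least `α I`. -/
lemma val_near (h : Regular S N α ψ σ κ ν) (hK : K ∈ S.sublevel N ν) (hK' : K' ∈ S.sublevel N ν)
    (hD : ‖K' - K‖ ≤ s) (hs : s * (64 * ψ * κ ^ 8) ≤ √α) :
    ‖S.val K' - S.val K‖ ≤ 4 * √α * ψ * κ ^ 4 * s := by
  have hst := (h.mem_sublevel.1 hK).1
  have hst' := (h.mem_sublevel.1 hK').1
  have hψ := h.hψ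
  have hκ := h.κ_pos
  have hα := h.hα
  have hs0 : 0 ≤ s := (norm_nonneg _).trans hD
  have hrec : S.val K' - S.val K
      = S.pert K (K' - K) + (S.cl K')ᵀ * (S.val K' - S.val K) * (S.cl K')ᵀᵀ := by
    have e1 : S.pert K (K' - K)
        = S.cm K' + (S.cl K')ᵀ * S.val K * S.cl K' - S.val K := by
      rw [h.value_identity hst K', LQR.pert]; abel
    conv_lhs => rw [val_eq hst']
    rw [e1, Matrix.transpose_transpose, Matrix.mul_sub, Matrix.sub_mul]
    abel
  have hval : S.val K' = S.cm K' + (S.cl K')ᵀ * S.val K' * (S.cl K')ᵀᵀ := by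
    rw [Matrix.transpose_transpose]; exact val_eq hst'
  have h1 := frobNorm_lyap_le hst'.transpose hval (h.val_psd hst') hrec
    (by rw [Matrix.transpose_sub, h.val_symm hst, h.val_symm hst']) hα
    (PosSemidef.symm' (h.cm_psd K')) (h.cm_ge K') (h.pert_symm hst _) (h.norm_pert_le hK hD hs)
  refine (norm_le_frobNorm _).trans (h1.trans ?_)
  have h2 := h.trace_val_le hK'
  calc _ ≤ 4 * s * (√α * ψ * κ ^ 2) / α * (α * κ ^ 2) := by gcongr
    _ = _ := by field_simp

lemma natGrad_near (h : Regular S N α ψ σ κ ν) (hK : K ∈ S.sublevel N ν)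
    (hK' : K' ∈ S.sublevel N ν) (hD : ‖K' - K‖ ≤ s) (hs : s * (64 * ψ * κ ^ 8) ≤ √α) :
    ‖S.natGrad K' - S.natGrad K‖ ≤ 5 * ψ ^ 2 * κ ^ 5 * s := by
  have hψ := h.hψ
  have hκ := h.κ_pos
  have hs0 : 0 ≤ s := (norm_nonneg _).trans hD
  have e : S.natGrad K' - S.natGrad K = S.R * (K' - K)
      + S.Bᵀ * (S.val K' - S.val K) * S.cl K' + S.Bᵀ * S.val K * (S.B * (K' - K)) := by
    simp only [LQR.natGrad, LQR.cl, Matrix.mul_sub, Matrix.sub_mul, Matrix.mul_add, Matrix.mul_assoc]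
    abel
  have hBt : ‖S.Bᵀ‖ ≤ ψ := by rw [norm_transpose]; exact h.hB
  rw [e]
  refine (norm_add_le_of_le (norm_add_le_of_le (norm_mul_le_of_le h.hR1 hD)
    (norm_mul_le_of_le (norm_mul_le_of_le hBt (h.val_near hK hK' hD hs)) (h.norm_cl_le hK')))
    (norm_mul_le_of_le (norm_mul_le_of_le hBt (h.norm_val_le hK))
      (norm_mul_le_of_le h.hB hD))).trans ?_
  have h1 : √α ≤ 1 := Real.sqrt_le_one.2 h.hα1
  have h2 := h.one_add_le
  have h3 : ψ ^ 2 * κ ^ 2 * 8 ≤ ψ ^ 2 * κ ^ 5 := by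
    have := h.κ_pow_ge 3
    have : ψ ^ 2 * κ ^ 2 * 8 ≤ ψ ^ 2 * κ ^ 2 * κ ^ 3 := by gcongr; linarith
    nlinarith
  have h4 : 1 + ψ ^ 2 * (α * κ ^ 2) ≤ ψ ^ 2 * κ ^ 5 := by
    have : 0 ≤ ψ ^ 2 * κ ^ 2 := by positivity
    linarith
  have h5 := mul_le_mul_of_nonneg_right h4 hs0
  have h6 : √α * (ψ ^ 2 * κ ^ 5 * s) ≤ 1 * (ψ ^ 2 * κ ^ 5 * s) := by gcongr
  nlinarith

/-- Near a controller of cost at most `ν / 2` the cost is, up to a small Lipschitz error, linear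
with slope given by the gradient. -/
lemma cost_linearization (h : Regular S N α ψ σ κ ν) (hK : K ∈ S.sublevel N (ν / 2))
    (h1 : frobNorm (K₁ - K) ≤ s) (h2 : frobNorm (K₂ - K) ≤ s)
    (hs : s * (64 * ψ * κ ^ 8) ≤ √α) :
    |S.cost N K₁ - S.cost N K₂ - fip (S.grad N K) (K₁ - K₂)|
      ≤ 22 * ψ ^ 2 * κ ^ 7 * σ ^ 2 * s * frobNorm (K₁ - K₂) := by
  have n1 := (norm_le_frobNorm _).trans h1
  have n2 := (norm_le_frobNorm _).trans h2
  have m0 := h.sublevel_half hK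
  have m1 := h.near_mem hK n1 hs
  have m2 := h.near_mem hK n2 hs
  have hψ := h.hψ
  have hκ := h.κ_pos
  have hs0 : 0 ≤ s := (norm_nonneg _).trans n1
  -- The exact difference formula between `K₁` and `K₂` has `natGrad` at `K₂` and the covariance at
  -- `K₁`; moving both to `K` produces the gradient and three small terms.
  have hd := h.cost_diff (h.mem_sublevel.1 m2).1 (h.mem_sublevel.1 m1).1
  set D := K₁ - K₂ with hD
  have hDn : frobNorm D ≤ 2 * s := by
    have : D = (K₁ - K) - (K₂ - K) := by rw [hD]; abel
    rw [this]; linarith [frobNorm_sub_le (K₁ - K) (K₂ - K)]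
  have e : S.cost N K₁ - S.cost N K₂ - fip (S.grad N K) D
      = fip D ((2 : ℝ) • ((S.natGrad K₂ - S.natGrad K) * S.cov N K₁)
        + (2 : ℝ) • (S.natGrad K * (S.cov N K₁ - S.cov N K)) + S.hess K₂ * D * S.cov N K₁) := by
    rw [hd, fip_comm (S.grad N K), LQR.grad, fip_add_right, fip_add_right, fip_smul_right,
      fip_smul_right, fip_smul_right, Matrix.sub_mul, Matrix.mul_sub (S.natGrad K), fip_sub_right,
      fip_sub_right]
    ring
  rw [e]
  have b1 : frobNorm ((2 : ℝ) • ((S.natGrad K₂ - S.natGrad K) * S.cov N K₁))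
      ≤ 2 * (5 * ψ ^ 2 * κ ^ 5 * s * (σ ^ 2 * κ ^ 2)) := by
    rw [frobNorm_smul, abs_two]
    refine mul_le_mul_of_nonneg_left ((frobNorm_mul_le _ _).trans ?_) zero_le_two
    exact mul_le_mul (h.natGrad_near m0 m2 n2 hs)
      ((frobNorm_le_trace (h.cov_psd (h.mem_sublevel.1 m1).1)).trans (h.trace_cov_le' m1))
      (frobNorm_nonneg _) (by positivity)
  have b2 : frobNorm ((2 : ℝ) • (S.natGrad K * (S.cov N K₁ - S.cov N K)))
      ≤ 2 * (3 / 2 * (√α * ψ * κ ^ 2) * (3 * ψ * κ ^ 5 * σ ^ 2 * s)) := by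
    rw [frobNorm_smul, abs_two]
    refine mul_le_mul_of_nonneg_left ((frobNorm_mul_le _ _).trans ?_) zero_le_two
    exact mul_le_mul (h.norm_natGrad_le m0) (h.cov_near m0 m1 n1 hs)
      (frobNorm_nonneg _) (by positivity)
  have b3 : frobNorm (S.hess K₂ * D * S.cov N K₁)
      ≤ 5 / 4 * (ψ ^ 2 * κ ^ 2) * (2 * s) * (σ ^ 2 * κ ^ 2) := by
    refine (frobNorm_mul_le' _ _).trans (mul_le_mul ((frobNorm_mul_le _ _).trans ?_)
      (h.norm_cov_le m1) (norm_nonneg _) (by positivity))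
    exact mul_le_mul (h.norm_hess_le' m2) hDn (frobNorm_nonneg _) (by positivity)
  -- The three terms contribute `10`, `9` and, after trading `κ³ ≥ 8`, `5/16`; the sum is rounded up
  -- to `22`.
  have b4 : frobNorm ((2 : ℝ) • ((S.natGrad K₂ - S.natGrad K) * S.cov N K₁)
        + (2 : ℝ) • (S.natGrad K * (S.cov N K₁ - S.cov N K)) + S.hess K₂ * D * S.cov N K₁)
      ≤ 22 * ψ ^ 2 * κ ^ 7 * σ ^ 2 * s := by
    refine (frobNorm_add_le _ _).trans ((add_le_add (frobNorm_add_le _ _) le_rfl).trans ?_)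
    have h1 : √α ≤ 1 := Real.sqrt_le_one.2 h.hα1
    have h6 : √α * (ψ ^ 2 * κ ^ 7 * σ ^ 2 * s) ≤ 1 * (ψ ^ 2 * κ ^ 7 * σ ^ 2 * s) := by gcongr
    have h7 : ψ ^ 2 * κ ^ 4 * σ ^ 2 * s * 8 ≤ ψ ^ 2 * κ ^ 4 * σ ^ 2 * s * κ ^ 3 := by
      gcongr; linarith [h.κ_pow_ge 3]
    have h8 : 0 ≤ ψ ^ 2 * κ ^ 4 * σ ^ 2 * s := by positivity
    nlinarith
  calc _ ≤ _ := abs_fip_le _ _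
    _ ≤ _ := by rw [mul_comm]; exact mul_le_mul_of_nonneg_right b4 (frobNorm_nonneg _)

lemma frobNorm_grad_le (h : Regular S N α ψ σ κ ν) (hK : K ∈ S.sublevel N (ν / 2)) :
    frobNorm (S.grad N K) ≤ 3 / 2 * (√α * ψ * κ ^ 4 * σ ^ 2) := by
  have hψ := h.hψ
  have hm := h.mem_sublevel.1 hK
  have ht : (S.cov N K).trace ≤ σ ^ 2 * κ ^ 2 / 2 := by
    have h1 := h.trace_cov_le hm.1
    have h2 : α * (S.cov N K).trace ≤ α * (σ ^ 2 * κ ^ 2 / 2) := by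
      have := hm.2
      rw [h.hν] at this; linarith
    exact le_of_mul_le_mul_left h2 h.hα
  rw [LQR.grad, frobNorm_smul, abs_two]
  have : frobNorm (S.natGrad K * S.cov N K) ≤ 3 / 2 * (√α * ψ * κ ^ 2) * (σ ^ 2 * κ ^ 2 / 2) :=
    (frobNorm_mul_le _ _).trans (mul_le_mul (h.norm_natGrad_le (h.sublevel_half hK))
      ((frobNorm_le_trace (h.cov_psd hm.1)).trans ht)
      (frobNorm_nonneg _) (by positivity))
  linarith

lemma dot_hess_ge (h : Regular S N α ψ σ κ ν) (hK : StableMat (S.cl K)) (y : Fin du → ℝ) :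
    α * (y ⬝ᵥ y) ≤ y ⬝ᵥ S.hess K *ᵥ y := by
  rw [LQR.hess, Matrix.add_mulVec, dotProduct_add]
  linarith [h.hR y, dot_nonneg (PosSemidef.conj' (h.val_psd hK) S.B) y]

/-- Gradient domination, relative to an arbitrary stabilizing comparator `K'`. -/
lemma grad_dominates (h : Regular S N α ψ σ κ ν) (hK : K ∈ S.sublevel N ν)
    (hK' : K' ∈ S.sublevel N (ν / 4)) :
    S.cost N K - S.cost N K' ≤ κ ^ 4 / (16 * ν) * frobNorm (S.grad N K) ^ 2 := by
  have hst := (h.mem_sublevel.1 hK).1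
  obtain ⟨hst', hc'⟩ := h.mem_sublevel.1 hK'
  have hα := h.hα
  have hσ := h.hσ
  set E := S.natGrad K with hE
  set D := K' - K with hD
  -- Completing the square with `hess ⪰ α I`: no perturbation `D` can bring `pert` below `-α⁻¹ Eᵀ
  -- E`.
  have hpsd : (α⁻¹ • (Eᵀ * E) + S.pert K D).PosSemidef := by
    refine posSemidef_iff_real.2 ⟨?_, fun x => ?_⟩
    · rw [Matrix.transpose_add, h.pert_symm hst]; simp
    · have h1 := h.dot_hess_ge hst (D *ᵥ x)
      have h2 : x ⬝ᵥ (α⁻¹ • (Eᵀ * E) + S.pert K D) *ᵥ x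
          = α⁻¹ * ((E *ᵥ x) ⬝ᵥ (E *ᵥ x)) + 2 * ((D *ᵥ x) ⬝ᵥ (E *ᵥ x))
            + (D *ᵥ x) ⬝ᵥ S.hess K *ᵥ (D *ᵥ x) := by
        simp only [LQR.pert, Matrix.add_mulVec, dotProduct_add, Matrix.smul_mulVec,
          dotProduct_smul, smul_eq_mul]
        rw [← mulVec_dotProduct_mulVec, ← mulVec_dotProduct_mulVec, ← mulVec_dotProduct_mulVec,
          Matrix.mul_assoc, ← mulVec_dotProduct_mulVec, ← Matrix.mulVec_mulVec,
          dotProduct_comm (E *ᵥ x) (D *ᵥ x)]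
        ring
      have h3 : 0 ≤ (α⁻¹ • E *ᵥ x + D *ᵥ x) ⬝ᵥ (α⁻¹ • E *ᵥ x + D *ᵥ x) := by
        rw [← euclNorm_sq]; positivity
      simp only [dotProduct_add, add_dotProduct, dotProduct_smul, smul_dotProduct,
        smul_eq_mul, dotProduct_comm (E *ᵥ x) (D *ᵥ x)] at h3
      have h4 := mul_nonneg hα.le h3
      have h5 : α * α⁻¹ = 1 := mul_inv_cancel₀ hα.ne'
      have h6 : α * (α⁻¹ * (α⁻¹ * ((E *ᵥ x) ⬝ᵥ (E *ᵥ x)) + (D *ᵥ x) ⬝ᵥ (E *ᵥ x))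
          + (α⁻¹ * ((D *ᵥ x) ⬝ᵥ (E *ᵥ x)) + (D *ᵥ x) ⬝ᵥ (D *ᵥ x)))
          = α⁻¹ * ((E *ᵥ x) ⬝ᵥ (E *ᵥ x)) + 2 * ((D *ᵥ x) ⬝ᵥ (E *ᵥ x))
            + α * ((D *ᵥ x) ⬝ᵥ (D *ᵥ x)) := by
        field_simp; ring
      rw [h6] at h4
      rw [h2]; linarith
  have h1 := trace_mul_nonneg hpsd (h.cov_psd hst')
  rw [Matrix.add_mul, Matrix.trace_add, ← h.cost_diff_trace hst hst', Matrix.smul_mul,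
    Matrix.trace_smul, smul_eq_mul, Matrix.mul_assoc, ← fip_eq_trace'] at h1
  have h2 : fip E (E * S.cov N K') ≤ frobNorm E * (frobNorm E * (ν / (4 * α))) := by
    refine (fip_le _ _).trans (mul_le_mul_of_nonneg_left ((frobNorm_mul_le' _ _).trans
      (mul_le_mul_of_nonneg_left ((norm_le_trace (h.cov_psd hst')).trans ?_) (frobNorm_nonneg _)))
      (frobNorm_nonneg _))
    rw [le_div_iff₀ (by positivity)]
    linarith [h.trace_cov_le hst']
  -- The stationary covariance is at least `N ⪰ σ² I`, so the gradient controls `natGrad`.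
  have h3 : 2 * σ ^ 2 * frobNorm E ≤ frobNorm (S.grad N K) := by
    have hX : ∀ x : Fin dx → ℝ, σ ^ 2 * (x ⬝ᵥ x) ≤ x ⬝ᵥ S.cov N K *ᵥ x := fun x => by
      rw [cov_eq hst, Matrix.add_mulVec, dotProduct_add]
      linarith [h.hN x, dot_nonneg (PosSemidef.conj (h.cov_psd hst) (S.cl K)) x]
    have e1 := le_trace_mul (PosSemidef.symm' (h.cov_psd hst)) hX (PosSemidef.conj' .one E)
    rw [Matrix.mul_one, Matrix.trace_mul_comm (S.cov N K), Matrix.mul_assoc, ← fip_eq_trace',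
      ← fip_eq_trace', fip_self] at e1
    have e2 := e1.trans (fip_le _ _)
    rw [LQR.grad, frobNorm_smul, abs_two, ← hE]
    rcases (frobNorm_nonneg E).eq_or_lt with h0 | h0
    · rw [← h0, mul_zero]; linarith [frobNorm_nonneg (E * S.cov N K)]
    · have : σ ^ 2 * frobNorm E ≤ frobNorm (E * S.cov N K) :=
        le_of_mul_le_mul_left (by linarith) h0
      linarith
  have h4 : (2 * σ ^ 2 * frobNorm E) ^ 2 ≤ frobNorm (S.grad N K) ^ 2 :=
    pow_le_pow_left₀ (by have := frobNorm_nonneg E; positivity) h3 2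
  have hν := h.ν_pos
  have hκ := h.κ_pos
  have h5 : S.cost N K - S.cost N K' ≤ α⁻¹ * (frobNorm E * (frobNorm E * (ν / (4 * α)))) := by
    have := mul_le_mul_of_nonneg_left h2 (inv_nonneg.2 hα.le)
    linarith
  -- The constant is `ν / (16 α² σ⁴)`, which equals `κ⁴ / (16 ν)` because `ν = κ² α σ²`.
  refine h5.trans (le_trans (le_of_eq ?_) (mul_le_mul_of_nonneg_left h4
    (div_nonneg (by positivity) (by positivity))))
  rw [h.hν]
  field_simp
  ring

/-- Descent along an inexact gradient. -/
lemma inexact_descent (h : Regular S N α ψ σ κ ν) (hK : K ∈ S.sublevel N (ν / 2))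
    {ξ : Matrix (Fin du) (Fin dx) ℝ} {η : ℝ}
    (hη : η = α / (128 * ν * ψ ^ 2 * κ ^ 10)) (hξ : frobNorm ξ ≤ ν / (16 * κ ^ 2)) :
    K - η • (S.grad N K + ξ) ∈ S.sublevel N ν ∧
    S.cost N (K - η • (S.grad N K + ξ)) ≤ S.cost N K - η / 4 * frobNorm (S.grad N K) ^ 2
      + η * (3 / 4 * frobNorm ξ ^ 2) := by
  have hα := h.hα
  have hσ := h.hσ
  have hκ := h.κ_pos
  have hψ := h.hψ
  have hψ0 : 0 < ψ := by linarith
  have hν := h.ν_pos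
  set g := S.grad N K + ξ with hg
  have hη0 : 0 < η := by rw [hη]; positivity
  -- This normalization makes a step along any `g` with `‖g‖ ≤ 2 √α ψ κ⁴ σ²` satisfy the radius
  -- condition of `near_mem`: `128 = 2 · 64` and `κ¹² = κ⁴ κ⁸`.
  have hη' : η * (128 * σ ^ 2 * ψ ^ 2 * κ ^ 12) = 1 := by
    rw [hη, h.hν]; field_simp
  have hgn : frobNorm g ≤ 2 * (√α * ψ * κ ^ 4 * σ ^ 2) := by
    have h1 := h.frobNorm_grad_le hK
    have h2 : ν / (16 * κ ^ 2) ≤ 1 / 2 * (√α * ψ * κ ^ 4 * σ ^ 2) := by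
      have e : ν / (16 * κ ^ 2) = 1 / 16 * (√α * (√α * σ ^ 2)) := by
        rw [h.hν, ← mul_assoc √α, Real.mul_self_sqrt hα.le]; field_simp
      have e1 : √α * (√α * σ ^ 2) ≤ √α * (ψ * κ ^ 4 * σ ^ 2) := by
        have : √α ≤ ψ * κ ^ 4 := by
          have := Real.sqrt_le_one.2 h.hα1
          have := h.κ_pow_ge 4
          nlinarith
        gcongr
      have : 0 ≤ √α * (ψ * κ ^ 4 * σ ^ 2) := by positivity
      rw [e]; linarith
    linarith [frobNorm_add_le (S.grad N K) ξ]
  have hD : K - η • g - K = -(η • g) := by abel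
  have hDn : frobNorm (K - η • g - K) = η * frobNorm g := by
    rw [hD, ← neg_smul, frobNorm_smul, abs_neg, abs_of_pos hη0]
  have hs : η * frobNorm g * (64 * ψ * κ ^ 8) ≤ √α := by
    calc η * frobNorm g * (64 * ψ * κ ^ 8)
        ≤ η * (2 * (√α * ψ * κ ^ 4 * σ ^ 2)) * (64 * ψ * κ ^ 8) := by gcongr
      _ = √α * (η * (128 * σ ^ 2 * ψ ^ 2 * κ ^ 12)) := by ring
      _ = √α := by rw [hη', mul_one]
  have hmem := h.near_mem hK ((norm_le_frobNorm _).trans hDn.le) hs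
  refine ⟨hmem, ?_⟩
  have hlin := (abs_le.1 (h.cost_linearization (K₁ := K - η • g) (K₂ := K) hK hDn.le
    (by rw [sub_self, frobNorm_zero]; exact mul_nonneg hη0.le (frobNorm_nonneg _)) hs)).2
  rw [hDn, hD, ← neg_smul, fip_smul_right] at hlin
  set a := frobNorm (S.grad N K) with ha
  set b := frobNorm ξ with hb
  have ha0 : 0 ≤ a := frobNorm_nonneg _
  have hb0 : 0 ≤ b := frobNorm_nonneg _
  have h1 : a ^ 2 - a * b ≤ fip (S.grad N K) g := by
    rw [hg, fip_add_right, fip_self]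
    linarith [(abs_le.1 (abs_fip_le (S.grad N K) ξ)).1]
  have h2 : frobNorm g ^ 2 ≤ 2 * a ^ 2 + 2 * b ^ 2 := by
    have h3 := pow_le_pow_left₀ (frobNorm_nonneg g) (frobNorm_add_le (S.grad N K) ξ) 2
    nlinarith [sq_nonneg (a - b)]
  -- The linearization error costs at most `η ‖g‖² / 8 ≤ η (a² + b²) / 4`. Together with `a b ≤ (a²
  -- + b²) / 2` this leaves the decrease `η a² / 4` and the error `3 η b² / 4`.
  have h3 : 22 * ψ ^ 2 * κ ^ 7 * σ ^ 2 * (η * frobNorm g) * (η * frobNorm g)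
      ≤ η * (frobNorm g ^ 2 / 8) := by
    have e : 176 * (ψ ^ 2 * κ ^ 7 * σ ^ 2 * η) ≤ 1 := by
      have e1 : ψ ^ 2 * κ ^ 7 * σ ^ 2 * η * 32 ≤ ψ ^ 2 * κ ^ 7 * σ ^ 2 * η * κ ^ 5 := by
        gcongr; linarith [h.κ_pow_ge 5]
      have e2 : 0 ≤ ψ ^ 2 * κ ^ 7 * σ ^ 2 * η := by positivity
      have e3 : ψ ^ 2 * κ ^ 7 * σ ^ 2 * η * κ ^ 5 = η * (128 * σ ^ 2 * ψ ^ 2 * κ ^ 12) / 128 := by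
        ring
      linarith
    have e3 := mul_le_mul_of_nonneg_right e (mul_nonneg hη0.le (sq_nonneg (frobNorm g)))
    linarith
  have e1 := mul_le_mul_of_nonneg_left h1 hη0.le
  have e2 := mul_le_mul_of_nonneg_left h2 hη0.le
  have e3 := mul_nonneg hη0.le (sq_nonneg (a - b))
  linarith

/-- One inexact gradient step does not leave the sublevel set. -/
lemma step_mem (h : Regular S N α ψ σ κ ν) (hK : K ∈ S.sublevel N (ν / 2))
    (hK' : K' ∈ S.sublevel N (ν / 4)) {ξ : Matrix (Fin du) (Fin dx) ℝ} {η : ℝ}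
    (hη : η = α / (128 * ν * ψ ^ 2 * κ ^ 10)) (hξ : frobNorm ξ ≤ ν / (16 * κ ^ 2)) :
    K - η • (S.grad N K + ξ) ∈ S.sublevel N (ν / 2) := by
  have hα := h.hα
  have hκ := h.κ_pos
  have hψ := h.hψ
  have hν := h.ν_pos
  have hη0 : 0 < η := by rw [hη]; positivity
  obtain ⟨hmem, h4⟩ := h.inexact_descent hK hη hξ
  refine h.mem_sublevel.2 ⟨(h.mem_sublevel.1 hmem).1, h4.trans ?_⟩
  set a := frobNorm (S.grad N K) with ha
  set b := frobNorm ξ with hb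
  have hb0 : 0 ≤ b := frobNorm_nonneg _
  have hcost := (h.mem_sublevel.1 hK).2
  by_cases hcase : 3 * b ^ 2 ≤ a ^ 2
  -- A large gradient: the decrease outweighs the error, so the cost does not grow.
  · have := mul_le_mul_of_nonneg_left hcase hη0.le
    linarith
  -- A small gradient: the cost exceeds `ν/4` by at most `ν/64` through gradient domination, and the
  -- step adds less than `ν/64`, so there is room up to `ν/2`.
  · push Not at hcase
    have h5 := h.grad_dominates (h.sublevel_half hK) hK'
    have h6 := (h.mem_sublevel.1 hK').2
    have h7 : b ^ 2 ≤ (ν / (16 * κ ^ 2)) ^ 2 := pow_le_pow_left₀ hb0 hξ 2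
    have h8 : κ ^ 4 / (16 * ν) * a ^ 2 ≤ ν / 64 := by
      calc κ ^ 4 / (16 * ν) * a ^ 2 ≤ κ ^ 4 / (16 * ν) * (3 * (ν / (16 * κ ^ 2)) ^ 2) := by
            gcongr; linarith
        _ = 3 / 4096 * ν := by field_simp; norm_num
        _ ≤ ν / 64 := by linarith
    have h9 : η * b ^ 2 ≤ ν / 64 := by
      have hην : η * ν ≤ 1 := by
        have e : η * ν * (128 * (ψ ^ 2 * κ ^ 10)) = α := by rw [hη]; field_simp
        have e1 : 1 ≤ ψ ^ 2 * κ ^ 10 := by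
          have := h.κ_pow_ge 10
          have : 1 ≤ ψ ^ 2 := by nlinarith
          nlinarith
        have e2 : 0 ≤ η * ν := by positivity
        nlinarith [h.hα1]
      calc η * b ^ 2 ≤ η * (ν / (16 * κ ^ 2)) ^ 2 := by gcongr
        _ = (η * ν) * (ν / (256 * κ ^ 4)) := by field_simp; norm_num
        _ ≤ 1 * (ν / (256 * κ ^ 4)) := by gcongr
        _ ≤ ν / 64 := by
          rw [one_mul]
          gcongr
          nlinarith [h.κ_pow_ge 4]
    have h10 : 0 ≤ η / 4 * a ^ 2 := by positivity
    linarith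

end Regular

/-! ### Expected costs -/

section Noise

variable {dx du : ℕ} {Ω : Type*}

/-- Independent bounded centred noise with covariance `N`. -/
structure IsNoise [MeasurableSpace Ω] (P : Measure Ω) (w : ℕ → Ω → Fin dx → ℝ)
    (N : Matrix (Fin dx) (Fin dx) ℝ) (W : ℝ) : Prop where
  meas : ∀ t, Measurable (w t)
  indep : iIndepFun w P
  bdd : ∀ t, ∀ᵐ ω ∂P, euclNorm (w t ω) ≤ W
  mean : ∀ t a, ∫ ω, w t ω a ∂P = 0
  cov : ∀ t a b, ∫ ω, w t ω a * w t ω b ∂P = N a b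

lemma measurable_mulVec {m n : ℕ} {_ : MeasurableSpace Ω} {M : Ω → Matrix (Fin m) (Fin n) ℝ}
    {x : Ω → Fin n → ℝ} (hM : ∀ a b, Measurable fun ω => M ω a b) (hx : Measurable x) :
    Measurable fun ω => M ω *ᵥ x ω := by
  refine measurable_pi_iff.2 fun a => ?_
  simp only [Matrix.mulVec, dotProduct]
  exact Finset.measurable_sum _ fun b _ => (hM a b).mul ((measurable_pi_apply b).comp hx)

lemma measurable_dotProduct {n : ℕ} {_ : MeasurableSpace Ω}
    {x y : Ω → Fin n → ℝ} (hx : Measurable x) (hy : Measurable y) :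
    Measurable fun ω => x ω ⬝ᵥ y ω := by
  simp only [dotProduct]
  exact Finset.measurable_sum _ fun b _ =>
    ((measurable_pi_apply b).comp hx).mul ((measurable_pi_apply b).comp hy)

lemma measurable_state {_ : MeasurableSpace Ω} (S : LQR dx du)
    {K : Ω → Matrix (Fin du) (Fin dx) ℝ} {w : Ω → ℕ → Fin dx → ℝ} {x : Ω → Fin dx → ℝ} {t₀ s : ℕ}
    (hK : ∀ a b, Measurable fun ω => K ω a b)
    (hw : ∀ t < t₀ + s, Measurable fun ω => w ω t) (hx : Measurable x) :
    Measurable fun ω => S.state (K ω) (w ω) t₀ (x ω) s := by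
  induction s with
  | zero => exact hx
  | succ s ih =>
    have := ih fun t ht => hw t (by omega)
    simp only [LQR.state]
    refine ((measurable_mulVec (M := fun _ => S.A) (fun _ _ => measurable_const) this).add
      (measurable_mulVec (M := fun _ => S.B) (fun _ _ => measurable_const)
        (measurable_mulVec hK this))).add
      (hw (t₀ + s) (by omega))

lemma state_succ (S : LQR dx du) (K : Matrix (Fin du) (Fin dx) ℝ) (w : ℕ → Fin dx → ℝ) (t₀ : ℕ)
    (x : Fin dx → ℝ) (s : ℕ) :
    S.state K w t₀ x (s + 1) = S.cl K *ᵥ S.state K w t₀ x s + w (t₀ + s) := by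
  rw [LQR.state, LQR.cl, Matrix.add_mulVec, Matrix.mulVec_mulVec]

lemma stageCost_eq (S : LQR dx du) (K : Matrix (Fin du) (Fin dx) ℝ) (x : Fin dx → ℝ) :
    S.stageCost K x = x ⬝ᵥ S.cm K *ᵥ x := by
  rw [LQR.stageCost, LQR.cm, Matrix.add_mulVec, dotProduct_add, Matrix.mul_assoc,
    ← mulVec_dotProduct_mulVec, ← Matrix.mulVec_mulVec]

lemma abs_coord_le {n : ℕ} (x : Fin n → ℝ) (a : Fin n) : |x a| ≤ euclNorm x :=
  PiLp.norm_apply_le (WithLp.toLp 2 x) a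

variable [MeasurableSpace Ω] {P : Measure Ω} {w : ℕ → Ω → Fin dx → ℝ}
  {N : Matrix (Fin dx) (Fin dx) ℝ} {W : ℝ}

lemma IsNoise.state_bdd (hw : IsNoise P w N W) (S : LQR dx du)
    (K : Matrix (Fin du) (Fin dx) ℝ) (t₀ : ℕ) (x : Fin dx → ℝ) (s : ℕ) :
    ∃ b : ℝ, ∀ᵐ ω ∂P, euclNorm (S.state K (fun t => w t ω) t₀ x s) ≤ b := by
  induction s with
  | zero => exact ⟨euclNorm x, Eventually.of_forall fun ω => le_rfl⟩
  | succ s ih =>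
    obtain ⟨b, hb⟩ := ih
    refine ⟨‖S.cl K‖ * b + W, ?_⟩
    filter_upwards [hb, hw.bdd (t₀ + s)] with ω h1 h2
    rw [state_succ]
    exact (euclNorm_add_le _ _).trans (add_le_add ((euclNorm_mulVec_le _ _).trans
      (mul_le_mul_of_nonneg_left h1 (norm_nonneg _))) h2)

lemma IsNoise.measurable_state (hw : IsNoise P w N W) (S : LQR dx du)
    (K : Matrix (Fin du) (Fin dx) ℝ) (t₀ : ℕ) (x : Fin dx → ℝ) (s : ℕ) :
    Measurable fun ω => S.state K (fun t => w t ω) t₀ x s :=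
  OnlineLQR.measurable_state S (K := fun _ => K) (w := fun ω t => w t ω) (x := fun _ => x)
    (fun _ _ => measurable_const) (fun t _ => hw.meas t) measurable_const

lemma integrable_of_ae_bound [IsFiniteMeasure P] {f : Ω → ℝ} {b : ℝ} (hf : Measurable f)
    (hb : ∀ᵐ ω ∂P, |f ω| ≤ b) : Integrable f P :=
  Integrable.of_bound hf.aestronglyMeasurable b hb

lemma integrable_dot [IsFiniteMeasure P] {n : ℕ} {u v : Ω → Fin n → ℝ} {b c : ℝ}
    (hu : Measurable u) (hv : Measurable v) (hb : ∀ᵐ ω ∂P, euclNorm (u ω) ≤ b)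
    (hc : ∀ᵐ ω ∂P, euclNorm (v ω) ≤ c) (M : Matrix (Fin n) (Fin n) ℝ) :
    Integrable (fun ω => u ω ⬝ᵥ M *ᵥ v ω) P := by
  refine integrable_of_ae_bound (b := ‖M‖ * (b * c)) (measurable_dotProduct hu
    (measurable_mulVec (fun _ _ => measurable_const) hv)) ?_
  filter_upwards [hb, hc] with ω h1 h2
  exact (dotProduct_mulVec_le _ _ _).trans (mul_le_mul_of_nonneg_left
    (mul_le_mul h1 h2 (euclNorm_nonneg _) ((euclNorm_nonneg _).trans h1)) (norm_nonneg _))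

lemma dot_mulVec_sum {n : ℕ} (u v : Fin n → ℝ) (M : Matrix (Fin n) (Fin n) ℝ) :
    u ⬝ᵥ M *ᵥ v = ∑ a, ∑ b, M a b * (u a * v b) := by
  simp only [dotProduct, Matrix.mulVec, Finset.mul_sum]
  exact Finset.sum_congr rfl fun a _ => Finset.sum_congr rfl fun b _ => by ring

lemma dot_mulVec_symm {n : ℕ} {M : Matrix (Fin n) (Fin n) ℝ} (hM : Mᵀ = M) (u v : Fin n → ℝ) :
    u ⬝ᵥ M *ᵥ v = v ⬝ᵥ M *ᵥ u := by
  rw [Matrix.dotProduct_mulVec, ← Matrix.mulVec_transpose, hM, dotProduct_comm]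

lemma IsNoise.indepFun_state (hw : IsNoise P w N W) (S : LQR dx du)
    (K : Matrix (Fin du) (Fin dx) ℝ) (t₀ : ℕ) (x : Fin dx → ℝ) (s : ℕ) :
    IndepFun (fun ω => S.state K (fun t => w t ω) t₀ x s) (w (t₀ + s)) P := by
  have hi := indep_iSup_of_disjoint (fun k => (hw.meas k).comap_le) hw.indep.iIndep
    (S := Set.Iio (t₀ + s)) (T := {t₀ + s}) (by simp)
  rw [iSup_singleton] at hi
  refine (IndepFun_iff_Indep _ _ _).2 (indep_of_indep_of_le_left hi ?_)
  refine Measurable.comap_le (OnlineLQR.measurable_state S (K := fun _ => K)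
    (w := fun ω t => w t ω) (x := fun _ => x) (fun _ _ => measurable_const) (fun t ht => ?_)
    measurable_const)
  exact (comap_measurable (w t)).mono
    (le_iSup₂_of_le (f := fun k (_ : k ∈ Set.Iio (t₀ + s)) => MeasurableSpace.comap (w k) _)
      t ht le_rfl) le_rfl

lemma IsNoise.integral_cross [IsProbabilityMeasure P] (hw : IsNoise P w N W) (S : LQR dx du)
    (K : Matrix (Fin du) (Fin dx) ℝ) (t₀ : ℕ) (x : Fin dx → ℝ) (s : ℕ)
    (M : Matrix (Fin dx) (Fin dx) ℝ) :
    ∫ ω, S.state K (fun t => w t ω) t₀ x s ⬝ᵥ M *ᵥ w (t₀ + s) ω ∂P = 0 := by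
  obtain ⟨b, hb⟩ := hw.state_bdd S K t₀ x s
  have hms := hw.measurable_state S K t₀ x s
  simp only [dot_mulVec_sum]
  have hint : ∀ a c, Integrable (fun ω => M a c *
      (S.state K (fun t => w t ω) t₀ x s a * w (t₀ + s) ω c)) P := by
    intro a c
    refine (integrable_of_ae_bound (b := b * W) (((measurable_pi_apply a).comp hms).mul
      ((measurable_pi_apply c).comp (hw.meas (t₀ + s)))) ?_).const_mul _
    filter_upwards [hb, hw.bdd (t₀ + s)] with ω h1 h2
    simp only [Pi.mul_apply, Function.comp]
    rw [abs_mul]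
    exact mul_le_mul ((abs_coord_le _ _).trans h1) ((abs_coord_le _ _).trans h2) (abs_nonneg _)
      ((euclNorm_nonneg _).trans h1)
  rw [integral_finsetSum _ fun a _ => integrable_finsetSum _ fun c _ => hint a c]
  refine Finset.sum_eq_zero fun a _ => ?_
  rw [integral_finsetSum _ fun c _ => hint a c]
  refine Finset.sum_eq_zero fun c _ => ?_
  rw [integral_const_mul]
  have hi := (hw.indepFun_state S K t₀ x s).comp (measurable_pi_apply a) (measurable_pi_apply c)
  have := hi.integral_fun_mul_eq_mul_integral
    ((measurable_pi_apply a).comp hms).aestronglyMeasurable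
    ((measurable_pi_apply c).comp (hw.meas (t₀ + s))).aestronglyMeasurable
  simp only [Function.comp] at this
  rw [this, hw.mean, mul_zero, mul_zero]

/-- Second moments of the state: `𝔼 xₛᵀ M xₛ`. -/
lemma IsNoise.integral_state [IsProbabilityMeasure P] (hw : IsNoise P w N W) (S : LQR dx du)
    (K : Matrix (Fin du) (Fin dx) ℝ) (t₀ : ℕ) (x : Fin dx → ℝ) (s : ℕ) :
    ∀ M : Matrix (Fin dx) (Fin dx) ℝ, Mᵀ = M →
    ∫ ω, S.state K (fun t => w t ω) t₀ x s ⬝ᵥ M *ᵥ S.state K (fun t => w t ω) t₀ x s ∂P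
      = (S.cl K ^ s *ᵥ x) ⬝ᵥ M *ᵥ (S.cl K ^ s *ᵥ x)
        + ∑ k ∈ Finset.range s, (M * (S.cl K ^ k * N * (S.cl K ^ k)ᵀ)).trace := by
  induction s with
  | zero => intro M _; simp [LQR.state]
  | succ s ih =>
    intro M hM
    obtain ⟨b, hb⟩ := hw.state_bdd S K t₀ x s
    have hms := hw.measurable_state S K t₀ x s
    set A := S.cl K
    have e : ∀ ω, S.state K (fun t => w t ω) t₀ x (s + 1) ⬝ᵥ
        M *ᵥ S.state K (fun t => w t ω) t₀ x (s + 1)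
        = S.state K (fun t => w t ω) t₀ x s ⬝ᵥ (Aᵀ * M * A) *ᵥ S.state K (fun t => w t ω) t₀ x s
          + 2 * (S.state K (fun t => w t ω) t₀ x s ⬝ᵥ (Aᵀ * M) *ᵥ w (t₀ + s) ω)
          + w (t₀ + s) ω ⬝ᵥ M *ᵥ w (t₀ + s) ω := by
      intro ω
      rw [state_succ]
      simp only [Matrix.mulVec_add, dotProduct_add, add_dotProduct]
      have e1 : ∀ y z : Fin dx → ℝ, (A *ᵥ y) ⬝ᵥ M *ᵥ z = y ⬝ᵥ (Aᵀ * M) *ᵥ z :=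
        fun y z => mulVec_dotProduct_mulVec _ _ _ _
      have e2 : w (t₀ + s) ω ⬝ᵥ M *ᵥ (A *ᵥ S.state K (fun t => w t ω) t₀ x s)
          = S.state K (fun t => w t ω) t₀ x s ⬝ᵥ (Aᵀ * M) *ᵥ w (t₀ + s) ω := by
        rw [← e1, dot_mulVec_symm hM]
      rw [e2, e1, e1, Matrix.mulVec_mulVec]
      ring
    simp only [e]
    have i1 := integrable_dot hms hms hb hb (Aᵀ * M * A)
    have i2 := (integrable_dot hms (hw.meas (t₀ + s)) hb (hw.bdd _) (Aᵀ * M)).const_mul 2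
    have i3 := integrable_dot (hw.meas (t₀ + s)) (hw.meas (t₀ + s)) (hw.bdd _) (hw.bdd _) M
    refine (integral_add (i1.add i2) i3).trans ?_
    rw [integral_add' i1 i2, integral_const_mul,
      hw.integral_cross S K t₀ x s, ih _ (by simp [hM, Matrix.mul_assoc])]
    have e3 : ∫ ω, w (t₀ + s) ω ⬝ᵥ M *ᵥ w (t₀ + s) ω ∂P = (M * N).trace := by
      have hint : ∀ a c, Integrable (fun ω => M a c * (w (t₀ + s) ω a * w (t₀ + s) ω c)) P := by
        intro a c
        refine (integrable_of_ae_bound (b := W * W) (((measurable_pi_apply a).comp (hw.meas (t₀ + s))).mul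
          ((measurable_pi_apply c).comp (hw.meas (t₀ + s)))) ?_).const_mul _
        filter_upwards [hw.bdd (t₀ + s)] with ω h2
        simp only [Pi.mul_apply, Function.comp]
        rw [abs_mul]
        exact mul_le_mul ((abs_coord_le _ _).trans h2) ((abs_coord_le _ _).trans h2) (abs_nonneg _)
          ((euclNorm_nonneg _).trans h2)
      simp only [dot_mulVec_sum]
      rw [integral_finsetSum _ fun a _ => integrable_finsetSum _ fun c _ => hint a c,
        Matrix.trace]
      refine Finset.sum_congr rfl fun a _ => ?_
      rw [integral_finsetSum _ fun c _ => hint a c, Matrix.diag_apply, Matrix.mul_apply]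
      refine Finset.sum_congr rfl fun c _ => ?_
      rw [integral_const_mul, hw.cov]
      congr 1
      rw [← hw.cov (t₀ + s), ← hw.cov (t₀ + s)]
      simp only [mul_comm]
    rw [e3, Finset.sum_range_succ']
    have e4 : (A ^ s *ᵥ x) ⬝ᵥ (Aᵀ * M * A) *ᵥ (A ^ s *ᵥ x)
        = (A ^ (s + 1) *ᵥ x) ⬝ᵥ M *ᵥ (A ^ (s + 1) *ᵥ x) := by
      rw [pow_succ', ← Matrix.mulVec_mulVec _ A]
      generalize A ^ s *ᵥ x = y
      rw [mulVec_dotProduct_mulVec A M y, Matrix.mulVec_mulVec]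
    have e5 : ∀ k, (Aᵀ * M * A * (A ^ k * N * (A ^ k)ᵀ)).trace
        = (M * (A ^ (k + 1) * N * (A ^ (k + 1))ᵀ)).trace := by
      intro k
      rw [pow_succ', Matrix.transpose_mul]
      simp only [Matrix.mul_assoc]
      rw [Matrix.trace_mul_comm]
      simp only [Matrix.mul_assoc]
    rw [e4]
    simp only [e5, pow_zero, one_mul, Matrix.transpose_one, mul_one]
    ring

lemma IsNoise.integral_stageCost [IsProbabilityMeasure P] (hw : IsNoise P w N W) {S : LQR dx du}
    {α ψ σ κ ν : ℝ} (h : Regular S N α ψ σ κ ν)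
    (K : Matrix (Fin du) (Fin dx) ℝ) (t₀ : ℕ) (x : Fin dx → ℝ) (s : ℕ) :
    ∫ ω, S.stageCost K (S.state K (fun t => w t ω) t₀ x s) ∂P
      = (S.cl K ^ s *ᵥ x) ⬝ᵥ S.cm K *ᵥ (S.cl K ^ s *ᵥ x) + S.costN N K s := by
  simp only [stageCost_eq]
  exact hw.integral_state S K t₀ x s _ (PosSemidef.symm' (h.cm_psd K))

lemma IsNoise.integrable_stageCost [IsFiniteMeasure P] (hw : IsNoise P w N W) (S : LQR dx du)
    (K : Matrix (Fin du) (Fin dx) ℝ) (t₀ : ℕ) (x : Fin dx → ℝ) (s : ℕ) :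
    Integrable (fun ω => S.stageCost K (S.state K (fun t => w t ω) t₀ x s)) P := by
  simp only [stageCost_eq]
  obtain ⟨b, hb⟩ := hw.state_bdd S K t₀ x s
  exact integrable_dot (hw.measurable_state S K t₀ x s) (hw.measurable_state S K t₀ x s) hb hb _

lemma sum_Icc_one {f : ℕ → ℝ} (n : ℕ) :
    ∑ t ∈ Finset.Icc 1 n, f t = ∑ t ∈ Finset.range n, f (t + 1) := by
  rw [Finset.range_eq_Ico, Finset.sum_Ico_add' f 0 n 1]
  rfl

lemma IsNoise.J_eq [IsProbabilityMeasure P] (hw : IsNoise P w N W) {S : LQR dx du}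
    {α ψ σ κ ν : ℝ} (h : Regular S N α ψ σ κ ν) (K : Matrix (Fin du) (Fin dx) ℝ) :
    S.J P w K = limUnder atTop fun n : ℕ =>
      ENNReal.ofReal (∑ t ∈ Finset.range n, S.costN N K (t + 1)) / (n : ℝ≥0∞) := by
  rw [LQR.J]
  congr 1
  funext n
  congr 1
  rw [← sum_Icc_one, ← ofReal_integral_eq_lintegral_ofReal]
  · rw [integral_finsetSum _ fun t _ => hw.integrable_stageCost S K 0 0 t]
    congr 1
    refine Finset.sum_congr rfl fun t _ => ?_
    rw [hw.integral_stageCost h]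
    simp
  · exact integrable_finsetSum _ fun t _ => hw.integrable_stageCost S K 0 0 t
  · refine Eventually.of_forall fun ω => Finset.sum_nonneg fun t _ => ?_
    rw [stageCost_eq]
    exact dot_nonneg (h.cm_psd K) _

lemma ofReal_div_natCast (x : ℝ) {n : ℕ} (hn : n ≠ 0) :
    ENNReal.ofReal x / (n : ℝ≥0∞) = ENNReal.ofReal ((n : ℝ)⁻¹ * x) := by
  have : (0 : ℝ) < n := by exact_mod_cast Nat.pos_of_ne_zero hn
  rw [inv_mul_eq_div, ENNReal.ofReal_div_of_pos this, ENNReal.ofReal_natCast]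

/-- The long run average cost of a stabilizing controller. -/
lemma IsNoise.J_of_stable [IsProbabilityMeasure P] (hw : IsNoise P w N W) {S : LQR dx du}
    {α ψ σ κ ν : ℝ} (h : Regular S N α ψ σ κ ν) {K : Matrix (Fin du) (Fin dx) ℝ}
    (hK : StableMat (S.cl K)) : S.J P w K = ENNReal.ofReal (S.cost N K) := by
  rw [hw.J_eq h]
  refine Tendsto.limUnder_eq ?_
  have h1 := ((tendsto_add_atTop_iff_nat 1).2 (Regular.tendsto_costN (N := N) hK)).cesaro
  refine ((ENNReal.continuous_ofReal.tendsto _).comp h1).congr' ?_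
  filter_upwards [eventually_ne_atTop 0] with n hn
  rw [ofReal_div_natCast _ hn]
  rfl

/-- A controller whose long run average cost is at most `b` stabilizes the system. -/
lemma IsNoise.mem_sublevel_of_J_le [IsProbabilityMeasure P] (hw : IsNoise P w N W) {S : LQR dx du}
    {α ψ σ κ ν : ℝ} (h : Regular S N α ψ σ κ ν) {K : Matrix (Fin du) (Fin dx) ℝ} {b : ℝ}
    (hb0 : 0 ≤ b) (hb : S.J P w K ≤ ENNReal.ofReal b) : K ∈ S.sublevel N b := by
  by_cases hbd : ∃ c, ∀ n, S.costN N K n ≤ c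
  · obtain ⟨c, hc⟩ := hbd
    have hst := h.stable_of_costN_le hc
    rw [hw.J_of_stable h hst] at hb
    exact h.mem_sublevel.2 ⟨hst, (ENNReal.ofReal_le_ofReal_iff hb0).1 hb⟩
  · exfalso
    push Not at hbd
    -- The finite-horizon costs are monotone and unbounded. Truncated at `c + 1` they are eventually
    -- constant, so their averages eventually exceed `c`; hence the averages themselves diverge.
    have hlim : Tendsto (fun n : ℕ => (n : ℝ)⁻¹ * ∑ t ∈ Finset.range n, S.costN N K (t + 1))
        atTop atTop := by
      refine tendsto_atTop.2 fun c => ?_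
      obtain ⟨k, hk⟩ := hbd (c + 1)
      have h1 : Tendsto (fun n : ℕ => min (S.costN N K (n + 1)) (c + 1)) atTop (𝓝 (c + 1)) := by
        refine tendsto_const_nhds.congr' ?_
        filter_upwards [eventually_ge_atTop k] with n hn
        exact (min_eq_right (hk.le.trans (h.costN_mono K (by omega)))).symm
      filter_upwards [h1.cesaro.eventually (lt_mem_nhds (lt_add_one c))] with n hn
      refine hn.le.trans (mul_le_mul_of_nonneg_left (Finset.sum_le_sum fun t _ => min_le_left _ _)
        (by positivity))
    have : S.J P w K = ⊤ := by
      rw [hw.J_eq h]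
      refine Tendsto.limUnder_eq ?_
      refine (ENNReal.tendsto_ofReal_atTop.comp hlim).congr' ?_
      filter_upwards [eventually_ne_atTop 0] with n hn
      rw [ofReal_div_natCast _ hn]
      rfl
    rw [this, top_le_iff] at hb
    exact ENNReal.ofReal_ne_top hb

lemma state_eq_sum (S : LQR dx du) (K : Matrix (Fin du) (Fin dx) ℝ) (w : ℕ → Fin dx → ℝ) (t₀ : ℕ)
    (x : Fin dx → ℝ) (s : ℕ) : S.state K w t₀ x s = S.cl K ^ s *ᵥ x
      + ∑ k ∈ Finset.range s, S.cl K ^ k *ᵥ w (t₀ + (s - 1 - k)) := by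
  induction s with
  | zero => simp [LQR.state]
  | succ s ih =>
    rw [state_succ, ih, Finset.sum_range_succ', Matrix.mulVec_add, Matrix.mulVec_mulVec,
      ← pow_succ', Matrix.mulVec_sum, add_assoc]
    congr 1
    simp only [pow_zero, Matrix.one_mulVec, Matrix.mulVec_mulVec, ← pow_succ']
    congr 1
    refine Finset.sum_congr rfl fun k hk => ?_
    have := Finset.mem_range.1 hk
    rw [show s + 1 - 1 - (k + 1) = s - 1 - k by omega]

/-- The decay rate `√(1 - κ⁻²)` of the closed loop. -/
def decay (κ : ℝ) : ℝ := √(1 - (κ ^ 2)⁻¹)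

lemma euclNorm_sum_le {n : ℕ} {ι : Type*} (s : Finset ι) (f : ι → Fin n → ℝ) :
    euclNorm (∑ i ∈ s, f i) ≤ ∑ i ∈ s, euclNorm (f i) := by
  simp only [euclNorm]
  rw [WithLp.toLp_sum]
  exact norm_sum_le _ _

/-- The bound `√(1 - y) ≤ 1 - y/2` with `y = κ⁻²` gives a spectral gap of at least `κ⁻²/2`. -/
lemma geom_decay_le {κ : ℝ} (hκ : 2 ≤ κ) (s : ℕ) :
    ∑ k ∈ Finset.range s, decay κ ^ k ≤ 2 * κ ^ 2 := by
  have hκ2 : 0 < (κ ^ 2)⁻¹ := by positivity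
  have h1 : decay κ ≤ 1 - (κ ^ 2)⁻¹ / 2 := by
    have h4 : (κ ^ 2)⁻¹ ≤ 1 := inv_le_one_of_one_le₀ (by nlinarith)
    refine Real.sqrt_le_iff.2 ⟨by linarith, ?_⟩
    nlinarith [sq_nonneg ((κ ^ 2)⁻¹)]
  have h0 : 0 ≤ decay κ := Real.sqrt_nonneg _
  have h2 := mul_geom_sum (decay κ) s
  have h3 : 0 ≤ decay κ ^ s := pow_nonneg h0 s
  have h5 : (∑ k ∈ Finset.range s, decay κ ^ k) * (κ ^ 2)⁻¹ ≤ 2 := by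
    have h6 : 0 ≤ ∑ k ∈ Finset.range s, decay κ ^ k := Finset.sum_nonneg fun k _ => pow_nonneg h0 k
    nlinarith
  rwa [← div_eq_mul_inv, div_le_iff₀ (by positivity)] at h5

/-! ### Pathwise bounds for the states -/

namespace Regular

variable {S : LQR dx du} {α ψ σ κ ν : ℝ} {K : Matrix (Fin du) (Fin dx) ℝ}

lemma euclNorm_pow_le' (h : Regular S N α ψ σ κ ν) (hK : K ∈ S.sublevel N ν) (x : Fin dx → ℝ)
    (k : ℕ) : euclNorm (S.cl K ^ k *ᵥ x) ≤ decay κ ^ k * (κ * euclNorm x) := by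
  have hκ := h.κ_pos
  have h0 : 0 ≤ decay κ := Real.sqrt_nonneg _
  refine abs_le_of_sq_le_sq' ?_ (mul_nonneg (pow_nonneg h0 k)
    (mul_nonneg hκ.le (euclNorm_nonneg _))) |>.2
  refine (h.euclNorm_pow_le hK x k).trans (le_of_eq ?_)
  rw [mul_pow, ← pow_mul, mul_comm k 2, pow_mul, decay, Real.sq_sqrt h.one_sub_nonneg, mul_pow]

/-- States stay bounded under a good controller. -/
lemma euclNorm_state_le (h : Regular S N α ψ σ κ ν) (hK : K ∈ S.sublevel N ν)
    {w : ℕ → Fin dx → ℝ} (hw : ∀ t, euclNorm (w t) ≤ W) (t₀ : ℕ) (x : Fin dx → ℝ) (s : ℕ) :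
    euclNorm (S.state K w t₀ x s) ≤ decay κ ^ s * (κ * euclNorm x) + 2 * κ ^ 3 * W := by
  have hκ := h.κ_pos
  have hW : 0 ≤ W := (euclNorm_nonneg _).trans (hw 0)
  rw [state_eq_sum]
  refine (euclNorm_add_le _ _).trans (add_le_add (h.euclNorm_pow_le' hK x s) ?_)
  refine (euclNorm_sum_le _ _).trans ((Finset.sum_le_sum fun k _ =>
    (h.euclNorm_pow_le' hK _ k).trans (mul_le_mul_of_nonneg_left
      (mul_le_mul_of_nonneg_left (hw _) hκ.le)
      (pow_nonneg (Real.sqrt_nonneg _) k))).trans ?_)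
  rw [← Finset.sum_mul]
  calc _ ≤ 2 * κ ^ 2 * (κ * W) := by gcongr; exact geom_decay_le h.hκ s
    _ = _ := by ring

end Regular

end Noise

/-! ### Gaussian directions -/

section Direction

variable {E : Type*} [NormedAddCommGroup E]

/-- The direction `v / ‖v‖`. -/
def dir [NormedSpace ℝ E] (v : E) : E := ‖v‖⁻¹ • v

/-- At `v = 0` the direction is `0` by convention. Hypotheses stated on the closed unit ball
therefore apply to every value of `dir`, and the null event needs no separate treatment. -/
lemma norm_dir_le [NormedSpace ℝ E] (v : E) : ‖dir v‖ ≤ 1 := by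
  rw [dir, norm_smul, norm_inv, norm_norm]
  exact inv_mul_le_one

lemma norm_dir [NormedSpace ℝ E] {v : E} (hv : v ≠ 0) : ‖dir v‖ = 1 := by
  rw [dir, norm_smul, norm_inv, norm_norm, inv_mul_cancel₀ (norm_ne_zero_iff.2 hv)]

variable [InnerProductSpace ℝ E]

lemma abs_inner_dir_le (v a : E) : |inner ℝ (dir v) a| ≤ ‖a‖ :=
  (abs_real_inner_le_norm _ _).trans (by
    have := mul_le_mul_of_nonneg_right (norm_dir_le v) (norm_nonneg a); rwa [one_mul] at this)

lemma dir_isometry (ρ : E ≃ₗᵢ[ℝ] E) (v : E) : dir (ρ v) = ρ (dir v) := by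
  simp [dir]

lemma abs_le_of_lip {f : E → ℝ} {L : ℝ}
    (hf : ∀ u u', ‖u‖ ≤ 1 → ‖u'‖ ≤ 1 → |f u - f u'| ≤ L * ‖u - u'‖) (hL : 0 ≤ L) (v : E) :
    |f (dir v)| ≤ |f 0| + L := by
  have h1 := hf (dir v) 0 (norm_dir_le v) (by simp)
  rw [sub_zero] at h1
  have h2 := mul_le_mul_of_nonneg_left (norm_dir_le v) hL
  have h3 := abs_add_le (f (dir v) - f 0) (f 0)
  rw [sub_add_cancel] at h3
  linarith

variable [MeasurableSpace E] [BorelSpace E]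

lemma measurable_dir [SecondCountableTopology E] : Measurable (dir : E → E) :=
  measurable_norm.inv.smul measurable_id

variable [FiniteDimensional ℝ E]

/-- The standard Gaussian law is invariant under linear isometries, which commute with `dir`. -/
lemma integral_dir_comp (ρ : E ≃ₗᵢ[ℝ] E) (F : E → ℝ) :
    ∫ v, F (ρ (dir v)) ∂(stdGaussian E) = ∫ v, F (dir v) ∂(stdGaussian E) := by
  simp only [← dir_isometry]
  conv_rhs => rw [← stdGaussian_map (E := E) (F := E) ρ]
  exact (integral_map_equiv ρ.toHomeomorph.toMeasurableEquiv fun v => F (dir v)).symm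

lemma measurable_inner_dir (a : E) : Measurable fun v : E => inner ℝ (dir v) a :=
  measurable_dir.inner measurable_const

lemma integrable_inner_dir_mul (a b : E) :
    Integrable (fun v => inner ℝ (dir v) a * inner ℝ (dir v) b) (stdGaussian E) := by
  refine Integrable.of_bound (C := ‖a‖ * ‖b‖)
    ((measurable_inner_dir a).mul (measurable_inner_dir b)).aestronglyMeasurable
    (Eventually.of_forall fun v => ?_)
  rw [Real.norm_eq_abs, abs_mul]
  exact mul_le_mul (abs_inner_dir_le v a) (abs_inner_dir_le v b) (abs_nonneg _) (norm_nonneg _)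

/-- A one-dimensional marginal along a nonzero vector is a nondegenerate Gaussian and has no atom at
`0`. -/
lemma ae_ne_zero_stdGaussian [Nontrivial E] : ∀ᵐ v ∂(stdGaussian E), v ≠ 0 := by
  obtain ⟨e, he⟩ := exists_ne (0 : E)
  set L : StrongDual ℝ E := innerSL ℝ e with hL
  have hmap := IsGaussian.map_eq_gaussianReal (μ := stdGaussian E) L
  have hv : Var[L; stdGaussian E].toNNReal ≠ 0 := by
    rw [variance_dual_stdGaussian, Ne, Real.toNNReal_eq_zero, not_le, hL, innerSL_apply_norm]
    positivity
  have := nullSingletonClass_gaussianReal (μ := (stdGaussian E)[L]) hv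
  have h0 : (stdGaussian E).map L {0} = 0 := by rw [hmap]; exact measure_singleton 0
  rw [Measure.map_apply L.continuous.measurable (measurableSet_singleton 0)] at h0
  refine measure_mono_null (fun v hv => ?_) h0
  simp only [Set.mem_compl_iff, Set.mem_ofPred_eq, not_not] at hv
  simp [hv]

/-- By rotation invariance all unit vectors give the same second moment, and over an orthonormal
basis the moments sum to `𝔼 ‖dir v‖² = 1`. -/
lemma integral_inner_dir_sq (a : E) :
    ∫ v, inner ℝ (dir v) a ^ 2 ∂(stdGaussian E) = ‖a‖ ^ 2 / Module.finrank ℝ E := by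
  rcases subsingleton_or_nontrivial E with hE | hE
  · simp [Subsingleton.elim a 0]
  have hrot : ∀ a b : E, ‖a‖ = ‖b‖ → ∫ v, inner ℝ (dir v) a ^ 2 ∂(stdGaussian E)
      = ∫ v, inner ℝ (dir v) b ^ 2 ∂(stdGaussian E) := by
    intro a b hab
    obtain ⟨ρ, rfl⟩ : ∃ ρ : E ≃ₗᵢ[ℝ] E, ρ a = b := ⟨_, Submodule.reflection_sub hab⟩
    rw [← integral_dir_comp ρ fun u => inner ℝ u (ρ a) ^ 2]
    simp only [LinearIsometryEquiv.inner_map_map]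
  have hint : ∀ a : E, Integrable (fun v => inner ℝ (dir v) a ^ 2) (stdGaussian E) := fun a => by
    simpa only [sq] using integrable_inner_dir_mul a a
  set b := stdOrthonormalBasis ℝ E
  have hsum : ∑ i, ∫ v, inner ℝ (dir v) (b i) ^ 2 ∂(stdGaussian E) = 1 := by
    rw [← integral_finsetSum _ fun i _ => hint _]
    have : ∀ᵐ v ∂(stdGaussian E), ∑ i, inner ℝ (dir v) (b i) ^ 2 = 1 := by
      filter_upwards [ae_ne_zero_stdGaussian] with v hv
      rw [b.sum_sq_inner_left, norm_dir hv, one_pow]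
    rw [integral_congr_ae this]
    simp
  have hd : (Module.finrank ℝ E : ℝ) ≠ 0 := by exact_mod_cast (Module.finrank_pos (R := ℝ)).ne'
  have hone : ∀ c : E, ‖c‖ = 1 → ∫ v, inner ℝ (dir v) c ^ 2 ∂(stdGaussian E)
      = 1 / Module.finrank ℝ E := by
    intro c hc
    have : ∀ i, ∫ v, inner ℝ (dir v) (b i) ^ 2 ∂(stdGaussian E)
        = ∫ v, inner ℝ (dir v) c ^ 2 ∂(stdGaussian E) := fun i =>
      hrot _ _ (by rw [hc, b.norm_eq_one])
    simp only [this, Finset.sum_const, Finset.card_univ, Fintype.card_fin, nsmul_eq_mul] at hsum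
    rw [eq_div_iff hd, mul_comm]
    exact hsum
  rcases eq_or_ne a 0 with rfl | ha
  · simp
  · have h1 := hone (dir a) (norm_dir ha)
    have h2 : ∀ v, inner ℝ (dir v) a ^ 2 = ‖a‖ ^ 2 * inner ℝ (dir v) (dir a) ^ 2 := by
      intro v
      rw [← mul_pow, ← real_inner_smul_right]
      congr 2
      rw [dir, smul_inv_smul₀ (norm_ne_zero_iff.2 ha)]
    simp only [h2]
    rw [integral_const_mul, h1]
    ring

lemma integral_inner_dir_mul (a b : E) :
    ∫ v, inner ℝ (dir v) a * inner ℝ (dir v) b ∂(stdGaussian E)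
      = inner ℝ a b / Module.finrank ℝ E := by
  have h : ∀ v, inner ℝ (dir v) a * inner ℝ (dir v) b
      = (1 / 4 : ℝ) * (inner ℝ (dir v) (a + b) ^ 2 - inner ℝ (dir v) (a - b) ^ 2) := by
    intro v
    rw [inner_add_right, inner_sub_right]; ring
  have hint : ∀ a : E, Integrable (fun v => inner ℝ (dir v) a ^ 2) (stdGaussian E) := fun a => by
    simpa only [sq] using integrable_inner_dir_mul a a
  simp only [h]
  rw [integral_const_mul, integral_sub (hint _) (hint _), integral_inner_dir_sq,
    integral_inner_dir_sq, @norm_add_sq_real, @norm_sub_sq_real]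
  ring

/-- Nothing is known about `f` outside the unit ball, so measurability goes through the restriction
of `f` to the ball, where it is continuous. -/
lemma measurable_comp_dir {f : E → ℝ} {L : ℝ}
    (hf : ∀ u u', ‖u‖ ≤ 1 → ‖u'‖ ≤ 1 → |f u - f u'| ≤ L * ‖u - u'‖) :
    Measurable fun v => f (dir v) := by
  have hc : ContinuousOn f (Metric.closedBall 0 1) := by
    refine (LipschitzOnWith.of_dist_le_mul (K := L.toNNReal) fun u hu u' hu' => ?_).continuousOn
    rw [mem_closedBall_zero_iff] at hu hu'
    rw [Real.dist_eq, dist_eq_norm]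
    exact (hf u u' hu hu').trans (mul_le_mul_of_nonneg_right (Real.le_coe_toNNReal L)
      (norm_nonneg _))
  exact hc.domRestrict.measurable.comp (measurable_dir.subtype_mk
    (h := fun v => mem_closedBall_zero_iff.2 (norm_dir_le v)))

lemma integrable_lip_mul {f : E → ℝ} {L : ℝ}
    (hf : ∀ u u', ‖u‖ ≤ 1 → ‖u'‖ ≤ 1 → |f u - f u'| ≤ L * ‖u - u'‖) (hL : 0 ≤ L) (a : E) :
    Integrable (fun v => f (dir v) * inner ℝ (dir v) a) (stdGaussian E) := by
  refine Integrable.of_bound (C := (|f 0| + L) * ‖a‖)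
    ((measurable_comp_dir hf).mul (measurable_inner_dir a)).aestronglyMeasurable
    (Eventually.of_forall fun v => ?_)
  rw [Real.norm_eq_abs, abs_mul]
  exact mul_le_mul (abs_le_of_lip hf hL v) (abs_inner_dir_le v a) (abs_nonneg _) (by positivity)

/-- A Lipschitz function of a uniform direction is nearly uncorrelated with the direction. -/
lemma abs_integral_lip_le {f : E → ℝ} {L : ℝ}
    (hf : ∀ u u', ‖u‖ ≤ 1 → ‖u'‖ ≤ 1 → |f u - f u'| ≤ L * ‖u - u'‖) (hL : 0 ≤ L) (a : E) :
    |∫ v, f (dir v) * inner ℝ (dir v) a ∂(stdGaussian E)| ≤ L * ‖a‖ / Module.finrank ℝ E := by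
  rcases eq_or_ne a 0 with rfl | ha
  · simp
  have hna : 0 < ‖a‖ := norm_pos_iff.2 ha
  -- The reflection in the hyperplane orthogonal to `a`. It preserves the law of the direction and
  -- flips the sign of `⟨u, a⟩`, so only the part of `f` that is odd under `ρ` contributes to the
  -- integral.
  set ρ := Submodule.reflection (Submodule.span ℝ {a})ᗮ with hρ
  have hρa : ρ a = -a := by
    rw [hρ, Submodule.reflection_orthogonalComplement_singleton_eq_neg]
  have hinner : ∀ u, inner ℝ (ρ u) a = -inner ℝ u a := by
    intro u
    have := LinearIsometryEquiv.inner_map_map ρ u a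
    rw [hρa, inner_neg_right] at this
    linarith
  -- The reflection moves `u` by twice its distance to the hyperplane. The Lipschitz bound thus
  -- supplies a second factor `|⟨u, a⟩|`, whose mean square is `‖a‖² / dim E`.
  have hdist : ∀ u, ‖u - ρ u‖ = 2 * |inner ℝ u a| / ‖a‖ := by
    intro u
    have h1 : ‖u - ρ u‖ ^ 2 = (2 * |inner ℝ u a| / ‖a‖) ^ 2 := by
      have : ρ u = u - (2 * inner ℝ u a / ‖a‖ ^ 2) • a := by
        rw [hρ, Submodule.reflection_orthogonal_apply, Submodule.reflection_singleton_apply]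
        rw [real_inner_comm, neg_sub, ← smul_assoc]
        congr 2
        simp; ring
      rw [this, sub_sub_cancel, norm_smul, Real.norm_eq_abs, mul_pow, sq_abs, div_pow, div_pow,
        mul_pow, mul_pow, sq_abs]
      field_simp
    exact (pow_left_inj₀ (norm_nonneg _) (by positivity) two_ne_zero).1 h1
  set I := ∫ v, f (dir v) * inner ℝ (dir v) a ∂(stdGaussian E) with hI
  have hf' : ∀ u u', ‖u‖ ≤ 1 → ‖u'‖ ≤ 1 → |f (ρ u) - f (ρ u')| ≤ L * ‖u - u'‖ := by
    intro u u' hu hu'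
    have := hf (ρ u) (ρ u') (by rwa [LinearIsometryEquiv.norm_map])
      (by rwa [LinearIsometryEquiv.norm_map])
    rwa [← map_sub, LinearIsometryEquiv.norm_map] at this
  have e1 : I = -∫ v, f (ρ (dir v)) * inner ℝ (dir v) a ∂(stdGaussian E) := by
    rw [hI, ← integral_dir_comp ρ fun u => f u * inner ℝ u a, ← integral_neg]
    simp only [hinner, mul_neg]
  have i1 := integrable_lip_mul hf hL a
  have i2 := integrable_lip_mul (f := fun u => f (ρ u)) hf' hL a
  have e2 : 2 * I = ∫ v, (f (dir v) - f (ρ (dir v))) * inner ℝ (dir v) a ∂(stdGaussian E) := by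
    simp only [sub_mul]
    rw [integral_sub i1 i2]
    linarith
  have hb : ∀ v, |(f (dir v) - f (ρ (dir v))) * inner ℝ (dir v) a|
      ≤ 2 * L / ‖a‖ * inner ℝ (dir v) a ^ 2 := by
    intro v
    have h1 := hf (dir v) (ρ (dir v)) (norm_dir_le v)
      (by rw [LinearIsometryEquiv.norm_map]; exact norm_dir_le v)
    rw [hdist] at h1
    rw [abs_mul, ← sq_abs (inner ℝ (dir v) a)]
    calc _ ≤ L * (2 * |inner ℝ (dir v) a| / ‖a‖) * |inner ℝ (dir v) a| := by gcongr
      _ = _ := by ring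
  have hint : Integrable (fun v => inner ℝ (dir v) a ^ 2) (stdGaussian E) := by
    simpa only [sq] using integrable_inner_dir_mul a a
  have h2 : |2 * I| ≤ 2 * L / ‖a‖ * (‖a‖ ^ 2 / Module.finrank ℝ E) := by
    rw [e2, ← integral_inner_dir_sq a, ← integral_const_mul]
    exact (abs_integral_le_integral_abs).trans (integral_mono_of_nonneg
      (Eventually.of_forall fun v => abs_nonneg _) (hint.const_mul _)
      (Eventually.of_forall hb))
  rw [abs_mul, abs_two] at h2
  have h3 : 2 * L / ‖a‖ * (‖a‖ ^ 2 / Module.finrank ℝ E) = 2 * (L * ‖a‖ / Module.finrank ℝ E) := by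
    field_simp
  linarith

/-- One-point gradient estimation on the sphere. -/
lemma abs_integral_sub_le {f : E → ℝ} {g : E} {L : ℝ} (hL : 0 ≤ L)
    (hf : ∀ u u', ‖u‖ ≤ 1 → ‖u'‖ ≤ 1 → |f u - f u' - inner ℝ g (u - u')| ≤ L * ‖u - u'‖) (a : E) :
    |∫ v, f (dir v) * inner ℝ (dir v) a ∂(stdGaussian E) - inner ℝ g a / Module.finrank ℝ E|
      ≤ L * ‖a‖ / Module.finrank ℝ E := by
  have hR : ∀ u u', ‖u‖ ≤ 1 → ‖u'‖ ≤ 1 →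
      |(f u - inner ℝ g u) - (f u' - inner ℝ g u')| ≤ L * ‖u - u'‖ := by
    intro u u' hu hu'
    have := hf u u' hu hu'
    rw [inner_sub_right] at this
    convert this using 2
    ring
  -- The linear part is correlated with the direction exactly as in `integral_inner_dir_mul`; only
  -- the Lipschitz remainder causes bias.
  have h1 := abs_integral_lip_le hR hL a
  have e : ∫ v, f (dir v) * inner ℝ (dir v) a ∂(stdGaussian E) - inner ℝ g a / Module.finrank ℝ E
      = ∫ v, (f (dir v) - inner ℝ g (dir v)) * inner ℝ (dir v) a ∂(stdGaussian E) := by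
    have i1 := integrable_lip_mul hR hL a
    have i2 := integrable_inner_dir_mul g a
    rw [← integral_inner_dir_mul g a, sub_eq_iff_eq_add, ← integral_add i1 i2]
    congr 1
    funext v
    rw [real_inner_comm g (dir v)]
    ring
  rw [e]
  exact h1

end Direction

/-! ### Concentration of vector-valued martingales -/

section Azuma

/-- `cosh x` is a power series in `x²` with nonnegative coefficients, hence monotone and convex as a
function of `x²`; the inequality holds term by term. -/
lemma cosh_le_of_sq_le {x y z θ : ℝ} (h0 : 0 ≤ θ) (h1 : θ ≤ 1)
    (h : x ^ 2 ≤ θ * y ^ 2 + (1 - θ) * z ^ 2) :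
    Real.cosh x ≤ θ * Real.cosh y + (1 - θ) * Real.cosh z := by
  refine hasSum_le (fun n => ?_) (Real.hasSum_cosh x)
    (((Real.hasSum_cosh y).mul_left θ).add ((Real.hasSum_cosh z).mul_left (1 - θ)))
  have h2 : (x ^ 2) ^ n ≤ θ * (y ^ 2) ^ n + (1 - θ) * (z ^ 2) ^ n := by
    refine (pow_le_pow_left₀ (sq_nonneg x) h n).trans ?_
    have := (convexOn_pow n).2 (Set.mem_Ici.2 (sq_nonneg y)) (Set.mem_Ici.2 (sq_nonneg z))
      h0 (sub_nonneg.2 h1) (by ring)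
    simpa using this
  rw [← mul_div_assoc, ← mul_div_assoc, ← add_div, pow_mul, pow_mul, pow_mul]
  gcongr

variable {E : Type*} [NormedAddCommGroup E] [InnerProductSpace ℝ E]

/-- With `s = ⟨D, S⟩`, the number `‖S + D‖²` is at most `‖S‖² + c² + 2 s`. This is the convex
combination of `(‖S‖ + c)²` and `(‖S‖ - c)²` with weight `(1 + s/(‖S‖ c))/2` on the first, so
convexity of `cosh` in the square applies. The resulting bound is affine in `D`, hence easy to
average. -/
lemma cosh_norm_add_le (S D : E) {c : ℝ} (hc : 0 < c) (hD : ‖D‖ ≤ c) (l : ℝ) :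
    Real.cosh (l * ‖S + D‖) ≤ Real.cosh (l * ‖S‖) * Real.cosh (l * c)
      + inner ℝ D S * (Real.sinh (l * ‖S‖) * Real.sinh (l * c) / (‖S‖ * c)) := by
  rcases eq_or_ne S 0 with rfl | hS
  · simp only [zero_add, norm_zero, mul_zero, Real.cosh_zero, one_mul, inner_zero_right, zero_mul,
      add_zero]
    rw [Real.cosh_le_cosh, abs_mul, abs_mul, abs_norm, abs_of_pos hc]
    gcongr
  have ha : 0 < ‖S‖ := norm_pos_iff.2 hS
  set s := inner ℝ D S with hs
  have hsb : |s| ≤ ‖S‖ * c := (abs_real_inner_le_norm D S).trans (by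
    rw [mul_comm]; exact mul_le_mul_of_nonneg_left hD ha.le)
  have hac : 0 < ‖S‖ * c := mul_pos ha hc
  have hq : |s / (‖S‖ * c)| ≤ 1 := by
    rw [abs_div, abs_of_pos hac]; exact (div_le_one hac).2 hsb
  obtain ⟨hq1, hq2⟩ := abs_le.1 hq
  have hsq : (l * ‖S + D‖) ^ 2 ≤ (1 + s / (‖S‖ * c)) / 2 * (l * (‖S‖ + c)) ^ 2
      + (1 - (1 + s / (‖S‖ * c)) / 2) * (l * (‖S‖ - c)) ^ 2 := by
    have e1 : ‖S + D‖ ^ 2 = ‖S‖ ^ 2 + 2 * s + ‖D‖ ^ 2 := by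
      rw [@norm_add_sq_real, real_inner_comm]
    have e2 : ‖D‖ ^ 2 ≤ c ^ 2 := pow_le_pow_left₀ (norm_nonneg _) hD 2
    have e3 : (1 + s / (‖S‖ * c)) / 2 * (l * (‖S‖ + c)) ^ 2
      + (1 - (1 + s / (‖S‖ * c)) / 2) * (l * (‖S‖ - c)) ^ 2
      = l ^ 2 * (‖S‖ ^ 2 + c ^ 2 + 2 * s) := by
      field_simp
      ring
    rw [e3, mul_pow, e1]
    exact mul_le_mul_of_nonneg_left (by linarith) (sq_nonneg l)
  refine (cosh_le_of_sq_le (by linarith) (by linarith) hsq).trans (le_of_eq ?_)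
  rw [mul_add, mul_sub, Real.cosh_add, Real.cosh_sub]
  ring

variable {Ω 𝒵 𝒴 : Type*} [MeasurableSpace 𝒵] [MeasurableSpace 𝒴]

/-- Integrating out a variable that is independent of the past. -/
lemma setLIntegral_le_of_indep {m mΩ : MeasurableSpace Ω} {P : Measure Ω}
    [IsProbabilityMeasure P] (hm : m ≤ mΩ) {Y : Ω → 𝒴}
    (hY : Measurable Y) {Q : Measure 𝒴} [IsProbabilityMeasure Q] (hQ : P.map Y = Q)
    (hind : Indep m (MeasurableSpace.comap Y inferInstance) P) {A : Set Ω}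
    (hA : MeasurableSet[m] A) {Z : Ω → 𝒵} (hZ : Measurable[m] Z) {Φ : 𝒵 → ℝ≥0∞}
    {Φ' : 𝒵 × 𝒴 → ℝ≥0∞} (hΦ' : Measurable Φ')
    (h : ∀ᵐ ω ∂P, ω ∈ A → ∫⁻ y, Φ' (Z ω, y) ∂Q ≤ Φ (Z ω)) :
    ∫⁻ ω in A, Φ' (Z ω, Y ω) ∂P ≤ ∫⁻ ω in A, Φ (Z ω) ∂P := by
  classical
  have hA' := hm A hA
  have hZ' : Measurable Z := hZ.mono hm le_rfl
  -- The indicator of `A` is carried along as a coordinate of the past, so that independence of `(I,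
  -- Z)` and `Y` handles the restriction to `A` together with `Z`.
  set I : Ω → ℝ≥0∞ := A.indicator 1 with hI
  have hIm : Measurable[m] I := (@measurable_const _ _ _ m 1).indicator hA
  have hIZm : Measurable[m] fun ω => (I ω, Z ω) := hIm.prodMk hZ
  have hIZ : Measurable fun ω => (I ω, Z ω) := hIZm.mono hm le_rfl
  have hindf : IndepFun (fun ω => (I ω, Z ω)) Y P :=
    (IndepFun_iff_Indep _ _ _).2 (indep_of_indep_of_le_left hind hIZm.comap_le)
  have hmap := (indepFun_iff_map_prod_eq_prod_map_map hIZ.aemeasurable hY.aemeasurable).1 hindf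
  rw [hQ] at hmap
  have hΨ : Measurable fun p : (ℝ≥0∞ × 𝒵) × 𝒴 => p.1.1 * Φ' (p.1.2, p.2) := by fun_prop
  have e1 : ∫⁻ ω in A, Φ' (Z ω, Y ω) ∂P = ∫⁻ ω, I ω * Φ' (Z ω, Y ω) ∂P := by
    rw [← lintegral_indicator hA']
    congr 1
    funext ω
    by_cases hω : ω ∈ A <;> simp [hI, hω]
  have e2 : ∫⁻ ω in A, Φ (Z ω) ∂P = ∫⁻ ω, I ω * Φ (Z ω) ∂P := by
    rw [← lintegral_indicator hA']
    congr 1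
    funext ω
    by_cases hω : ω ∈ A <;> simp [hI, hω]
  have e3 : ∫⁻ ω, I ω * Φ' (Z ω, Y ω) ∂P = ∫⁻ ω, I ω * ∫⁻ y, Φ' (Z ω, y) ∂Q ∂P := by
    have h1 := lintegral_map (μ := P) hΨ (hIZ.prodMk hY)
    rw [hmap, lintegral_prod _ hΨ.aemeasurable,
      lintegral_map (hΨ.lintegral_prod_right') hIZ] at h1
    rw [← h1]
    congr 1
    funext ω
    exact lintegral_const_mul _ (hΦ'.comp measurable_prodMk_left)
  rw [e1, e2, e3]
  refine lintegral_mono_ae ?_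
  filter_upwards [h] with ω hω
  by_cases hωA : ω ∈ A
  · exact mul_le_mul_right (hω hωA) _
  · simp [hI, hωA]

variable [MeasurableSpace E] [BorelSpace E] [SecondCountableTopology E]

/-- In the pointwise bound `cosh_norm_add_le` the term linear in the increment has mean zero. The
growth factor `cosh (l c)` depends on neither the dimension nor `S`. -/
lemma lintegral_cosh_le {Q : Measure 𝒴} [IsProbabilityMeasure Q] {D : 𝒴 → E} (hD : Measurable D)
    {c : ℝ} (hc : 0 < c) (hb : ∀ᵐ y ∂Q, ‖D y‖ ≤ c) (hmean : ∀ a, ∫ y, inner ℝ (D y) a ∂Q = 0)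
    (S : E) (l : ℝ) :
    ∫⁻ y, ENNReal.ofReal (Real.cosh (l * ‖S + D y‖)) ∂Q
      ≤ ENNReal.ofReal (Real.cosh (l * c)) * ENNReal.ofReal (Real.cosh (l * ‖S‖)) := by
  set k := Real.sinh (l * ‖S‖) * Real.sinh (l * c) / (‖S‖ * c)
  have hint : Integrable (fun y => inner ℝ (D y) S * k) Q := by
    refine (Integrable.of_bound (C := c * ‖S‖) (hD.inner measurable_const).aestronglyMeasurable
      ?_).mul_const k
    filter_upwards [hb] with y hy
    exact (norm_inner_le_norm (𝕜 := ℝ) _ _).trans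
      (mul_le_mul_of_nonneg_right hy (norm_nonneg _))
  have hle : ∀ᵐ y ∂Q, Real.cosh (l * ‖S + D y‖)
      ≤ Real.cosh (l * ‖S‖) * Real.cosh (l * c) + inner ℝ (D y) S * k := by
    filter_upwards [hb] with y hy
    exact cosh_norm_add_le S (D y) hc hy l
  have he : ∫ y, inner ℝ (D y) S * k ∂Q = 0 := by
    rw [integral_mul_const, hmean, zero_mul]
  have hint2 : Integrable (fun y => Real.cosh (l * ‖S‖) * Real.cosh (l * c)
      + inner ℝ (D y) S * k) Q := (integrable_const _).add hint
  refine (lintegral_mono_ae (hle.mono fun y hy => ENNReal.ofReal_le_ofReal hy)).trans ?_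
  rw [← ofReal_integral_eq_lintegral_ofReal hint2
    (hle.mono fun y hy => (Real.cosh_pos _).le.trans hy),
    integral_add (integrable_const _) hint, he, add_zero,
    ← ENNReal.ofReal_mul (Real.cosh_pos _).le]
  simp [mul_comm]

/-- Azuma's inequality in Hilbert space, on an event of the past. -/
theorem azuma {mΩ : MeasurableSpace Ω} {P : Measure Ω} [IsProbabilityMeasure P] {n : ℕ}
    {c t : ℝ} (hc : 0 < c) (ht : 0 ≤ t) {A : Set Ω} {m : ℕ → MeasurableSpace Ω}
    (hm : ∀ i, m i ≤ mΩ) (hA : ∀ i, MeasurableSet[m i] A) {Z : ℕ → Ω → 𝒵}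
    (hZ : ∀ i, Measurable[m i] (Z i)) {Y : ℕ → Ω → 𝒴} (hY : ∀ i, Measurable (Y i))
    {Q : Measure 𝒴} [IsProbabilityMeasure Q] (hQ : ∀ i, P.map (Y i) = Q)
    (hind : ∀ i, Indep (m i) (MeasurableSpace.comap (Y i) inferInstance) P)
    {D : 𝒵 → 𝒴 → E} (hD : Measurable (Function.uncurry D))
    (hb : ∀ i, ∀ᵐ ω ∂P, ω ∈ A → ∀ᵐ y ∂Q, ‖D (Z i ω) y‖ ≤ c)
    (hmean : ∀ i, ∀ᵐ ω ∂P, ω ∈ A → ∀ a, ∫ y, inner ℝ (D (Z i ω) y) a ∂Q = 0)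
    {S : ℕ → Ω → E} (hS0 : ∀ ω, S 0 ω = 0) (hS : ∀ i, Measurable[m i] (S i))
    (hSs : ∀ i ω, S (i + 1) ω = S i ω + D (Z i ω) (Y i ω)) (hn : 0 < n) :
    P (A ∩ {ω | t ≤ ‖S n ω‖}) ≤ ENNReal.ofReal (2 * Real.exp (-(t ^ 2 / (2 * n * c ^ 2)))) := by
  have hn' : (0 : ℝ) < n := by exact_mod_cast hn
  -- The minimizer of the exponent `n l² c² / 2 - l t`.
  set l := t / (n * c ^ 2) with hl
  have hl0 : 0 ≤ l := by positivity
  have key : ∀ i, ∫⁻ ω in A, ENNReal.ofReal (Real.cosh (l * ‖S i ω‖)) ∂P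
      ≤ ENNReal.ofReal (Real.cosh (l * c)) ^ i := by
    intro i
    induction i with
    | zero =>
      simp only [hS0, norm_zero, mul_zero, Real.cosh_zero, ENNReal.ofReal_one, pow_zero,
        lintegral_const, one_mul, Measure.restrict_apply MeasurableSet.univ, Set.univ_inter]
      exact prob_le_one
    | succ i ih =>
      have hmeas : Measurable fun p : (𝒵 × E) × 𝒴 =>
          ENNReal.ofReal (Real.cosh (l * ‖p.1.2 + D p.1.1 p.2‖)) := by
        have : Measurable fun p : (𝒵 × E) × 𝒴 => D p.1.1 p.2 :=
          hD.comp ((measurable_fst.comp measurable_fst).prodMk measurable_snd)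
        have h2 : Measurable fun p : (𝒵 × E) × 𝒴 => ‖p.1.2 + D p.1.1 p.2‖ :=
          ((measurable_snd.comp measurable_fst).add this).norm
        exact (Real.continuous_cosh.measurable.comp (h2.const_mul l)).ennreal_ofReal
      -- The pair `(Z i, S i)` and the event `A` are known before `Y i`, so integrating out `Y i` on
      -- `A` multiplies the bound by at most `cosh (l c)`.
      have h1 := setLIntegral_le_of_indep (hm i) (hY i) (hQ i) (hind i) (hA i)
        ((hZ i).prodMk (hS i)) (Φ := fun p => ENNReal.ofReal (Real.cosh (l * c)) *
          ENNReal.ofReal (Real.cosh (l * ‖p.2‖))) hmeas (by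
            filter_upwards [hb i, hmean i] with ω h1 h2 hω
            exact lintegral_cosh_le (hD.comp measurable_prodMk_left) hc (h1 hω) (h2 hω) _ _)
      simp only [hSs]
      refine h1.trans ?_
      rw [lintegral_const_mul', pow_succ']
      · exact mul_le_mul_right ih _
      · exact ENNReal.ofReal_ne_top
  have hSm : Measurable (S n) := (hS n).mono (hm n) le_rfl
  have hset : MeasurableSet {ω | t ≤ ‖S n ω‖} := measurableSet_le measurable_const hSm.norm
  -- Markov's inequality on `A` for `cosh (l ‖S n‖)`.
  have h1 : ENNReal.ofReal (Real.cosh (l * t)) * P (A ∩ {ω | t ≤ ‖S n ω‖})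
      ≤ ENNReal.ofReal (Real.cosh (l * c)) ^ n := by
    refine le_trans ?_ (key n)
    rw [Set.inter_comm, ← Measure.restrict_apply hset, ← setLIntegral_const]
    refine (setLIntegral_mono' hset fun ω hω => ?_).trans (setLIntegral_le_lintegral _ _)
    refine ENNReal.ofReal_le_ofReal (Real.cosh_le_cosh.2 ?_)
    have : t ≤ ‖S n ω‖ := hω
    rw [abs_mul, abs_mul, abs_of_nonneg ht, abs_norm]
    gcongr
  have h2 : Real.cosh (l * c) ^ n ≤ Real.exp (t ^ 2 / (2 * n * c ^ 2)) := by
    refine (pow_le_pow_left₀ (Real.cosh_pos _).le (Real.cosh_le_exp_half_sq _) n).trans ?_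
    rw [← Real.exp_nat_mul]
    refine le_of_eq ?_
    congr 1
    rw [hl]
    field_simp
  have h3 : Real.exp (t ^ 2 / (n * c ^ 2)) / 2 ≤ Real.cosh (l * t) := by
    have : l * t = t ^ 2 / (n * c ^ 2) := by rw [hl]; ring
    rw [this, Real.cosh_eq]
    linarith [Real.exp_pos (-(t ^ 2 / (n * c ^ 2)))]
  have h4 : 0 < Real.cosh (l * t) := Real.cosh_pos _
  have h5 : P (A ∩ {ω | t ≤ ‖S n ω‖}) ≤ ENNReal.ofReal (Real.cosh (l * c)) ^ n
      / ENNReal.ofReal (Real.cosh (l * t)) := by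
    rw [ENNReal.le_div_iff_mul_le (Or.inl (by simpa using h4)) (Or.inl ENNReal.ofReal_ne_top),
      mul_comm]
    exact h1
  refine h5.trans ?_
  rw [← ENNReal.ofReal_pow (Real.cosh_pos _).le, ← ENNReal.ofReal_div_of_pos h4]
  refine ENNReal.ofReal_le_ofReal ?_
  rw [div_le_iff₀ h4]
  refine h2.trans ?_
  have h6 : Real.exp (t ^ 2 / (2 * n * c ^ 2))
      = 2 * Real.exp (-(t ^ 2 / (2 * n * c ^ 2))) * (Real.exp (t ^ 2 / (n * c ^ 2)) / 2) := by
    have e : t ^ 2 / (n * c ^ 2) = t ^ 2 / (2 * n * c ^ 2) + t ^ 2 / (2 * n * c ^ 2) := by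
      field_simp
      ring
    rw [e, Real.exp_add, Real.exp_neg]
    field_simp
  rw [h6]
  gcongr

end Azuma

/-! ### The randomness of the algorithm -/

section Independence

/-- Every finite intersection splits into a part from each family. Independence of `M₁` and `M₂`
factors the two parts, and independence inside each family does the rest. -/
lemma iIndep_sumElim {Ω ι₁ ι₂ : Type*} {mΩ : MeasurableSpace Ω} {P : Measure Ω}
    {m₁ : ι₁ → MeasurableSpace Ω} {m₂ : ι₂ → MeasurableSpace Ω} {M₁ M₂ : MeasurableSpace Ω}
    (h₁ : iIndep m₁ P) (h₂ : iIndep m₂ P) (hM₁ : ∀ i, m₁ i ≤ M₁) (hM₂ : ∀ i, m₂ i ≤ M₂)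
    (h : Indep M₁ M₂ P) : iIndep (Sum.elim m₁ m₂) P := by
  rw [iIndep_iff]
  intro s f hf
  have hl : ∀ i ∈ s.toLeft, MeasurableSet[m₁ i] (f (Sum.inl i)) := fun i hi =>
    hf (Sum.inl i) (Finset.mem_toLeft.1 hi)
  have hr : ∀ i ∈ s.toRight, MeasurableSet[m₂ i] (f (Sum.inr i)) := fun i hi =>
    hf (Sum.inr i) (Finset.mem_toRight.1 hi)
  have e : (⋂ i ∈ s, f i) = (⋂ i ∈ s.toLeft, f (Sum.inl i)) ∩ ⋂ i ∈ s.toRight, f (Sum.inr i) := by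
    ext ω
    simp only [Set.mem_inter_iff, Set.mem_iInter, Finset.mem_toLeft, Finset.mem_toRight]
    refine ⟨fun H => ⟨fun i hi => H _ hi, fun i hi => H _ hi⟩, fun H i hi => ?_⟩
    cases i with
    | inl i => exact H.1 i hi
    | inr i => exact H.2 i hi
  have e2 : ∏ i ∈ s, P (f i)
      = (∏ i ∈ s.toLeft, P (f (Sum.inl i))) * ∏ i ∈ s.toRight, P (f (Sum.inr i)) := by
    conv_lhs => rw [← Finset.toLeft_disjSum_toRight (u := s)]
    rw [Finset.prod_disjSum]
  rw [e, e2, ← (iIndep_iff _ _).1 h₁ _ hl, ← (iIndep_iff _ _).1 h₂ _ hr]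
  refine (Indep_iff _ _ _).1 h _ _ ?_ ?_
  · exact Finset.measurableSet_biInter _ fun i hi => hM₁ i _ (hl i hi)
  · exact Finset.measurableSet_biInter _ fun i hi => hM₂ i _ (hr i hi)

end Independence

/-- Parameter vectors: the entries of a controller as a Euclidean vector. -/
abbrev MatVec (dx du : ℕ) := EuclideanSpace ℝ (Fin du × Fin dx)

section

variable {dx du : ℕ}

/-- The controller with given entries. -/
def matE (v : MatVec dx du) : Matrix (Fin du) (Fin dx) ℝ := Matrix.of fun a b => v (a, b)

@[simp] lemma matE_vecE (M : Matrix (Fin du) (Fin dx) ℝ) : matE (vecE M) = M := rfl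

@[simp] lemma vecE_matE (v : MatVec dx du) : vecE (matE v) = v := rfl

lemma matE_sub (u v : MatVec dx du) : matE (u - v) = matE u - matE v := rfl

lemma frobNorm_matE (v : MatVec dx du) : frobNorm (matE v) = ‖v‖ := by
  rw [frobNorm_eq, vecE_matE]

lemma vecE_sum {ι : Type*} (s : Finset ι) (f : ι → Matrix (Fin du) (Fin dx) ℝ) :
    vecE (∑ i ∈ s, f i) = ∑ i ∈ s, vecE (f i) := by
  classical
  induction s using Finset.induction_on with
  | empty => ext p; simp
  | insert a s ha ih => rw [Finset.sum_insert ha, Finset.sum_insert ha, vecE_add, ih]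

lemma dir_vecE (G : Matrix (Fin du) (Fin dx) ℝ) : vecE ((frobNorm G)⁻¹ • G) = dir (vecE G) := by
  rw [vecE_smul, frobNorm_eq, dir]

lemma measurable_vecE {Ω : Type*} {_ : MeasurableSpace Ω} {M : Ω → Matrix (Fin du) (Fin dx) ℝ}
    (hM : ∀ a b, Measurable fun ω => M ω a b) : Measurable fun ω => vecE (M ω) :=
  (PiLp.continuous_toLp 2 _).measurable.comp (measurable_pi_iff.2 fun p => hM p.1 p.2)

lemma measurable_entry (p : Fin du × Fin dx) : Measurable fun v : MatVec dx du => v p :=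
  (PiLp.continuous_apply 2 _ p).measurable

end

/-- The random inputs of the algorithm. -/
structure Inputs {dx du : ℕ} {Ω : Type*} [MeasurableSpace Ω] (P : Measure Ω)
    (w : ℕ → Ω → Fin dx → ℝ) (G : ℕ → ℕ → Fin du → Fin dx → Ω → ℝ)
    (N : Matrix (Fin dx) (Fin dx) ℝ) (W : ℝ) : Prop where
  noise : IsNoise P w N W
  ident : ∀ t, IdentDistrib (w t) (w 0) P P
  measG : ∀ j i a b, Measurable (G j i a b)
  lawG : ∀ j i a b, P.map (G j i a b) = gaussianReal 0 1
  indepG : iIndepFun (fun (p : ℕ × ℕ × Fin du × Fin dx) => G p.1 p.2.1 p.2.2.1 p.2.2.2) P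
  indep : IndepFun (fun ω t => w t ω)
    (fun ω (p : ℕ × ℕ × Fin du × Fin dx) => G p.1 p.2.1 p.2.2.1 p.2.2.2 ω) P

namespace Inputs

section Past

variable {dx du : ℕ} {Ω : Type*} {w : ℕ → Ω → Fin dx → ℝ} {G : ℕ → ℕ → Fin du → Fin dx → Ω → ℝ}

/-- The σ-algebras generated by the single random inputs. -/
@[reducible] def sig (w : ℕ → Ω → Fin dx → ℝ) (G : ℕ → ℕ → Fin du → Fin dx → Ω → ℝ) :
    ℕ ⊕ (ℕ × ℕ × Fin du × Fin dx) → MeasurableSpace Ω :=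
  Sum.elim (fun t => MeasurableSpace.comap (w t) inferInstance)
    fun p => MeasurableSpace.comap (G p.1 p.2.1 p.2.2.1 p.2.2.2) inferInstance

/-- The information available after `t` rounds, when `(j, i)` is the next sub-epoch. -/
@[reducible] def past (w : ℕ → Ω → Fin dx → ℝ) (G : ℕ → ℕ → Fin du → Fin dx → Ω → ℝ) (t j i : ℕ) :
    MeasurableSpace Ω :=
  ⨆ k ∈ {k : ℕ ⊕ (ℕ × ℕ × Fin du × Fin dx) |
    k.elim (fun s => s < t) (fun p => p.1 < j ∨ p.1 = j ∧ p.2.1 < i)}, sig w G k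

lemma measurable_noise_past (w : ℕ → Ω → Fin dx → ℝ) (G : ℕ → ℕ → Fin du → Fin dx → Ω → ℝ)
    {t j i s : ℕ} (hs : s < t) : Measurable[past w G t j i] (w s) :=
  (comap_measurable (w s)).mono (le_iSup₂_of_le (f := fun k _ => sig w G k) (Sum.inl s) hs le_rfl)
    le_rfl

lemma measurable_gauss_past (w : ℕ → Ω → Fin dx → ℝ) (G : ℕ → ℕ → Fin du → Fin dx → Ω → ℝ)
    {t j i j' i' : ℕ} (hs : j' < j ∨ j' = j ∧ i' < i) (a : Fin du) (b : Fin dx) :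
    Measurable[past w G t j i] (G j' i' a b) :=
  (comap_measurable (G j' i' a b)).mono (le_iSup₂_of_le (f := fun k _ => sig w G k)
    (Sum.inr (j', i', a, b)) hs le_rfl) le_rfl

lemma past_mono {t t' j i i' : ℕ} (ht : t ≤ t') (hi : i ≤ i') :
    past w G t j i ≤ past w G t' j i' := by
  refine iSup₂_le fun k hk => le_iSup₂_of_le (f := fun k _ => sig w G k) k ?_ le_rfl
  cases k with
  | inl s => exact lt_of_lt_of_le hk ht
  | inr p => exact hk.imp id fun H => ⟨H.1, H.2.trans_le hi⟩

/-- The inputs of a sub-epoch: the Gaussian matrix and the noise from its beginning on. -/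
def fresh (w : ℕ → Ω → Fin dx → ℝ) (G : ℕ → ℕ → Fin du → Fin dx → Ω → ℝ) (t j i : ℕ) (ω : Ω) :
    MatVec dx du × (ℕ → Fin dx → ℝ) :=
  (vecE (Matrix.of fun a b => G j i a b ω), fun n => w (t + n) ω)

lemma measurable_fresh_of {m : MeasurableSpace Ω} {t j i : ℕ} (hG : ∀ a b, Measurable (G j i a b))
    (hw : ∀ n, Measurable (w (t + n))) : Measurable (fresh w G t j i) :=
  (measurable_vecE hG).prodMk (measurable_pi_iff.2 hw)

end Past

variable {dx du : ℕ} {Ω : Type*} [MeasurableSpace Ω] {P : Measure Ω}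
  {w : ℕ → Ω → Fin dx → ℝ} {G : ℕ → ℕ → Fin du → Fin dx → Ω → ℝ}
  {N : Matrix (Fin dx) (Fin dx) ℝ} {W : ℝ}

lemma sig_le (h : Inputs P w G N W) (k : ℕ ⊕ (ℕ × ℕ × Fin du × Fin dx)) :
    sig w G k ≤ (inferInstance : MeasurableSpace Ω) := by
  cases k with
  | inl t => exact (h.noise.meas t).comap_le
  | inr p => exact (h.measG _ _ _ _).comap_le

lemma iIndep_sig (h : Inputs P w G N W) : iIndep (sig w G) P := by
  refine iIndep_sumElim h.noise.indep.iIndep h.indepG.iIndep (fun t => ?_) (fun p => ?_)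
    ((IndepFun_iff_Indep _ _ _).1 h.indep)
  · exact Measurable.comap_le
      ((measurable_pi_apply t).comp (comap_measurable (fun ω t => w t ω)))
  · exact Measurable.comap_le ((measurable_pi_apply p).comp (comap_measurable
      (fun ω (p : ℕ × ℕ × Fin du × Fin dx) => G p.1 p.2.1 p.2.2.1 p.2.2.2 ω)))

lemma past_le (h : Inputs P w G N W) (t j i : ℕ) :
    past w G t j i ≤ (inferInstance : MeasurableSpace Ω) := iSup₂_le fun k _ => h.sig_le k

lemma measurable_fresh (h : Inputs P w G N W) (t j i : ℕ) : Measurable (fresh w G t j i) :=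
  measurable_fresh_of (fun a b => h.measG j i a b) fun n => h.noise.meas (t + n)

/-- The past and the inputs of sub-epoch `(j, i)` are generated by disjoint sets of mutually
independent inputs: the noise is cut at time `t`, and the Gaussian matrices used earlier all have
smaller index. -/
lemma indep_past_fresh (h : Inputs P w G N W) (t j i : ℕ) :
    Indep (past w G t j i) (MeasurableSpace.comap (fresh w G t j i) inferInstance) P := by
  have hi := indep_iSup_of_disjoint h.sig_le h.iIndep_sig
    (S := {k : ℕ ⊕ (ℕ × ℕ × Fin du × Fin dx) |
      k.elim (fun s => s < t) (fun p => p.1 < j ∨ p.1 = j ∧ p.2.1 < i)})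
    (T := {k : ℕ ⊕ (ℕ × ℕ × Fin du × Fin dx) |
      k.elim (fun s => t ≤ s) (fun p => p.1 = j ∧ p.2.1 = i)}) (by
        rw [Set.disjoint_left]
        rintro (s | p) h1 h2
        · have h1' : s < t := h1
          have h2' : t ≤ s := h2
          omega
        · have h1' : p.1 < j ∨ p.1 = j ∧ p.2.1 < i := h1
          have h2' : p.1 = j ∧ p.2.1 = i := h2
          omega)
  refine indep_of_indep_of_le_right hi (Measurable.comap_le (measurable_fresh_of ?_ ?_))
  · refine fun a b => (comap_measurable (G j i a b)).mono ?_ le_rfl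
    exact le_iSup₂_of_le (f := fun k _ => sig w G k) (Sum.inr (j, i, a, b)) ⟨rfl, rfl⟩ le_rfl
  · refine fun n => (comap_measurable (w (t + n))).mono ?_ le_rfl
    exact le_iSup₂_of_le (f := fun k _ => sig w G k) (Sum.inl (t + n)) (Nat.le_add_right t n) le_rfl

/-- The law of the noise sequence. -/
def noiseLaw (P : Measure Ω) (w : ℕ → Ω → Fin dx → ℝ) : Measure (ℕ → Fin dx → ℝ) :=
  Measure.infinitePi fun _ : ℕ => P.map (w 0)

/-- Because the noise is i.i.d., its future has the same law from any starting time. One law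
therefore serves for all sub-epochs, as `azuma` requires; keeping the whole infinite future avoids
dependence on the horizon. -/
lemma map_shift [IsProbabilityMeasure P] (h : Inputs P w G N W) (t : ℕ) :
    P.map (fun ω n => w (t + n) ω) = noiseLaw P w := by
  have hi : iIndepFun (fun n => w (t + n)) P :=
    h.noise.indep.precomp (g := fun n => t + n) fun a b hab => by simpa using hab
  rw [hi.map_fun_eq_infinitePi_map fun n => h.noise.meas (t + n), noiseLaw]
  congr 1
  funext n
  exact (h.ident (t + n)).map_eq

lemma isProbabilityMeasure_noiseLaw [IsProbabilityMeasure P] (h : Inputs P w G N W) :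
    IsProbabilityMeasure (noiseLaw P w) := by
  rw [← h.map_shift 0]
  exact Measure.isProbabilityMeasure_map
    (measurable_pi_iff.2 fun n => h.noise.meas (0 + n)).aemeasurable

lemma map_gauss [IsProbabilityMeasure P] (h : Inputs P w G N W) (j i : ℕ) :
    P.map (fun ω => vecE (Matrix.of fun a b => G j i a b ω)) = stdGaussian (MatVec dx du) := by
  have hi : iIndepFun (fun p : Fin du × Fin dx => G j i p.1 p.2) P :=
    h.indepG.precomp (g := fun p : Fin du × Fin dx => (j, i, p.1, p.2)) fun p q hpq => by
      simp only [Prod.mk.injEq, true_and] at hpq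
      exact Prod.ext hpq.1 hpq.2
  have hm := hi.map_fun_eq_pi_map fun p : Fin du × Fin dx => (h.measG j i p.1 p.2).aemeasurable
  simp only [h.lawG] at hm
  rw [← map_pi_eq_stdGaussian, ← hm, Measure.map_map (PiLp.continuous_toLp 2 _).measurable
    (measurable_pi_iff.2 fun p : Fin du × Fin dx => h.measG j i p.1 p.2)]
  rfl

/-- The law of the inputs of a sub-epoch. -/
def freshLaw (du : ℕ) (P : Measure Ω) (w : ℕ → Ω → Fin dx → ℝ) :
    Measure (MatVec dx du × (ℕ → Fin dx → ℝ)) :=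
  (stdGaussian (MatVec dx du)).prod (noiseLaw P w)

lemma map_fresh [IsProbabilityMeasure P] (h : Inputs P w G N W) (t j i : ℕ) :
    P.map (fresh w G t j i) = freshLaw du P w := by
  have hind : IndepFun (fun ω => vecE (Matrix.of fun a b => G j i a b ω))
      (fun ω n => w (t + n) ω) P := by
    refine (h.indep.symm.comp (φ := fun g : ℕ × ℕ × Fin du × Fin dx → ℝ =>
      vecE (Matrix.of fun a b => g (j, i, a, b))) (ψ := fun v : ℕ → Fin dx → ℝ => fun n => v (t + n))
      (measurable_vecE fun a b => measurable_pi_apply _)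
      (measurable_pi_iff.2 fun n => measurable_pi_apply _))
  have := (indepFun_iff_map_prod_eq_prod_map_map
    (measurable_vecE fun a b => h.measG j i a b).aemeasurable
    (measurable_pi_iff.2 fun n => h.noise.meas (t + n)).aemeasurable).1 hind
  refine this.trans ?_
  rw [freshLaw, ← h.map_gauss j i, ← h.map_shift t]
  rfl

/-- The noise hypotheses pass to the coordinate process under its law, so the moment formulas also
apply after the past has been frozen. -/
lemma noise_law [IsProbabilityMeasure P] (h : Inputs P w G N W) : IsNoise (noiseLaw P w) (fun t v => v t) N W := by
  have hp := h.isProbabilityMeasure_noiseLaw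
  have h0 : Measurable fun ω n => w (0 + n) ω := measurable_pi_iff.2 fun n => h.noise.meas (0 + n)
  have hint : ∀ f : (ℕ → Fin dx → ℝ) → ℝ, Measurable f →
      ∫ v, f v ∂(noiseLaw P w) = ∫ ω, f (fun n => w (0 + n) ω) ∂P := fun f hf => by
    rw [← h.map_shift 0, integral_map h0.aemeasurable hf.aestronglyMeasurable]
  have hc : ∀ t (a : Fin dx), Measurable fun v : ℕ → Fin dx → ℝ => v t a := fun t a =>
    (measurable_pi_apply a).comp (measurable_pi_apply t)
  refine ⟨fun t => measurable_pi_apply t, ?_, fun t => ?_, fun t a => ?_, fun t a b => ?_⟩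
  · have : IsProbabilityMeasure (P.map (w 0)) :=
      Measure.isProbabilityMeasure_map (h.noise.meas 0).aemeasurable
    exact iIndepFun_infinitePi (P := fun _ : ℕ => P.map (w 0)) (X := fun _ v => v)
      fun _ => measurable_id
  · rw [← h.map_shift 0]
    refine (ae_map_iff h0.aemeasurable ?_).2 ?_
    · have hm : Measurable fun v : ℕ → Fin dx → ℝ => euclNorm (v t) :=
        ((PiLp.continuous_toLp 2 _).measurable.comp (measurable_pi_apply t)).norm
      exact measurableSet_le hm measurable_const
    · simpa only [zero_add] using h.noise.bdd t
  · rw [hint _ (hc t a)]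
    simpa only [zero_add] using h.noise.mean t a
  · refine (hint (fun v => v t a * v t b) ((hc t a).mul (hc t b))).trans ?_
    simpa only [zero_add] using h.noise.cov t a b

end Inputs

/-! ### Measurability of the algorithm -/

section Measurability

variable {dx du : ℕ} {Ω : Type*}

lemma measurable_frobNorm {m n : ℕ} {_ : MeasurableSpace Ω} {M : Ω → Matrix (Fin m) (Fin n) ℝ}
    (hM : ∀ a b, Measurable fun ω => M ω a b) : Measurable fun ω => frobNorm (M ω) :=
  (Finset.measurable_sum _ fun a _ => Finset.measurable_sum _ fun b _ =>
    (hM a b).pow_const 2).sqrt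

lemma measurable_euclNorm {n : ℕ} {_ : MeasurableSpace Ω} {x : Ω → Fin n → ℝ}
    (hx : Measurable x) : Measurable fun ω => euclNorm (x ω) :=
  ((PiLp.continuous_toLp 2 _).measurable.comp hx).norm

lemma measurable_unit {m n : ℕ} {_ : MeasurableSpace Ω} {M : Ω → Matrix (Fin m) (Fin n) ℝ}
    (hM : ∀ a b, Measurable fun ω => M ω a b) (a : Fin m) (b : Fin n) :
    Measurable fun ω => ((frobNorm (M ω))⁻¹ • M ω) a b :=
  (measurable_frobNorm hM).inv.mul (hM a b)

lemma measurable_perturb {_ : MeasurableSpace Ω} (c : Consts) (j : ℕ)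
    {K G : Ω → Matrix (Fin du) (Fin dx) ℝ} (hK : ∀ a b, Measurable fun ω => K ω a b)
    (hG : ∀ a b, Measurable fun ω => G ω a b) (a : Fin du) (b : Fin dx) :
    Measurable fun ω => perturb c j (K ω) (G ω) a b :=
  (hK a b).add ((measurable_unit hG a b).const_mul _)

lemma measurable_stageCost {_ : MeasurableSpace Ω} (S : LQR dx du)
    {K : Ω → Matrix (Fin du) (Fin dx) ℝ} {x : Ω → Fin dx → ℝ}
    (hK : ∀ a b, Measurable fun ω => K ω a b) (hx : Measurable x) :
    Measurable fun ω => S.stageCost (K ω) (x ω) := by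
  have hKx : Measurable fun ω => K ω *ᵥ x ω := measurable_mulVec hK hx
  have hQ : Measurable fun ω => S.Q *ᵥ x ω :=
    measurable_mulVec (M := fun _ => S.Q) (fun _ _ => measurable_const) hx
  have hR : Measurable fun ω => S.R *ᵥ (K ω *ᵥ x ω) :=
    measurable_mulVec (M := fun _ => S.R) (fun _ _ => measurable_const) hKx
  simp only [LQR.stageCost]
  exact (measurable_dotProduct hx hQ).add (measurable_dotProduct hKx hR)

lemma startTime_succ (c : Consts) (dx du j i : ℕ) :
    c.startTime dx du j (i + 1) = c.startTime dx du j i + c.τ := by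
  simp only [Consts.startTime]
  ring

lemma startTime_epoch (c : Consts) (dx du j : ℕ) :
    c.startTime dx du (j + 1) 0 = c.startTime dx du j (c.m dx du j) := by
  simp only [Consts.startTime, Finset.sum_range_succ, add_zero]

lemma startTime_mono (c : Consts) (dx du j : ℕ) : Monotone (c.startTime dx du j) :=
  fun _ _ hi => Nat.mul_le_mul_left _ (Nat.add_le_add_left hi _)

variable {w : Ω → ℕ → Fin dx → ℝ} {G : Ω → ℕ → ℕ → Matrix (Fin du) (Fin dx) ℝ}
  {K : Ω → Matrix (Fin du) (Fin dx) ℝ} {x : Ω → Fin dx → ℝ}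

lemma measurable_subState {_ : MeasurableSpace Ω} (S : LQR dx du) (c : Consts) (j : ℕ)
    (hK : ∀ a b, Measurable fun ω => K ω a b) (hx : Measurable x) {i : ℕ}
    (hG : ∀ i' < i, ∀ a b, Measurable fun ω => G ω j i' a b)
    (hw : ∀ t < c.startTime dx du j i, Measurable fun ω => w ω t) :
    Measurable fun ω => subState S c (w ω) (G ω) j (K ω) (x ω) i := by
  induction i with
  | zero => exact hx
  | succ i ih =>
    simp only [subState]
    rw [startTime_succ] at hw
    exact measurable_state S (measurable_perturb c j hK (hG i (Nat.lt_succ_self i))) hw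
      (ih (fun i' hi' => hG i' (hi'.trans (Nat.lt_succ_self i))) fun t ht => hw t (by omega))

lemma measurable_finalCost {_ : MeasurableSpace Ω} (S : LQR dx du) (c : Consts) (j : ℕ)
    (hK : ∀ a b, Measurable fun ω => K ω a b) (hx : Measurable x) {i : ℕ}
    (hG : ∀ i' ≤ i, ∀ a b, Measurable fun ω => G ω j i' a b)
    (hw : ∀ t < c.startTime dx du j (i + 1), Measurable fun ω => w ω t) :
    Measurable fun ω => finalCost S c (w ω) (G ω) j (K ω) (x ω) i := by
  rw [startTime_succ] at hw
  have hp := measurable_perturb c j hK (hG i le_rfl)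
  exact measurable_stageCost S hp (measurable_state S hp (fun t ht => hw t (by omega))
    (measurable_subState S c j hK hx (fun i' hi' => hG i' hi'.le) fun t ht => hw t (by omega)))

lemma measurable_gradEst {_ : MeasurableSpace Ω} (S : LQR dx du) (c : Consts) (j : ℕ)
    (hK : ∀ a b, Measurable fun ω => K ω a b) (hx : Measurable x)
    (hG : ∀ i' < c.m dx du j, ∀ a b, Measurable fun ω => G ω j i' a b)
    (hw : ∀ t < c.startTime dx du (j + 1) 0, Measurable fun ω => w ω t) (a : Fin du) (b : Fin dx) :
    Measurable fun ω => gradEst S c (w ω) (G ω) j (K ω) (x ω) a b := by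
  rw [startTime_epoch] at hw
  simp only [gradEst, Matrix.smul_apply, Matrix.sum_apply, smul_eq_mul]
  refine Measurable.const_mul (Finset.measurable_sum _ fun i hi => ?_) _
  have hi' := Finset.mem_range.1 hi
  exact (measurable_finalCost S c j hK hx (fun i' h => hG i' (h.trans_lt hi')) fun t ht =>
    hw t (ht.trans_le (startTime_mono c dx du j hi'))).mul
    (measurable_unit (hG i hi') a b)

lemma measurable_run {_ : MeasurableSpace Ω} (S : LQR dx du) (c : Consts)
    (K₀ : Matrix (Fin du) (Fin dx) ℝ) {j : ℕ}
    (hG : ∀ j' < j, ∀ i a b, Measurable fun ω => G ω j' i a b)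
    (hw : ∀ t < c.startTime dx du j 0, Measurable fun ω => w ω t) :
    (∀ a b, Measurable fun ω => (run S c K₀ (w ω) (G ω) j).1 a b) ∧
      Measurable fun ω => (run S c K₀ (w ω) (G ω) j).2 := by
  induction j with
  | zero => exact ⟨fun _ _ => measurable_const, measurable_const⟩
  | succ j ih =>
    have hle : c.startTime dx du j 0 ≤ c.startTime dx du (j + 1) 0 := by
      rw [startTime_epoch]
      exact startTime_mono c dx du j (Nat.zero_le _)
    obtain ⟨hK, hx⟩ := ih (fun j' hj' => hG j' (by omega)) fun t ht => hw t (by omega)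
    refine ⟨fun a b => ?_, ?_⟩
    · simp only [run, Matrix.sub_apply, Matrix.smul_apply, smul_eq_mul]
      exact (hK a b).sub ((measurable_gradEst S c j hK hx
        (fun i _ => hG j (Nat.lt_succ_self j) i) hw a b).const_mul _)
    · simp only [run]
      exact measurable_subState S c j hK hx (fun i _ => hG j (Nat.lt_succ_self j) i)
        (by rwa [startTime_epoch] at hw)

lemma state_shift (S : LQR dx du) (K : Matrix (Fin du) (Fin dx) ℝ) (w : ℕ → Fin dx → ℝ) (t₀ : ℕ)
    (x : Fin dx → ℝ) (s : ℕ) :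
    S.state K w t₀ x s = S.state K (fun n => w (t₀ + n)) 0 x s := by
  induction s with
  | zero => rfl
  | succ s ih => simp only [LQR.state, ih, zero_add]

lemma continuous_costN (S : LQR dx du) (N : Matrix (Fin dx) (Fin dx) ℝ) (n : ℕ) :
    Continuous fun K : Matrix (Fin du) (Fin dx) ℝ => S.costN N K n := by
  have hcl : Continuous fun K : Matrix (Fin du) (Fin dx) ℝ => S.cl K :=
    continuous_const.add (continuous_const.matrix_mul continuous_id)
  have hcm : Continuous fun K : Matrix (Fin du) (Fin dx) ℝ => S.cm K :=
    continuous_const.add ((continuous_id.matrix_transpose.matrix_mul continuous_const).matrix_mul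
      continuous_id)
  refine continuous_finsetSum _ fun k _ => Continuous.matrix_trace (hcm.matrix_mul ?_)
  exact ((hcl.pow k).matrix_mul continuous_const).matrix_mul (hcl.pow k).matrix_transpose

/-- A countable intersection of closed sets: each finite-horizon cost is a polynomial in the
controller. The limiting cost would be harder to handle because it is finite only where the system
is stable. -/
lemma measurableSet_sublevel (S : LQR dx du) (N : Matrix (Fin dx) (Fin dx) ℝ) (b : ℝ) :
    MeasurableSet {v : MatVec dx du | matE v ∈ S.sublevel N b} := by
  have hm : Continuous fun v : MatVec dx du => matE v :=
    continuous_matrix fun a b => PiLp.continuous_apply 2 _ (a, b)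
  have e : {v : MatVec dx du | matE v ∈ S.sublevel N b}
      = ⋂ n, {v : MatVec dx du | S.costN N (matE v) n ≤ b} := by
    ext v
    simp only [Set.mem_iInter]
    rfl
  rw [e]
  exact MeasurableSet.iInter fun n =>
    (isClosed_le ((continuous_costN S N n).comp hm) continuous_const).measurableSet

end Measurability

/-! ### One sub-epoch -/

namespace Regular

variable {dx du : ℕ} {S : LQR dx du} {N : Matrix (Fin dx) (Fin dx) ℝ} {α ψ σ κ ν : ℝ}
  {K : Matrix (Fin du) (Fin dx) ℝ}

/-- The tail of the cost series from `s` on is the full series for the noise propagated by `s`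
steps; the contraction of the value matrix then bounds it. -/
lemma cost_sub_costN (hK : StableMat (S.cl K)) (s : ℕ) :
    S.cost N K - S.costN N K s = ((S.cl K ^ s)ᵀ * S.val K * S.cl K ^ s * N).trace := by
  induction s with
  | zero => simp [LQR.costN, cost_eq_val hK]
  | succ s ih =>
    have h1 : S.costN N K (s + 1)
        = S.costN N K s + (S.cm K * (S.cl K ^ s * N * (S.cl K ^ s)ᵀ)).trace := by
      simp only [LQR.costN, Finset.sum_range_succ]
    have h2 : (S.cm K * (S.cl K ^ s * N * (S.cl K ^ s)ᵀ)).trace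
        = ((S.cl K ^ s)ᵀ * S.cm K * S.cl K ^ s * N).trace := by
      rw [← Matrix.mul_assoc, Matrix.trace_mul_comm]
      simp only [Matrix.mul_assoc]
    rw [h1, ← sub_sub, ih, h2, ← Matrix.trace_sub, ← Matrix.sub_mul, ← Matrix.sub_mul,
      ← Matrix.mul_sub, pow_succ', Matrix.transpose_mul]
    have h3 : S.val K - S.cm K = (S.cl K)ᵀ * S.val K * S.cl K := by
      nth_rewrite 1 [val_eq hK]
      abel
    rw [h3]
    simp only [Matrix.mul_assoc]

lemma cost_sub_costN_le (h : Regular S N α ψ σ κ ν) (hK : K ∈ S.sublevel N ν) (s : ℕ) :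
    S.cost N K - S.costN N K s ≤ (1 - (κ ^ 2)⁻¹) ^ s * ν := by
  obtain ⟨hst, hc⟩ := h.mem_sublevel.1 hK
  rw [cost_sub_costN hst]
  have h1 : ((S.cl K ^ s)ᵀ * S.val K * S.cl K ^ s * N).trace
      ≤ (((1 - (κ ^ 2)⁻¹) ^ s • S.val K) * N).trace := by
    refine trace_mul_mono ?_ h.N_psd
    refine posSemidef_iff_real.2 ⟨?_, fun x => ?_⟩
    · simp only [Matrix.transpose_sub, Matrix.transpose_smul, Matrix.transpose_mul,
        Matrix.transpose_transpose, h.val_symm hst, Matrix.mul_assoc]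
    · have := h.dot_val_pow_le hK x s
      rw [Matrix.sub_mulVec, dotProduct_sub, Matrix.smul_mulVec, dotProduct_smul, smul_eq_mul,
        Matrix.mul_assoc, ← mulVec_dotProduct_mulVec, ← Matrix.mulVec_mulVec]
      linarith
  rw [Matrix.smul_mul, Matrix.trace_smul, smul_eq_mul, ← cost_eq_val hst] at h1
  exact h1.trans (mul_le_mul_of_nonneg_left hc (pow_nonneg h.one_sub_nonneg s))

/-- The expected cost after `s` rounds is close to the long run cost. -/
lemma abs_cost_sub_le (h : Regular S N α ψ σ κ ν) (hK : K ∈ S.sublevel N ν) (x : Fin dx → ℝ)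
    (s : ℕ) :
    |(S.cl K ^ s *ᵥ x) ⬝ᵥ S.cm K *ᵥ (S.cl K ^ s *ᵥ x) + S.costN N K s - S.cost N K|
      ≤ (1 - (κ ^ 2)⁻¹) ^ s * (ν + α * κ ^ 2 * euclNorm x ^ 2) := by
  obtain ⟨hst, hc⟩ := h.mem_sublevel.1 hK
  have hθ := pow_nonneg h.one_sub_nonneg s
  have h1 := h.cost_sub_costN_le hK s
  have h2 := h.costN_le_cost hst s
  have h3 : 0 ≤ (S.cl K ^ s *ᵥ x) ⬝ᵥ S.cm K *ᵥ (S.cl K ^ s *ᵥ x) := dot_nonneg (h.cm_psd K) _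
  have h4 := (h.dot_cm_le_val hst (S.cl K ^ s *ᵥ x)).trans ((h.dot_val_pow_le hK x s).trans
    (mul_le_mul_of_nonneg_left (h.dot_val_le hK x) hθ))
  have h5 := h.ν_pos
  have h6 := h.hα
  have h7 : 0 ≤ (1 - (κ ^ 2)⁻¹) ^ s * ν := mul_nonneg hθ h5.le
  have h8 : 0 ≤ (1 - (κ ^ 2)⁻¹) ^ s * (α * κ ^ 2 * euclNorm x ^ 2) :=
    mul_nonneg hθ (by positivity)
  -- The missing tail lowers the expected cost and the initial state raises it; the two errors have
  -- opposite signs and decay at the same rate.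
  rw [mul_add, abs_le]
  constructor <;> linarith

lemma stageCost_nonneg (h : Regular S N α ψ σ κ ν) (K : Matrix (Fin du) (Fin dx) ℝ)
    (x : Fin dx → ℝ) : 0 ≤ S.stageCost K x := by
  rw [stageCost_eq]
  exact dot_nonneg (h.cm_psd K) _

lemma stageCost_le (h : Regular S N α ψ σ κ ν) (hK : K ∈ S.sublevel N ν) (x : Fin dx → ℝ) :
    S.stageCost K x ≤ α * κ ^ 2 * euclNorm x ^ 2 := by
  rw [stageCost_eq]
  exact (h.dot_cm_le_val (h.mem_sublevel.1 hK).1 x).trans (h.dot_val_le hK x)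

end Regular

section SubEpoch

variable {dx du : ℕ}

/-- The cost of the last round of a sub-epoch with `s + 1` rounds and exploration radius `r`, as a
function of the controller and the state at its beginning and of its random inputs. -/
def obs (S : LQR dx du) (r : ℝ) (s : ℕ) (z : MatVec dx du × (Fin dx → ℝ))
    (y : MatVec dx du × (ℕ → Fin dx → ℝ)) : ℝ :=
  S.stageCost (matE (z.1 + r • dir y.1)) (S.state (matE (z.1 + r • dir y.1)) y.2 0 z.2 s)

/-- The observed cost times the exploration direction. -/
def obsVec (S : LQR dx du) (r : ℝ) (s : ℕ) (z : MatVec dx du × (Fin dx → ℝ))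
    (y : MatVec dx du × (ℕ → Fin dx → ℝ)) : MatVec dx du :=
  obs S r s z y • dir y.1

lemma measurable_obs (S : LQR dx du) (r : ℝ) (s : ℕ) :
    Measurable fun p : (MatVec dx du × (Fin dx → ℝ)) × (MatVec dx du × (ℕ → Fin dx → ℝ)) =>
      obs S r s p.1 p.2 := by
  have hK : ∀ a b, Measurable fun p : (MatVec dx du × (Fin dx → ℝ)) ×
      (MatVec dx du × (ℕ → Fin dx → ℝ)) => matE (p.1.1 + r • dir p.2.1) a b := fun a b => by
    have h1 : Measurable fun p : (MatVec dx du × (Fin dx → ℝ)) ×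
      (MatVec dx du × (ℕ → Fin dx → ℝ)) => p.1.1 + r • dir p.2.1 :=
      (measurable_fst.comp measurable_fst).add
        ((measurable_dir.comp (measurable_fst.comp measurable_snd)).const_smul r)
    exact (measurable_entry (a, b)).comp h1
  exact measurable_stageCost S hK (measurable_state S hK
    (fun t _ => (measurable_pi_apply t).comp (measurable_snd.comp measurable_snd))
    (measurable_snd.comp measurable_fst))

lemma measurable_obsVec (S : LQR dx du) (r : ℝ) (s : ℕ) :
    Measurable (Function.uncurry (obsVec S r s)) :=
  (measurable_obs S r s).smul (measurable_dir.comp (measurable_fst.comp measurable_snd))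

lemma frobNorm_matE_add_smul_dir_sub {r : ℝ} (hr : 0 ≤ r) (v u : MatVec dx du) (hu : ‖u‖ ≤ 1) :
    frobNorm (matE (v + r • u) - matE v) ≤ r := by
  rw [← matE_sub, frobNorm_matE, add_sub_cancel_left, norm_smul, Real.norm_of_nonneg hr]
  exact mul_le_of_le_one_right hr hu

variable {S : LQR dx du} {N : Matrix (Fin dx) (Fin dx) ℝ} {α ψ σ κ ν W r : ℝ} {s : ℕ}
  {μ : Measure (ℕ → Fin dx → ℝ)}

lemma Regular.explore_mem (h : Regular S N α ψ σ κ ν) (hr : 0 ≤ r)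
    (hrs : r * (64 * ψ * κ ^ 8) ≤ √α) {v : MatVec dx du} (hv : matE v ∈ S.sublevel N (ν / 2))
    {u : MatVec dx du} (hu : ‖u‖ ≤ 1) : matE (v + r • u) ∈ S.sublevel N ν :=
  h.near_mem hv ((norm_le_frobNorm _).trans (frobNorm_matE_add_smul_dir_sub hr v u hu)) hrs

lemma IsNoise.ae_bdd (hμ : IsNoise μ (fun t v => v t) N W) :
    ∀ᵐ v ∂μ, ∀ t, euclNorm (v t) ≤ W := ae_all_iff.2 hμ.bdd

lemma Regular.abs_obs_le (h : Regular S N α ψ σ κ ν) (hr : 0 ≤ r)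
    (hrs : r * (64 * ψ * κ ^ 8) ≤ √α) {z : MatVec dx du × (Fin dx → ℝ)}
    (hz : matE z.1 ∈ S.sublevel N (ν / 2)) {y : MatVec dx du × (ℕ → Fin dx → ℝ)}
    (hy : ∀ t, euclNorm (y.2 t) ≤ W) :
    |obs S r s z y| ≤ α * κ ^ 2 * (decay κ ^ s * (κ * euclNorm z.2) + 2 * κ ^ 3 * W) ^ 2 := by
  have hK := h.explore_mem hr hrs hz (norm_dir_le y.1)
  have hα := h.hα
  rw [obs, abs_of_nonneg (h.stageCost_nonneg _ _)]
  refine (h.stageCost_le hK _).trans (mul_le_mul_of_nonneg_left ?_ (by positivity))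
  exact pow_le_pow_left₀ (euclNorm_nonneg _) (h.euclNorm_state_le hK hy 0 z.2 s) 2

lemma Regular.norm_obsVec_le (h : Regular S N α ψ σ κ ν) (hμ : IsNoise μ (fun t v => v t) N W)
    (hr : 0 ≤ r) (hrs : r * (64 * ψ * κ ^ 8) ≤ √α) {z : MatVec dx du × (Fin dx → ℝ)}
    (hz : matE z.1 ∈ S.sublevel N (ν / 2)) :
    ∀ᵐ y ∂((stdGaussian (MatVec dx du)).prod μ), ‖obsVec S r s z y‖
      ≤ α * κ ^ 2 * (decay κ ^ s * (κ * euclNorm z.2) + 2 * κ ^ 3 * W) ^ 2 := by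
  have h1 : ∀ᵐ y ∂((stdGaussian (MatVec dx du)).prod μ), ∀ t, euclNorm (y.2 t) ≤ W :=
    Measure.quasiMeasurePreserving_snd.ae hμ.ae_bdd
  filter_upwards [h1] with y hy
  rw [obsVec, norm_smul, Real.norm_eq_abs]
  exact (mul_le_of_le_one_right (abs_nonneg _) (norm_dir_le _)).trans (h.abs_obs_le hr hrs hz hy)

variable [IsProbabilityMeasure μ]

lemma Regular.integrable_obsVec (h : Regular S N α ψ σ κ ν)
    (hμ : IsNoise μ (fun t v => v t) N W)
    (hr : 0 ≤ r) (hrs : r * (64 * ψ * κ ^ 8) ≤ √α) {z : MatVec dx du × (Fin dx → ℝ)}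
    (hz : matE z.1 ∈ S.sublevel N (ν / 2)) :
    Integrable (obsVec S r s z) ((stdGaussian (MatVec dx du)).prod μ) :=
  Integrable.of_bound ((measurable_obsVec S r s).comp measurable_prodMk_left).aestronglyMeasurable
    _ (h.norm_obsVec_le hμ hr hrs hz)

/-- The mean of the observations, for a fixed exploration direction. -/
def meanObs (S : LQR dx du) (N : Matrix (Fin dx) (Fin dx) ℝ) (r : ℝ) (s : ℕ)
    (z : MatVec dx du × (Fin dx → ℝ)) (u : MatVec dx du) : ℝ :=
  (S.cl (matE (z.1 + r • u)) ^ s *ᵥ z.2) ⬝ᵥ S.cm (matE (z.1 + r • u)) *ᵥ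
    (S.cl (matE (z.1 + r • u)) ^ s *ᵥ z.2) + S.costN N (matE (z.1 + r • u)) s

/-- Fubini: for a fixed direction the noise is integrated out by the second moment formula.
Integrability of the result comes with Fubini, so `meanObs` needs no measurability proof of its own.
-/
lemma Regular.inner_integral_obsVec (h : Regular S N α ψ σ κ ν)
    (hμ : IsNoise μ (fun t v => v t) N W)
    (hr : 0 ≤ r) (hrs : r * (64 * ψ * κ ^ 8) ≤ √α) {z : MatVec dx du × (Fin dx → ℝ)}
    (hz : matE z.1 ∈ S.sublevel N (ν / 2)) (a : MatVec dx du) :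
    Integrable (fun v => meanObs S N r s z (dir v) * inner ℝ (dir v) a)
      (stdGaussian (MatVec dx du)) ∧
    inner ℝ a (∫ y, obsVec S r s z y ∂((stdGaussian (MatVec dx du)).prod μ))
      = ∫ v, meanObs S N r s z (dir v) * inner ℝ (dir v) a ∂(stdGaussian (MatVec dx du)) := by
  have hint := h.integrable_obsVec (s := s) hμ hr hrs hz
  have hint2 : Integrable (fun y => inner ℝ a (obsVec S r s z y))
      ((stdGaussian (MatVec dx du)).prod μ) := hint.const_inner a
  have e : ∀ v, ∫ x, inner ℝ a (obsVec S r s z (v, x)) ∂μ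
      = meanObs S N r s z (dir v) * inner ℝ (dir v) a := fun v => by
    simp only [obsVec, inner_smul_right]
    rw [integral_mul_const, real_inner_comm]
    congr 1
    exact hμ.integral_stageCost h (matE (z.1 + r • dir v)) 0 z.2 s
  refine ⟨(integrable_congr (Eventually.of_forall e)).1 hint2.integral_prod_left, ?_⟩
  rw [← integral_inner hint a, integral_prod _ hint2]
  exact integral_congr_ae (Eventually.of_forall e)

/-- The expected gradient estimate of a sub-epoch is nearly the gradient. -/
lemma Regular.norm_integral_obsVec_sub_le (h : Regular S N α ψ σ κ ν)
    (hμ : IsNoise μ (fun t v => v t) N W) (hd : 0 < dx) (hu : 0 < du)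
    (hr : 0 ≤ r) (hrs : r * (64 * ψ * κ ^ 8) ≤ √α) {z : MatVec dx du × (Fin dx → ℝ)}
    (hz : matE z.1 ∈ S.sublevel N (ν / 2)) :
    ‖∫ y, obsVec S r s z y ∂((stdGaussian (MatVec dx du)).prod μ)
        - (r / (dx * du : ℝ)) • vecE (S.grad N (matE z.1))‖
      ≤ (1 - (κ ^ 2)⁻¹) ^ s * (ν + α * κ ^ 2 * euclNorm z.2 ^ 2)
        + 22 * ψ ^ 2 * κ ^ 7 * σ ^ 2 * r ^ 2 / (dx * du) := by
  set I := ∫ y, obsVec S r s z y ∂((stdGaussian (MatVec dx du)).prod μ) with hI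
  set g := vecE (S.grad N (matE z.1)) with hg
  set e := (1 - (κ ^ 2)⁻¹) ^ s * (ν + α * κ ^ 2 * euclNorm z.2 ^ 2) with he
  -- The error itself serves as the test vector, so a bound on `⟨a, a⟩` by a multiple of `‖a‖`
  -- bounds its norm.
  set a := I - (r / (dx * du : ℝ)) • g with ha
  have hψ := h.hψ
  have hκ := h.κ_pos
  have hfin : (Module.finrank ℝ (MatVec dx du) : ℝ) = dx * du := by
    rw [finrank_euclideanSpace, Fintype.card_prod, Fintype.card_fin, Fintype.card_fin]
    push_cast
    ring
  set f : MatVec dx du → ℝ := fun u => S.cost N (matE (z.1 + r • u)) with hf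
  set L := 22 * ψ ^ 2 * κ ^ 7 * σ ^ 2 * r ^ 2 with hL
  have hL0 : 0 ≤ L := by positivity
  have hlin : ∀ u u' : MatVec dx du, ‖u‖ ≤ 1 → ‖u'‖ ≤ 1 →
      |f u - f u' - inner ℝ (r • g) (u - u')| ≤ L * ‖u - u'‖ := fun u u' hu hu' => by
    have := h.cost_linearization hz (frobNorm_matE_add_smul_dir_sub hr z.1 u hu)
      (frobNorm_matE_add_smul_dir_sub hr z.1 u' hu') hrs
    rw [fip_eq, ← matE_sub, frobNorm_matE, vecE_matE, add_sub_add_left_eq_sub, ← smul_sub,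
      inner_smul_right, norm_smul, Real.norm_of_nonneg hr] at this
    rw [inner_smul_left, hL]
    refine this.trans (le_of_eq ?_)
    ring
  -- Used only for integrability; the sharp estimate is `hlin`, with the gradient removed.
  have hlip : ∀ u u' : MatVec dx du, ‖u‖ ≤ 1 → ‖u'‖ ≤ 1 →
      |f u - f u'| ≤ (L + ‖r • g‖) * ‖u - u'‖ := fun u u' hu hu' => by
    have h1 := hlin u u' hu hu'
    have h2 := abs_real_inner_le_norm (r • g) (u - u')
    have h3 := abs_sub_abs_le_abs_sub (f u - f u') (inner ℝ (r • g) (u - u'))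
    linarith
  have h1 := abs_integral_sub_le hL0 hlin a
  obtain ⟨hint, heq⟩ := h.inner_integral_obsVec (s := s) hμ hr hrs hz a
  have hint2 := integrable_lip_mul hlip (by positivity) a
  -- Replacing the expected observation by the long run cost incurs the mixing error, uniformly in
  -- the direction.
  have h2 : |∫ v, meanObs S N r s z (dir v) * inner ℝ (dir v) a ∂(stdGaussian (MatVec dx du))
      - ∫ v, f (dir v) * inner ℝ (dir v) a ∂(stdGaussian (MatVec dx du))| ≤ e * ‖a‖ := by
    rw [← integral_sub hint hint2]
    have hb : ∀ v : MatVec dx du, ‖meanObs S N r s z (dir v) * inner ℝ (dir v) a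
        - f (dir v) * inner ℝ (dir v) a‖ ≤ e * ‖a‖ := fun v => by
      rw [← sub_mul, norm_mul, Real.norm_eq_abs, Real.norm_eq_abs]
      have hK := h.explore_mem hr hrs hz (norm_dir_le v)
      have h3 := h.abs_cost_sub_le hK z.2 s
      exact mul_le_mul h3 (abs_inner_dir_le v a) (abs_nonneg _) ((abs_nonneg _).trans h3)
    have := norm_integral_le_of_norm_le_const (μ := stdGaussian (MatVec dx du))
      (Eventually.of_forall hb)
    simpa using this
  rw [hfin] at h1
  have h3 : inner ℝ a a = inner ℝ a I - inner ℝ (r • g) a / (dx * du) := by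
    nth_rewrite 2 [ha]
    rw [inner_sub_right, inner_smul_right, inner_smul_left, real_inner_comm g a]
    simp only [conj_trivial]
    ring
  rw [real_inner_self_eq_norm_sq, heq] at h3
  have h4 : ‖a‖ ^ 2 ≤ (e + L / (dx * du)) * ‖a‖ := by
    rw [h3]
    have h5 := abs_le.1 h1
    have h6 := abs_le.1 h2
    rw [add_mul, div_mul_eq_mul_div]
    linarith [h5.2, h6.2]
  rcases (norm_nonneg a).eq_or_lt with h0 | h0
  · rw [← h0]
    have hν := h.ν_pos
    have hα := h.hα
    have : 0 ≤ e := mul_nonneg (pow_nonneg h.one_sub_nonneg s) (by positivity)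
    positivity
  · rw [pow_two] at h4
    exact le_of_mul_le_mul_right h4 h0

/-- A constant function has Lipschitz constant `0`, so it is exactly uncorrelated with the
direction. -/
lemma integral_inner_dir (a : MatVec dx du) :
    ∫ v, inner ℝ (dir v) a ∂(stdGaussian (MatVec dx du)) = 0 := by
  have := abs_integral_lip_le (E := MatVec dx du) (f := fun _ => 1) (L := 0)
    (fun u u' _ _ => by simp) le_rfl a
  simpa using this

end SubEpoch

/-! ### The parameters of the algorithm -/

/-- A control problem with the inputs and the parameters of the policy gradient method, where `N`
is the noise covariance. -/
structure Setting {dx du : ℕ} {Ω : Type*} [MeasurableSpace Ω] (S : LQR dx du) (c : Consts)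
    (K₀ : Matrix (Fin du) (Fin dx) ℝ) (P : Measure Ω) (w : ℕ → Ω → Fin dx → ℝ)
    (G : ℕ → ℕ → Fin du → Fin dx → Ω → ℝ) (N : Matrix (Fin dx) (Fin dx) ℝ) : Prop where
  dx_pos : 0 < dx
  du_pos : 0 < du
  reg : Regular S N c.α c.ψ c.σ c.κ c.ν
  inp : Inputs P w G N c.W
  W_pos : 0 < c.W
  σ_le : c.σ ^ 2 ≤ c.W ^ 2
  δ_pos : 0 < c.δ
  δ_lt : c.δ < 1
  T_pos : 0 < c.T
  init : K₀ ∈ S.sublevel N (c.ν / 4)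

/-- The logarithmic factor `log (240 T⁴ / δ)`. -/
def Consts.logTerm (c : Consts) : ℝ := Real.log (240 * (c.T : ℝ) ^ 4 / c.δ)

namespace Setting

variable {dx du : ℕ} {Ω : Type*} [MeasurableSpace Ω] {S : LQR dx du} {c : Consts}
  {K₀ : Matrix (Fin du) (Fin dx) ℝ} {P : Measure Ω} {w : ℕ → Ω → Fin dx → ℝ}
  {G : ℕ → ℕ → Fin du → Fin dx → Ω → ℝ} {N : Matrix (Fin dx) (Fin dx) ℝ}

lemma one_le_T (h : Setting S c K₀ P w G N) : (1 : ℝ) ≤ c.T := by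
  exact_mod_cast h.T_pos

lemma logTerm_arg_ge (h : Setting S c K₀ P w G N) : 240 ≤ 240 * (c.T : ℝ) ^ 4 / c.δ := by
  have h1 := h.one_le_T
  have h2 := h.δ_pos
  rw [le_div_iff₀ h2]
  have h3 : (1 : ℝ) ≤ (c.T : ℝ) ^ 4 := one_le_pow₀ h1
  nlinarith [h.δ_lt]

lemma one_le_logTerm (h : Setting S c K₀ P w G N) : 1 ≤ c.logTerm := by
  rw [Consts.logTerm, Real.le_log_iff_exp_le (by linarith [h.logTerm_arg_ge])]
  exact (Real.exp_one_lt_d9.le.trans (by norm_num)).trans h.logTerm_arg_ge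

lemma log_ratio_nonneg (h : Setting S c K₀ P w G N) : 0 ≤ Real.log ((c.T : ℝ) / c.δ) := by
  refine Real.log_nonneg ?_
  rw [le_div_iff₀ h.δ_pos]
  linarith [h.one_le_T, h.δ_lt]

/-- Since `log δ ≤ 0`, `log (T⁴/δ) ≤ 4 log (T/δ)`. The additive constant cannot be dropped, because
`log (T/δ)` may be arbitrarily close to `0`. -/
lemma logTerm_le (h : Setting S c K₀ P w G N) :
    c.logTerm ≤ 6 + 4 * Real.log ((c.T : ℝ) / c.δ) := by
  have h1 := h.one_le_T
  have h2 := h.δ_pos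
  have h3 : Real.log 240 ≤ 6 := by
    rw [Real.log_le_iff_le_exp (by norm_num)]
    have := Real.exp_one_gt_d9
    have h5 : Real.exp 6 = Real.exp 1 ^ 6 := by rw [← Real.exp_nat_mul]; norm_num
    rw [h5]
    calc (240 : ℝ) ≤ 2.7 ^ 6 := by norm_num
      _ ≤ _ := pow_le_pow_left₀ (by norm_num) (by linarith) 6
  have h4 : Real.log c.δ ≤ 0 := Real.log_nonpos h2.le h.δ_lt.le
  rw [Consts.logTerm, Real.log_div (by positivity) h2.ne', Real.log_mul (by norm_num)
    (by positivity), Real.log_pow, Real.log_div (by positivity) h2.ne']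
  push_cast
  linarith

lemma ρ_eq (h : Setting S c K₀ P w G N) : c.ρ = 1 - c.α / (96 * c.ψ ^ 2 * c.κ ^ 14) := by
  have h1 := h.reg.ν_pos
  have h2 := h.reg.κ_pos
  have h3 := h.reg.hψ
  have h4 : 0 < c.ψ := by linarith
  rw [Consts.ρ, Consts.μ, Consts.η]
  field_simp
  ring

lemma κ_pow_ge_one (h : Setting S c K₀ P w G N) (k : ℕ) : 1 ≤ c.κ ^ k :=
  one_le_pow₀ (by linarith [h.reg.hκ])

lemma ρ_pos (h : Setting S c K₀ P w G N) : 0 < c.ρ := by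
  have h1 := h.reg.hα1
  have h2 : 1 ≤ c.ψ ^ 2 := one_le_pow₀ h.reg.hψ
  have h3 := h.κ_pow_ge_one 14
  have h4 : 96 ≤ 96 * c.ψ ^ 2 * c.κ ^ 14 := by nlinarith
  rw [h.ρ_eq, sub_pos, div_lt_one (by linarith)]
  linarith

lemma ρ_le (h : Setting S c K₀ P w G N) : c.ρ ≤ 1 := by
  have h1 := h.reg.hα
  have h2 := h.reg.κ_pos
  rw [h.ρ_eq, sub_le_self_iff]
  positivity

lemma r₀_pos (h : Setting S c K₀ P w G N) : 0 < c.r₀ dx := by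
  have h1 := h.reg.hα
  have h2 := h.reg.κ_pos
  have h3 := h.reg.hψ
  have h4 : 0 < c.ψ := by linarith
  have h5 : (0 : ℝ) < dx := by exact_mod_cast h.dx_pos
  rw [Consts.r₀]
  positivity

lemma r_pos (h : Setting S c K₀ P w G N) (j : ℕ) : 0 < c.r dx j :=
  mul_pos h.r₀_pos (Real.rpow_pos_of_pos h.ρ_pos _)

lemma r_le (h : Setting S c K₀ P w G N) (j : ℕ) : c.r dx j ≤ c.r₀ dx :=
  mul_le_of_le_one_right h.r₀_pos.le (Real.rpow_le_one h.ρ_pos.le h.ρ_le (by positivity))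

lemma r_mul_le (h : Setting S c K₀ P w G N) (j : ℕ) :
    c.r dx j * (448 * c.ψ ^ 2 * c.κ ^ 10) ≤ c.α := by
  have h1 := h.reg.hα
  have h2 := h.reg.κ_pos
  have h3 := h.reg.hψ
  have h4 : 0 < c.ψ := by linarith
  have h5 : (1 : ℝ) ≤ dx := by exact_mod_cast h.dx_pos
  have h6 : 1 ≤ √(dx : ℝ) := Real.one_le_sqrt.2 h5
  have h7 : c.r₀ dx ≤ c.α / (448 * c.ψ ^ 2 * c.κ ^ 10) := by
    rw [Consts.r₀]
    refine div_le_div_of_nonneg_left h1.le (by positivity) ?_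
    have : 0 < c.ψ ^ 2 * c.κ ^ 10 := by positivity
    nlinarith
  rw [← le_div_iff₀ (by positivity)]
  exact (h.r_le j).trans h7

lemma r_small (h : Setting S c K₀ P w G N) (j : ℕ) :
    c.r dx j * (64 * c.ψ * c.κ ^ 8) ≤ √c.α := by
  have h1 := h.reg.hα
  have h2 := h.reg.κ_pos
  have h3 := h.reg.hψ
  have h4 : 0 < c.ψ := by linarith
  have h5 := h.κ_pow_ge_one 2
  have h6 : 64 * c.ψ * c.κ ^ 8 ≤ 448 * c.ψ ^ 2 * c.κ ^ 10 := by
    have e : 448 * c.ψ ^ 2 * c.κ ^ 10 = 64 * c.ψ * c.κ ^ 8 * (7 * (c.ψ * c.κ ^ 2)) := by ring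
    rw [e]
    refine le_mul_of_one_le_right (by positivity) ?_
    nlinarith
  have h7 : c.α ≤ √c.α := by
    refine Real.le_sqrt_of_sq_le ?_
    nlinarith [h.reg.hα1]
  exact ((mul_le_mul_of_nonneg_left h6 (h.r_pos j).le).trans (h.r_mul_le j)).trans h7

lemma sqrt_m₀ (h : Setting S c K₀ P w G N) : √(c.m₀ dx du)
    = 2 ^ 17 * (du : ℝ) * ((dx : ℝ) * √(dx : ℝ)) * c.ψ ^ 2 * c.κ ^ 20 * c.W ^ 2
      / (c.α * c.σ ^ 2) * √c.logTerm := by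
  have h1 := h.reg.hα
  have h2 := h.reg.κ_pos
  have h5 : (0 : ℝ) < dx := by exact_mod_cast h.dx_pos
  have h6 : (dx : ℝ) ^ (3 / 2 : ℝ) = dx * √(dx : ℝ) := by
    rw [Real.sqrt_eq_rpow, show (3 / 2 : ℝ) = 1 + 1 / 2 by norm_num, Real.rpow_add h5,
      Real.rpow_one]
  rw [Consts.m₀, h6, Real.sqrt_sq (by positivity), Consts.logTerm]

lemma m₀_pos (h : Setting S c K₀ P w G N) : 0 < c.m₀ dx du := by
  rw [← Real.sqrt_pos, h.sqrt_m₀]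
  have h1 := h.reg.hα
  have h2 := h.reg.κ_pos
  have h3 := h.reg.hψ
  have h4 : 0 < c.ψ := by linarith
  have h5 : (0 : ℝ) < dx := by exact_mod_cast h.dx_pos
  have h6 : (0 : ℝ) < du := by exact_mod_cast h.du_pos
  have h7 := h.reg.hσ
  have h8 := h.W_pos
  have h9 := h.one_le_logTerm
  positivity

lemma m_pos (h : Setting S c K₀ P w G N) (j : ℕ) : 0 < c.m dx du j :=
  Nat.ceil_pos.2 (mul_pos h.m₀_pos (inv_pos.2 (pow_pos h.ρ_pos _)))

/-- The exploration is long enough to average the observations. -/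
lemma dim_le (h : Setting S c K₀ P w G N) (j : ℕ) :
    (dx * du : ℝ) * (2 ^ 17 * c.κ ^ 10 * c.W ^ 2 * √c.logTerm)
      ≤ 448 * c.σ ^ 2 * (c.r dx j * √(c.m dx du j : ℝ)) := by
  have h1 := h.reg.hα
  have h2 := h.reg.κ_pos
  have h3 := h.reg.hψ
  have h4 : 0 < c.ψ := by linarith
  have h5 : (0 : ℝ) < dx := by exact_mod_cast h.dx_pos
  have h7 := h.reg.hσ
  have hρ := h.ρ_pos
  have hm : √(c.m₀ dx du) * (c.ρ ^ j)⁻¹ ≤ √(c.m dx du j : ℝ) := by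
    refine Real.le_sqrt_of_sq_le ?_
    rw [mul_pow, Real.sq_sqrt h.m₀_pos.le, inv_pow, ← pow_mul, mul_comm j 2]
    exact Nat.le_ceil _
  -- The radius decays like `ρ^{j/2}` while `√m_j` grows at least like `ρ^{-j}`, so `r_j √m_j` never
  -- falls below its initial value before rounding, from which the explicit constants come.
  have hρ1 : 1 ≤ c.ρ ^ ((j : ℝ) / 2) * (c.ρ ^ j)⁻¹ := by
    rw [← div_eq_mul_inv, one_le_div (pow_pos hρ j), ← Real.rpow_natCast]
    refine Real.rpow_le_rpow_of_exponent_ge hρ h.ρ_le ?_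
    linarith [(Nat.cast_nonneg j : (0 : ℝ) ≤ j)]
  have hr : c.r₀ dx * √(c.m₀ dx du) ≤ c.r dx j * √(c.m dx du j : ℝ) := by
    calc c.r₀ dx * √(c.m₀ dx du) ≤ c.r₀ dx * √(c.m₀ dx du) *
          (c.ρ ^ ((j : ℝ) / 2) * (c.ρ ^ j)⁻¹) :=
          le_mul_of_one_le_right (mul_nonneg h.r₀_pos.le (Real.sqrt_nonneg _)) hρ1
      _ = c.r dx j * (√(c.m₀ dx du) * (c.ρ ^ j)⁻¹) := by rw [Consts.r]; ring
      _ ≤ _ := mul_le_mul_of_nonneg_left hm (h.r_pos j).le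
  refine le_trans (le_of_eq ?_) (mul_le_mul_of_nonneg_left hr (by positivity))
  rw [h.sqrt_m₀, Consts.r₀]
  have h8 : 0 < √(dx : ℝ) := Real.sqrt_pos.2 h5
  field_simp

lemma one_le_arg (h : Setting S c K₀ P w G N) : 7 * c.κ ≤ 7 * c.κ * c.T := by
  have h1 := h.reg.hκ
  have h2 := h.one_le_T
  nlinarith

lemma τ_pos (h : Setting S c K₀ P w G N) : 0 < c.τ := by
  have h1 := h.reg.hκ
  refine Nat.ceil_pos.2 (mul_pos (by positivity) (Real.log_pos ?_))
  linarith [h.one_le_arg]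

lemma decay_pos (h : Setting S c K₀ P w G N) : 6 / 7 ≤ decay c.κ := by
  have h1 := h.reg.hκ
  refine Real.le_sqrt_of_sq_le ?_
  have : (c.κ ^ 2)⁻¹ ≤ 4⁻¹ := inv_anti₀ (by norm_num) (by nlinarith)
  linarith

/-- This is what `τ` is chosen for: `√(1 - κ⁻²) ≤ exp (-κ⁻²/2)`, and `τ κ⁻²/2 ≥ log (7 κ T)`. -/
lemma decay_τ_le (h : Setting S c K₀ P w G N) : decay c.κ ^ c.τ ≤ 1 / (7 * c.κ * c.T) := by
  have h1 := h.reg.hκ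
  have h2 := h.one_le_T
  have h3 : 0 < 7 * c.κ * c.T := by nlinarith
  have hd : decay c.κ ≤ Real.exp (-((c.κ ^ 2)⁻¹ / 2)) := by
    rw [decay, Real.sqrt_le_left (Real.exp_pos _).le, ← Real.exp_nat_mul]
    have := Real.one_sub_le_exp_neg (c.κ ^ 2)⁻¹
    refine this.trans (le_of_eq ?_)
    congr 1
    push_cast
    ring
  calc decay c.κ ^ c.τ ≤ Real.exp (-((c.κ ^ 2)⁻¹ / 2)) ^ c.τ :=
        pow_le_pow_left₀ (Real.sqrt_nonneg _) hd _
    _ = Real.exp (-((c.τ : ℝ) * ((c.κ ^ 2)⁻¹ / 2))) := by rw [← Real.exp_nat_mul, mul_neg]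
    _ ≤ Real.exp (-Real.log (7 * c.κ * c.T)) := by
        refine Real.exp_le_exp.2 (neg_le_neg ?_)
        have h4 : 2 * c.κ ^ 2 * Real.log (7 * c.κ * c.T) ≤ c.τ := Nat.le_ceil _
        have h5 : Real.log (7 * c.κ * c.T)
            = 2 * c.κ ^ 2 * Real.log (7 * c.κ * c.T) * ((c.κ ^ 2)⁻¹ / 2) := by field_simp
        rw [h5]
        exact mul_le_mul_of_nonneg_right h4 (by positivity)
    _ = 1 / (7 * c.κ * c.T) := by rw [Real.exp_neg, Real.exp_log h3, one_div]

/-- The last cost of a sub-epoch is incurred at the state reached after `τ - 1` steps. The missing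
contraction factor is at least `6/7` and only changes the constant from `7` to `6`. -/
lemma decay_pred_le (h : Setting S c K₀ P w G N) :
    decay c.κ ^ (c.τ - 1) ≤ 1 / (6 * c.κ * c.T) := by
  have h1 := h.reg.κ_pos
  have h2 := h.one_le_T
  have h3 := h.decay_τ_le
  have h4 := h.decay_pos
  have h5 : decay c.κ ^ c.τ = decay c.κ ^ (c.τ - 1) * decay c.κ := by
    rw [← pow_succ, Nat.sub_add_cancel h.τ_pos]
  have h6 : 0 ≤ decay c.κ ^ (c.τ - 1) := pow_nonneg (by linarith) _
  have h7 : 1 / (6 * c.κ * c.T) = 7 / 6 * (1 / (7 * c.κ * c.T)) := by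
    field_simp
  rw [h7]
  nlinarith

/-- Epochs before `j` are completed within the horizon, so their lengths are at most `T`. Nothing of
the kind is claimed for epoch `j`. -/
lemma m_le (h : Setting S c K₀ P w G N) {j k : ℕ} (hj : c.startTime dx du j 0 ≤ c.T)
    (hk : k < j) : c.m dx du k ≤ c.T := by
  have h1 : c.m dx du k ≤ ∑ k ∈ Finset.range j, c.m dx du k :=
    Finset.single_le_sum (f := fun k => c.m dx du k) (fun _ _ => Nat.zero_le _)
      (Finset.mem_range.2 hk)
  exact (h1.trans (Nat.le_mul_of_pos_left _ h.τ_pos)).trans hj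

lemma epoch_le (h : Setting S c K₀ P w G N) {j : ℕ} (hj : c.startTime dx du j 0 ≤ c.T) :
    j ≤ c.T := by
  have h1 : j ≤ ∑ k ∈ Finset.range j, c.m dx du k := by
    have := Finset.card_nsmul_le_sum (Finset.range j) (fun k => c.m dx du k) 1
      fun k _ => h.m_pos k
    simpa using this
  exact (h1.trans (Nat.le_mul_of_pos_left _ h.τ_pos)).trans hj

/-- A bound for the states at the beginnings of the sub-epochs. -/
def _root_.OnlineLQR.Consts.stateBound (c : Consts) : ℝ := 7 / 3 * c.κ ^ 3 * c.W

/-- A sub-epoch maps a bound `b` on the initial state to at most `b/7 + 2 κ³ W`, and `7/3 = 2/(1 -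
1/7)` is the factor at the fixed point. -/
lemma state_contract (h : Setting S c K₀ P w G N) {b : ℝ} (hb : b ≤ c.stateBound) :
    decay c.κ ^ c.τ * (c.κ * b) + 2 * c.κ ^ 3 * c.W ≤ c.stateBound := by
  have h1 := h.reg.κ_pos
  have h2 := h.one_le_T
  have h3 := h.W_pos
  have h4 : decay c.κ ^ c.τ * (c.κ * b) ≤ 1 / (7 * c.κ * c.T) * (c.κ * c.stateBound) := by
    have : 0 ≤ c.stateBound := by rw [Consts.stateBound]; positivity
    exact (mul_le_mul_of_nonneg_left (mul_le_mul_of_nonneg_left hb h1.le)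
      (pow_nonneg (Real.sqrt_nonneg _) _)).trans (mul_le_mul_of_nonneg_right h.decay_τ_le
      (by positivity))
  have h5 : 1 / (7 * c.κ * c.T) * (c.κ * c.stateBound) ≤ c.stateBound / 7 := by
    have h6 : 0 ≤ c.stateBound := by rw [Consts.stateBound]; positivity
    have e : 1 / (7 * c.κ * c.T) * (c.κ * c.stateBound) = c.stateBound / 7 / c.T := by field_simp
    rw [e]
    exact div_le_self (by positivity) h2
  have e : c.stateBound = c.stateBound / 7 + 2 * c.κ ^ 3 * c.W := by
    rw [Consts.stateBound]; ring
  linarith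

/-- A bound for the observed costs. -/
def _root_.OnlineLQR.Consts.costBound (c : Consts) : ℝ := 6 * c.α * c.κ ^ 8 * c.W ^ 2

lemma cost_bound (h : Setting S c K₀ P w G N) {b : ℝ} (hb0 : 0 ≤ b) (hb : b ≤ c.stateBound) :
    c.α * c.κ ^ 2 * (decay c.κ ^ (c.τ - 1) * (c.κ * b) + 2 * c.κ ^ 3 * c.W) ^ 2 ≤ c.costBound := by
  have h1 := h.reg.κ_pos
  have h2 := h.one_le_T
  have h3 := h.W_pos
  have h0 := h.reg.hα
  have h6 : 0 ≤ c.stateBound := hb0.trans hb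
  have hd : 0 ≤ decay c.κ ^ (c.τ - 1) := pow_nonneg (Real.sqrt_nonneg _) _
  have h4 : decay c.κ ^ (c.τ - 1) * (c.κ * b) ≤ 1 / (6 * c.κ * c.T) * (c.κ * c.stateBound) :=
    (mul_le_mul_of_nonneg_left (mul_le_mul_of_nonneg_left hb h1.le) hd).trans
      (mul_le_mul_of_nonneg_right h.decay_pred_le (by positivity))
  have h5 : 1 / (6 * c.κ * c.T) * (c.κ * c.stateBound) ≤ c.stateBound / 6 := by
    have e : 1 / (6 * c.κ * c.T) * (c.κ * c.stateBound) = c.stateBound / 6 / c.T := by field_simp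
    rw [e]
    exact div_le_self (by positivity) h2
  -- The constant is `7/18 + 2 ≤ 2.4`, and `2.4² = 5.76` is rounded up to the `6` in `costBound`.
  have h7 : decay c.κ ^ (c.τ - 1) * (c.κ * b) + 2 * c.κ ^ 3 * c.W ≤ 2.4 * (c.κ ^ 3 * c.W) := by
    have : 0 ≤ c.κ ^ 3 * c.W := by positivity
    rw [Consts.stateBound] at h5 h4
    linarith
  have h8 := pow_le_pow_left₀ (by positivity) h7 2
  have h9 : (2.4 * (c.κ ^ 3 * c.W)) ^ 2 ≤ 6 * c.κ ^ 6 * c.W ^ 2 := by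
    have : 0 ≤ c.κ ^ 6 * c.W ^ 2 := by positivity
    have e : (2.4 * (c.κ ^ 3 * c.W)) ^ 2 = 5.76 * (c.κ ^ 6 * c.W ^ 2) := by ring
    rw [e]
    linarith
  refine (mul_le_mul_of_nonneg_left (h8.trans h9) (by positivity)).trans (le_of_eq ?_)
  rw [Consts.costBound]
  ring

/-- The rate for costs is the square of the rate for states. The bracket is at most `6 α κ⁸ W²`,
since `1/64 + 49/9 ≤ 6`, and the squared decay is at most `1/(36 κ² T)`. -/
lemma mixing_error_le (h : Setting S c K₀ P w G N) {b : ℝ} (hb0 : 0 ≤ b) (hb : b ≤ c.stateBound) :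
    (1 - (c.κ ^ 2)⁻¹) ^ (c.τ - 1) * (c.ν + c.α * c.κ ^ 2 * b ^ 2)
      ≤ c.α * c.κ ^ 6 * c.W ^ 2 / (6 * c.T) := by
  have h1 := h.reg.κ_pos
  have h2 := h.one_le_T
  have h3 := h.W_pos
  have h0 := h.reg.hα
  have hT : 0 < (c.T : ℝ) := by linarith
  have e1 : (1 - (c.κ ^ 2)⁻¹) ^ (c.τ - 1) = (decay c.κ ^ (c.τ - 1)) ^ 2 := by
    rw [← pow_mul, mul_comm (c.τ - 1) 2, pow_mul, decay, Real.sq_sqrt h.reg.one_sub_nonneg]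
  have h4 : (1 - (c.κ ^ 2)⁻¹) ^ (c.τ - 1) ≤ 1 / (36 * c.κ ^ 2 * c.T) := by
    rw [e1]
    refine (pow_le_pow_left₀ (pow_nonneg (Real.sqrt_nonneg _) _) h.decay_pred_le 2).trans ?_
    rw [div_pow, one_pow]
    refine one_div_le_one_div_of_le (by positivity) ?_
    have : 0 ≤ c.κ ^ 2 * c.T := by positivity
    nlinarith
  have h5 : c.ν ≤ c.α * c.κ ^ 8 * c.W ^ 2 * (1 / 64) := by
    have h6 : c.ν ≤ c.κ ^ 2 * (c.α * c.W ^ 2) := by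
      rw [h.reg.hν]
      exact mul_le_mul_of_nonneg_left (mul_le_mul_of_nonneg_left h.σ_le h0.le) (by positivity)
    have h7 := h.reg.κ_pow_ge 6
    have h8 : 0 ≤ c.κ ^ 2 * (c.α * c.W ^ 2) := by positivity
    have e : c.α * c.κ ^ 8 * c.W ^ 2 * (1 / 64) = c.κ ^ 2 * (c.α * c.W ^ 2) * (c.κ ^ 6 / 64) := by
      ring
    rw [e]
    refine h6.trans (le_mul_of_one_le_right h8 ?_)
    norm_num at h7
    linarith
  have h6 : c.α * c.κ ^ 2 * b ^ 2 ≤ c.α * c.κ ^ 8 * c.W ^ 2 * (49 / 9) := by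
    refine (mul_le_mul_of_nonneg_left (pow_le_pow_left₀ hb0 hb 2) (by positivity)).trans
      (le_of_eq ?_)
    rw [Consts.stateBound]
    ring
  have h7 : c.ν + c.α * c.κ ^ 2 * b ^ 2 ≤ c.α * c.κ ^ 8 * c.W ^ 2 * 6 := by
    have : 0 ≤ c.α * c.κ ^ 8 * c.W ^ 2 := by positivity
    linarith
  have hν := h.reg.ν_pos
  refine (mul_le_mul h4 h7 (by positivity) (by positivity)).trans (le_of_eq ?_)
  field_simp
  norm_num

end Setting

/-! ### One epoch -/

/-- The probability with which the deviation bound of an epoch may fail. -/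
def Consts.failProb (c : Consts) : ℝ := 2 * Real.exp (-c.logTerm)

namespace Setting

variable {dx du : ℕ} {Ω : Type*} [MeasurableSpace Ω] {S : LQR dx du} {c : Consts}
  {K₀ : Matrix (Fin du) (Fin dx) ℝ} {P : Measure Ω} {w : ℕ → Ω → Fin dx → ℝ}
  {G : ℕ → ℕ → Fin du → Fin dx → Ω → ℝ} {N : Matrix (Fin dx) (Fin dx) ℝ}

lemma failProb_nonneg (c : Consts) : 0 ≤ c.failProb := by
  rw [Consts.failProb]
  positivity

/-- `failProb` equals `δ/(120 T⁴)`. The factor `T + 1` stands for at most `T` earlier gradient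
estimates and the sum of directions of the current epoch. -/
lemma failProb_le (h : Setting S c K₀ P w G N) :
    ((c.T : ℝ) + 1) * c.failProb ≤ c.δ / (4 * c.T) := by
  have h1 := h.one_le_T
  have h2 := h.δ_pos
  have h3 : 0 < (c.T : ℝ) := by linarith
  have e : c.failProb = c.δ / (120 * (c.T : ℝ) ^ 4) := by
    rw [Consts.failProb, Consts.logTerm, Real.exp_neg, Real.exp_log (by positivity)]
    field_simp
    norm_num
  rw [e, mul_div_assoc', div_le_div_iff₀ (by positivity) (by positivity)]
  have h4 : (c.T : ℝ) ≤ (c.T : ℝ) ^ 4 := le_self_pow₀ h1 (by norm_num)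
  have h5 : (c.T : ℝ) ^ 2 ≤ (c.T : ℝ) ^ 4 := pow_le_pow_right₀ h1 (by norm_num)
  have h6 : ((c.T : ℝ) + 1) * (4 * c.T) ≤ 120 * (c.T : ℝ) ^ 4 := by nlinarith
  calc ((c.T : ℝ) + 1) * c.δ * (4 * c.T) = c.δ * (((c.T : ℝ) + 1) * (4 * c.T)) := by ring
    _ ≤ _ := mul_le_mul_of_nonneg_left h6 h2.le

/-- The target is `α σ² / 16`. The three errors, namely martingale deviation, mixing and Lipschitz
bias, take at most `1/50`, `1/100` and `1/100` of `α σ²`; the first two are paid for by `dim_le`,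
the last by the smallness of `r_j`. -/
lemma grad_error_le (h : Setting S c K₀ P w G N) {j : ℕ} (hm : c.m dx du j ≤ c.T) :
    (dx * du : ℝ) / ((c.m dx du j : ℝ) * c.r dx j) *
      (2 * c.costBound * √(2 * (c.m dx du j : ℝ) * c.logTerm)
        + (c.m dx du j : ℝ) * (c.α * c.κ ^ 6 * c.W ^ 2 / (6 * c.T)
          + 22 * c.ψ ^ 2 * c.κ ^ 7 * c.σ ^ 2 * c.r dx j ^ 2 / (dx * du)))
      ≤ c.ν / (16 * c.κ ^ 2) := by
  have h0 := h.reg.hα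
  have hκ := h.reg.κ_pos
  have hκ2 := h.reg.hκ
  have hσ := h.reg.hσ
  have hψ := h.reg.hψ
  have hψ0 : 0 < c.ψ := by linarith
  have hW := h.W_pos
  have hT := h.one_le_T
  have hdx : (0 : ℝ) < dx := by exact_mod_cast h.dx_pos
  have hdu : (0 : ℝ) < du := by exact_mod_cast h.du_pos
  have hr := h.r_pos j
  have hrm := h.r_mul_le j
  have hdim := h.dim_le j
  have hL := h.one_le_logTerm
  have hm0 : (0 : ℝ) < c.m dx du j := by exact_mod_cast h.m_pos j
  have hm1 : (1 : ℝ) ≤ c.m dx du j := by exact_mod_cast h.m_pos j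
  have hmT : (c.m dx du j : ℝ) ≤ c.T := by exact_mod_cast hm
  set m : ℝ := (c.m dx du j : ℝ)
  set r := c.r dx j
  set d : ℝ := (dx * du : ℝ)
  have hd : 0 < d := mul_pos hdx hdu
  have hν : c.ν / (16 * c.κ ^ 2) = c.α * c.σ ^ 2 / 16 := by
    rw [h.reg.hν]
    field_simp
  set sm := √m with hsm
  have hsm0 : 0 < sm := Real.sqrt_pos.2 hm0
  have hsm2 : sm * sm = m := Real.mul_self_sqrt hm0.le
  set sL := √c.logTerm with hsL
  have hsL1 : 1 ≤ sL := Real.one_le_sqrt.2 hL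
  have hsq : √(2 * m * c.logTerm) ≤ 3 / 2 * (sm * sL) := by
    rw [Real.sqrt_mul (by positivity), Real.sqrt_mul (by norm_num), mul_assoc]
    refine mul_le_mul_of_nonneg_right ?_ (by positivity)
    rw [Real.sqrt_le_left (by norm_num)]
    norm_num
  have t1 : d / (m * r) * (2 * c.costBound * √(2 * m * c.logTerm)) ≤ c.α * c.σ ^ 2 * (1 / 50) := by
    have e1 : d / (m * r) * (2 * c.costBound * √(2 * m * c.logTerm))
        ≤ d / (m * r) * (2 * c.costBound * (3 / 2 * (sm * sL))) := by
      refine mul_le_mul_of_nonneg_left (mul_le_mul_of_nonneg_left hsq ?_) (by positivity)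
      rw [Consts.costBound]
      positivity
    refine e1.trans ?_
    rw [Consts.costBound, div_mul_eq_mul_div, div_le_iff₀ (by positivity)]
    have e2 : d * (2 * (6 * c.α * c.κ ^ 8 * c.W ^ 2) * (3 / 2 * (sm * sL))) * (2 ^ 17 * c.κ ^ 2)
        = 18 * c.α * sm * (d * (2 ^ 17 * c.κ ^ 10 * c.W ^ 2 * sL)) := by ring
    have e3 : 18 * c.α * sm * (d * (2 ^ 17 * c.κ ^ 10 * c.W ^ 2 * sL))
        ≤ 18 * c.α * sm * (448 * c.σ ^ 2 * (r * sm)) :=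
      mul_le_mul_of_nonneg_left hdim (by positivity)
    have e4 : 18 * c.α * sm * (448 * c.σ ^ 2 * (r * sm))
        = 8064 * (c.α * c.σ ^ 2 * (m * r)) := by rw [← hsm2]; ring
    have e5 : 8064 * (c.α * c.σ ^ 2 * (m * r))
        ≤ c.α * c.σ ^ 2 * (1 / 50) * (m * r) * (2 ^ 17 * c.κ ^ 2) := by
      have h4 : (4 : ℝ) ≤ c.κ ^ 2 := by nlinarith only [hκ2]
      have h5 : 0 ≤ c.α * c.σ ^ 2 * (m * r) := by positivity
      have h6 := mul_le_mul_of_nonneg_left h4 h5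
      linarith only [h5, h6]
    have e6 : 0 < 2 ^ 17 * c.κ ^ 2 := by positivity
    refine le_of_mul_le_mul_right ?_ e6
    linarith only [e2, e3, e4, e5]
  have t2 : d / (m * r) * (m * (c.α * c.κ ^ 6 * c.W ^ 2 / (6 * c.T))) ≤ c.α * c.σ ^ 2 * (1 / 100) := by
    have e1 : d / (m * r) * (m * (c.α * c.κ ^ 6 * c.W ^ 2 / (6 * c.T)))
        = d * (c.α * c.κ ^ 6 * c.W ^ 2) / (r * (6 * c.T)) := by field_simp
    rw [e1, div_le_iff₀ (by positivity)]
    -- The mixing error is of order `1/T` and is divided by `r_j`; since `√m_j ≤ m_j ≤ T`, the lower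
    -- bound on `r_j √m_j` also bounds `r_j T` from below.
    have hsmT : sm ≤ c.T := by
      refine le_trans ?_ hmT
      rw [hsm, Real.sqrt_le_left hm0.le]
      nlinarith only [hm1]
    have e2 : d * (c.α * c.κ ^ 6 * c.W ^ 2) * (2 ^ 17 * c.κ ^ 4)
        ≤ c.α * (d * (2 ^ 17 * c.κ ^ 10 * c.W ^ 2 * sL)) := by
      have h4 : 0 ≤ c.α * (d * (2 ^ 17 * c.κ ^ 10 * c.W ^ 2)) := by positivity
      have h5 := mul_le_mul_of_nonneg_left hsL1 h4
      linarith only [h5]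
    have e3 : c.α * (d * (2 ^ 17 * c.κ ^ 10 * c.W ^ 2 * sL))
        ≤ c.α * (448 * c.σ ^ 2 * (r * c.T)) := by
      refine mul_le_mul_of_nonneg_left (hdim.trans ?_) h0.le
      exact mul_le_mul_of_nonneg_left (mul_le_mul_of_nonneg_left hsmT hr.le) (by positivity)
    have e5 : c.α * (448 * c.σ ^ 2 * (r * c.T))
        ≤ c.α * c.σ ^ 2 * (1 / 100) * (r * (6 * c.T)) * (2 ^ 17 * c.κ ^ 4) := by
      have h5 := h.κ_pow_ge_one 4
      have h6 : 0 ≤ c.α * c.σ ^ 2 * (r * c.T) := by positivity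
      have h7 := mul_le_mul_of_nonneg_left h5 h6
      linarith only [h6, h7]
    have e6 : 0 < 2 ^ 17 * c.κ ^ 4 := by positivity
    refine le_of_mul_le_mul_right ?_ e6
    linarith only [e2, e3, e5]
  have t3 : d / (m * r) * (m * (22 * c.ψ ^ 2 * c.κ ^ 7 * c.σ ^ 2 * r ^ 2 / d))
      ≤ c.α * c.σ ^ 2 * (1 / 100) := by
    have e1 : d / (m * r) * (m * (22 * c.ψ ^ 2 * c.κ ^ 7 * c.σ ^ 2 * r ^ 2 / d))
        = 22 * c.ψ ^ 2 * c.κ ^ 7 * c.σ ^ 2 * r := by field_simp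
    rw [e1]
    have h8 := h.reg.κ_pow_ge 3
    have e2 : 22 * c.ψ ^ 2 * c.κ ^ 7 * c.σ ^ 2 * r * 8
        ≤ 22 * c.ψ ^ 2 * c.κ ^ 7 * c.σ ^ 2 * r * c.κ ^ 3 :=
      mul_le_mul_of_nonneg_left (by linarith) (by positivity)
    have e3 := mul_le_mul_of_nonneg_left hrm (sq_nonneg c.σ)
    have h9 : 0 ≤ c.α * c.σ ^ 2 := by positivity
    have e4 : 22 * c.ψ ^ 2 * c.κ ^ 7 * c.σ ^ 2 * r * c.κ ^ 3
        = 22 / 448 * (c.σ ^ 2 * (r * (448 * c.ψ ^ 2 * c.κ ^ 10))) := by ring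
    linarith only [e2, e3, e4, h9]
  have h9 : 0 < c.α * c.σ ^ 2 := by positivity
  rw [hν, mul_add, mul_add m, mul_add (d / (m * r))]
  linarith only [t1, t2, t3, h9]

end Setting

/-! ### The algorithm on a sample path: frozen past and fresh inputs -/

section Path

variable {dx du : ℕ} {Ω : Type*}

/-- Underlying controller and state at the beginning of epoch `j`, on a sample path. -/
def pathRun (S : LQR dx du) (c : Consts) (K₀ : Matrix (Fin du) (Fin dx) ℝ)
    (w : ℕ → Ω → Fin dx → ℝ) (G : ℕ → ℕ → Fin du → Fin dx → Ω → ℝ) (j : ℕ) (ω : Ω) :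
    Matrix (Fin du) (Fin dx) ℝ × (Fin dx → ℝ) :=
  run S c K₀ (fun t => w t ω) (fun j' i => Matrix.of fun a b => G j' i a b ω) j

/-- Underlying controller and state at the beginning of a sub-epoch, on a sample path. -/
def pathPoint (S : LQR dx du) (c : Consts) (K₀ : Matrix (Fin du) (Fin dx) ℝ)
    (w : ℕ → Ω → Fin dx → ℝ) (G : ℕ → ℕ → Fin du → Fin dx → Ω → ℝ) (j i : ℕ) (ω : Ω) :
    MatVec dx du × (Fin dx → ℝ) :=
  (vecE (pathRun S c K₀ w G j ω).1,
    subState S c (fun t => w t ω) (fun j' i => Matrix.of fun a b => G j' i a b ω) j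
      (pathRun S c K₀ w G j ω).1 (pathRun S c K₀ w G j ω).2 i)

/-- The event that epoch `j` begins with a good controller at a moderate state. -/
def goodEvent (S : LQR dx du) (c : Consts) (K₀ : Matrix (Fin du) (Fin dx) ℝ)
    (w : ℕ → Ω → Fin dx → ℝ) (G : ℕ → ℕ → Fin du → Fin dx → Ω → ℝ)
    (N : Matrix (Fin dx) (Fin dx) ℝ) (j : ℕ) : Set Ω :=
  {ω | (pathRun S c K₀ w G j ω).1 ∈ S.sublevel N (c.ν / 2) ∧
    euclNorm (pathRun S c K₀ w G j ω).2 ≤ c.stateBound}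

/-- The inputs of a sub-epoch of the algorithm. -/
def pathFresh (c : Consts) (w : ℕ → Ω → Fin dx → ℝ) (G : ℕ → ℕ → Fin du → Fin dx → Ω → ℝ)
    (j i : ℕ) : Ω → MatVec dx du × (ℕ → Fin dx → ℝ) :=
  Inputs.fresh w G (c.startTime dx du j i) j i

/-- The information before a sub-epoch of the algorithm. -/
@[reducible] def pathPast (c : Consts) (w : ℕ → Ω → Fin dx → ℝ)
    (G : ℕ → ℕ → Fin du → Fin dx → Ω → ℝ) (j i : ℕ) : MeasurableSpace Ω :=
  Inputs.past w G (c.startTime dx du j i) j i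

variable (S : LQR dx du) (c : Consts) (K₀ : Matrix (Fin du) (Fin dx) ℝ)
  (w : ℕ → Ω → Fin dx → ℝ) (G : ℕ → ℕ → Fin du → Fin dx → Ω → ℝ)
  (N : Matrix (Fin dx) (Fin dx) ℝ)

lemma perturb_eq (j : ℕ) (K G : Matrix (Fin du) (Fin dx) ℝ) :
    perturb c j K G = matE (vecE K + c.r dx j • dir (vecE G)) := by
  rw [perturb, ← dir_vecE, ← vecE_smul, ← vecE_add, matE_vecE]

lemma finalCost_eq (j i : ℕ) (ω : Ω) :
    finalCost S c (fun t => w t ω) (fun j' i => Matrix.of fun a b => G j' i a b ω) j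
      (pathRun S c K₀ w G j ω).1 (pathRun S c K₀ w G j ω).2 i
      = obs S (c.r dx j) (c.τ - 1) (pathPoint S c K₀ w G j i ω) (pathFresh c w G j i ω) := by
  rw [finalCost, perturb_eq, state_shift]
  rfl

lemma pathPoint_succ (j i : ℕ) (ω : Ω) :
    (pathPoint S c K₀ w G j (i + 1) ω).2
      = S.state (matE (vecE (pathRun S c K₀ w G j ω).1
          + c.r dx j • dir (pathFresh c w G j i ω).1)) (fun t => w t ω) (c.startTime dx du j i)
        (pathPoint S c K₀ w G j i ω).2 c.τ := by
  simp only [pathPoint, subState]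
  rw [perturb_eq]
  rfl

lemma pathPast_mono (j : ℕ) : Monotone (pathPast c w G j) :=
  fun _ _ hi => Inputs.past_mono (startTime_mono c dx du j hi) hi

lemma measurable_pathRun (j i : ℕ) :
    (∀ a b, Measurable[pathPast c w G j i] fun ω => (pathRun S c K₀ w G j ω).1 a b) ∧
      Measurable[pathPast c w G j i] fun ω => (pathRun S c K₀ w G j ω).2 :=
  measurable_run (w := fun ω t => w t ω) (G := fun ω j' i => Matrix.of fun a b => G j' i a b ω)
    S c K₀ (fun _ hj' _ a b => Inputs.measurable_gauss_past w G (Or.inl hj') a b)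
    fun _ ht => Inputs.measurable_noise_past w G
      (ht.trans_le (startTime_mono c dx du j (Nat.zero_le i)))

lemma measurable_pathPoint (j i : ℕ) :
    Measurable[pathPast c w G j i] (pathPoint S c K₀ w G j i) := by
  obtain ⟨h1, h2⟩ := measurable_pathRun S c K₀ w G j i
  have h3 := measurable_subState (w := fun ω t => w t ω)
    (G := fun ω j' i => Matrix.of fun a b => G j' i a b ω) S c j h1 h2
    (fun i' hi' a b => Inputs.measurable_gauss_past w G (Or.inr ⟨rfl, hi'⟩) a b)
    fun t ht => Inputs.measurable_noise_past w G ht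
  exact (measurable_vecE h1).prodMk h3

lemma measurable_obs_path (j i : ℕ) :
    Measurable[pathPast c w G j (i + 1)] fun ω =>
      obs S (c.r dx j) (c.τ - 1) (pathPoint S c K₀ w G j i ω) (pathFresh c w G j i ω) := by
  obtain ⟨h1, h2⟩ := measurable_pathRun S c K₀ w G j (i + 1)
  have h3 := measurable_finalCost (w := fun ω t => w t ω)
    (G := fun ω j' i => Matrix.of fun a b => G j' i a b ω) S c j h1 h2 (i := i)
    (fun i' hi' a b => Inputs.measurable_gauss_past w G
      (Or.inr ⟨rfl, Nat.lt_succ_of_le hi'⟩) a b)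
    fun t ht => Inputs.measurable_noise_past w G ht
  simpa only [finalCost_eq] using h3

lemma measurable_fresh_dir (j i : ℕ) :
    Measurable[pathPast c w G j (i + 1)] fun ω => dir (pathFresh c w G j i ω).1 :=
  measurable_dir.comp (measurable_vecE fun a b => Inputs.measurable_gauss_past w G
    (Or.inr ⟨rfl, Nat.lt_succ_self i⟩) a b)

/-- The event is decided when the epoch begins, hence lies in the past of each of its sub-epochs, as
`azuma` demands. -/
lemma measurableSet_goodEvent (j i : ℕ) :
    MeasurableSet[pathPast c w G j i] (goodEvent S c K₀ w G N j) := by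
  obtain ⟨h1, h2⟩ := measurable_pathRun S c K₀ w G j i
  have h3 : MeasurableSet[pathPast c w G j i]
      {ω | (pathRun S c K₀ w G j ω).1 ∈ S.sublevel N (c.ν / 2)} :=
    measurable_vecE h1 (measurableSet_sublevel S N (c.ν / 2))
  exact h3.inter (measurableSet_le (measurable_euclNorm h2) measurable_const)

end Path

/-! ### Deviations within an epoch and induction over epochs -/

section Deviation

variable {dx du : ℕ} {Ω : Type*} [MeasurableSpace Ω] (S : LQR dx du) (c : Consts)
  (K₀ : Matrix (Fin du) (Fin dx) ℝ) (P : Measure Ω) (w : ℕ → Ω → Fin dx → ℝ)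
  (G : ℕ → ℕ → Fin du → Fin dx → Ω → ℝ)

/-- The expected gradient information of a sub-epoch of epoch `j`, up to scaling. -/
def meanVec (j : ℕ) (z : MatVec dx du × (Fin dx → ℝ)) : MatVec dx du :=
  ∫ y, obsVec S (c.r dx j) (c.τ - 1) z y ∂(Inputs.freshLaw du P w)

/-- The accumulated deviation of the gradient information from its conditional mean. -/
def devSum (j i : ℕ) (ω : Ω) : MatVec dx du :=
  ∑ i' ∈ Finset.range i, (obsVec S (c.r dx j) (c.τ - 1) (pathPoint S c K₀ w G j i' ω)
    (pathFresh c w G j i' ω) - meanVec S c P w j (pathPoint S c K₀ w G j i' ω))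

/-- The sum of the exploration directions. -/
def dirSum (j i : ℕ) (ω : Ω) : MatVec dx du :=
  ∑ i' ∈ Finset.range i, dir (pathFresh c w G j i' ω).1

end Deviation

namespace Setting

variable {dx du : ℕ} {Ω : Type*} [MeasurableSpace Ω] {S : LQR dx du} {c : Consts}
  {K₀ : Matrix (Fin du) (Fin dx) ℝ} {P : Measure Ω} {w : ℕ → Ω → Fin dx → ℝ}
  {G : ℕ → ℕ → Fin du → Fin dx → Ω → ℝ} {N : Matrix (Fin dx) (Fin dx) ℝ}

lemma ae_noise_le (h : Setting S c K₀ P w G N) :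
    ∀ᵐ ω ∂P, ∀ t, euclNorm (w t ω) ≤ c.W := ae_all_iff.2 h.inp.noise.bdd

lemma pathPoint_le (h : Setting S c K₀ P w G N) {j : ℕ} {ω : Ω}
    (hg : ω ∈ goodEvent S c K₀ w G N j) (hw : ∀ t, euclNorm (w t ω) ≤ c.W) (i : ℕ) :
    euclNorm (pathPoint S c K₀ w G j i ω).2 ≤ c.stateBound := by
  induction i with
  | zero => exact hg.2
  | succ i ih =>
    rw [pathPoint_succ]
    have hK := h.reg.explore_mem (v := vecE (pathRun S c K₀ w G j ω).1) (h.r_pos j).le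
      (h.r_small j) hg.1 (norm_dir_le (pathFresh c w G j i ω).1)
    exact (h.reg.euclNorm_state_le hK hw _ _ _).trans (h.state_contract ih)

variable [IsProbabilityMeasure P]

lemma isProbabilityMeasure_freshLaw (h : Setting S c K₀ P w G N) :
    IsProbabilityMeasure (Inputs.freshLaw du P w) := by
  have := h.inp.isProbabilityMeasure_noiseLaw
  rw [Inputs.freshLaw]
  infer_instance

lemma ae_norm_obsVec_le (h : Setting S c K₀ P w G N) (j : ℕ) {z : MatVec dx du × (Fin dx → ℝ)}
    (hz : matE z.1 ∈ S.sublevel N (c.ν / 2)) (hx : euclNorm z.2 ≤ c.stateBound) :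
    ∀ᵐ y ∂(Inputs.freshLaw du P w), ‖obsVec S (c.r dx j) (c.τ - 1) z y‖ ≤ c.costBound := by
  have := h.inp.isProbabilityMeasure_noiseLaw
  filter_upwards [h.reg.norm_obsVec_le (s := c.τ - 1) h.inp.noise_law (h.r_pos j).le (h.r_small j)
    hz] with y hy
  exact hy.trans (h.cost_bound (euclNorm_nonneg _) hx)

lemma norm_meanVec_le (h : Setting S c K₀ P w G N) (j : ℕ) {z : MatVec dx du × (Fin dx → ℝ)}
    (hz : matE z.1 ∈ S.sublevel N (c.ν / 2)) (hx : euclNorm z.2 ≤ c.stateBound) :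
    ‖meanVec S c P w j z‖ ≤ c.costBound := by
  have := h.isProbabilityMeasure_freshLaw
  have := norm_integral_le_of_norm_le_const (h.ae_norm_obsVec_le j hz hx)
  simpa [meanVec] using this

lemma measurable_meanVec (h : Setting S c K₀ P w G N) (j : ℕ) :
    Measurable (meanVec S c P w j : MatVec dx du × (Fin dx → ℝ) → MatVec dx du) := by
  have := h.isProbabilityMeasure_freshLaw
  exact (measurable_obsVec S (c.r dx j)
    (c.τ - 1)).stronglyMeasurable.integral_prod_right.measurable

/-- On the good event observations and their conditional means are bounded by `costBound`, hence the
increments by twice that. The threshold makes the exponent in `azuma` equal to `logTerm`. -/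
lemma measure_devSum_le (h : Setting S c K₀ P w G N) (j : ℕ) :
    P (goodEvent S c K₀ w G N j ∩ {ω | 2 * c.costBound * √(2 * (c.m dx du j : ℝ) * c.logTerm)
      ≤ ‖devSum S c K₀ P w G j (c.m dx du j) ω‖}) ≤ ENNReal.ofReal c.failProb := by
  have hQ := h.isProbabilityMeasure_freshLaw
  have hμ := h.inp.isProbabilityMeasure_noiseLaw
  have hm : (0 : ℝ) < c.m dx du j := by exact_mod_cast h.m_pos j
  have hL : 0 < c.logTerm := by linarith [h.one_le_logTerm]
  have hc : 0 < 2 * c.costBound := by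
    have h1 := h.reg.hα
    have h2 := h.reg.κ_pos
    have h3 := h.W_pos
    rw [Consts.costBound]
    positivity
  have key := azuma (P := P) (n := c.m dx du j) hc
    (t := 2 * c.costBound * √(2 * (c.m dx du j : ℝ) * c.logTerm))
    (by positivity) (A := goodEvent S c K₀ w G N j) (m := pathPast c w G j)
    (fun i => h.inp.past_le _ _ _) (fun i => measurableSet_goodEvent S c K₀ w G N j i)
    (Z := pathPoint S c K₀ w G j) (fun i => measurable_pathPoint S c K₀ w G j i)
    (Y := pathFresh c w G j) (fun i => h.inp.measurable_fresh _ _ _)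
    (fun i => h.inp.map_fresh _ _ _) (fun i => h.inp.indep_past_fresh _ _ _)
    (D := fun z y => obsVec S (c.r dx j) (c.τ - 1) z y - meanVec S c P w j z)
    ((measurable_obsVec S _ _).sub ((h.measurable_meanVec j).comp measurable_fst))
    (fun i => ?_) (fun i => ?_) (S := devSum S c K₀ P w G j) (fun ω => by simp [devSum])
    (fun i => ?_) (fun i ω => by rw [devSum, Finset.sum_range_succ]; rfl) (h.m_pos j)
  · refine key.trans (le_of_eq ?_)
    rw [Consts.failProb]
    congr 3
    rw [mul_pow, Real.sq_sqrt (by positivity)]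
    generalize 2 * c.costBound = b at hc
    field_simp
  · filter_upwards [h.ae_noise_le] with ω hω hg
    have hx := h.pathPoint_le hg hω i
    filter_upwards [h.ae_norm_obsVec_le j (z := pathPoint S c K₀ w G j i ω) hg.1 hx] with y hy
    refine (norm_sub_le _ _).trans ?_
    linarith [h.norm_meanVec_le j (z := pathPoint S c K₀ w G j i ω) hg.1 hx]
  · refine Eventually.of_forall fun ω hg a => ?_
    have hint : Integrable (obsVec S (c.r dx j) (c.τ - 1) (pathPoint S c K₀ w G j i ω))
        (Inputs.freshLaw du P w) := h.reg.integrable_obsVec h.inp.noise_law (h.r_pos j).le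
      (h.r_small j) (z := pathPoint S c K₀ w G j i ω) hg.1
    have h1 : Integrable (fun y => obsVec S (c.r dx j) (c.τ - 1) (pathPoint S c K₀ w G j i ω) y
        - meanVec S c P w j (pathPoint S c K₀ w G j i ω)) (Inputs.freshLaw du P w) :=
      hint.sub (integrable_const _)
    simp only [real_inner_comm a]
    rw [integral_inner h1, integral_sub hint (integrable_const _)]
    simp [meanVec]
  · refine Finset.measurable_sum _ fun i' hi' => ?_
    have hle : pathPast c w G j (i' + 1) ≤ pathPast c w G j i :=
      pathPast_mono c w G j (Finset.mem_range.1 hi')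
    have hle' : pathPast c w G j i' ≤ pathPast c w G j i :=
      pathPast_mono c w G j (Finset.mem_range.1 hi').le
    exact (((measurable_obs_path S c K₀ w G j i').smul (measurable_fresh_dir c w G j i')).mono
      hle le_rfl).sub (((h.measurable_meanVec j).comp
        (measurable_pathPoint S c K₀ w G j i')).mono hle' le_rfl)

/-- Directions are bounded and centred whatever the controller and the state are, so no good event
is needed and the bound also holds for an epoch longer than `T`. -/
lemma measure_dirSum_le (h : Setting S c K₀ P w G N) (j : ℕ) :
    P {ω | √(2 * (c.m dx du j : ℝ) * c.logTerm) ≤ ‖dirSum c w G j (c.m dx du j) ω‖}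
      ≤ ENNReal.ofReal c.failProb := by
  have hQ := h.isProbabilityMeasure_freshLaw
  have hμ := h.inp.isProbabilityMeasure_noiseLaw
  have hm : (0 : ℝ) < c.m dx du j := by exact_mod_cast h.m_pos j
  have hL : 0 < c.logTerm := by linarith [h.one_le_logTerm]
  have key := azuma (P := P) (n := c.m dx du j) one_pos
    (t := √(2 * (c.m dx du j : ℝ) * c.logTerm))
    (by positivity) (A := Set.univ) (m := pathPast c w G j)
    (fun i => h.inp.past_le _ _ _) (fun i => MeasurableSet.univ)
    (Z := pathPoint S c K₀ w G j) (fun i => measurable_pathPoint S c K₀ w G j i)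
    (Y := pathFresh c w G j) (fun i => h.inp.measurable_fresh _ _ _)
    (fun i => h.inp.map_fresh _ _ _) (fun i => h.inp.indep_past_fresh _ _ _)
    (D := fun _ y => dir y.1)
    (measurable_dir.comp (measurable_fst.comp measurable_snd))
    (fun i => Eventually.of_forall fun ω _ => Eventually.of_forall fun y => norm_dir_le y.1)
    (fun i => Eventually.of_forall fun ω _ a => ?_) (S := dirSum c w G j)
    (fun ω => by simp [dirSum])
    (fun i => ?_) (fun i ω => by rw [dirSum, Finset.sum_range_succ]; rfl) (h.m_pos j)
  · rw [Set.univ_inter] at key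
    refine key.trans (le_of_eq ?_)
    rw [Consts.failProb]
    congr 3
    rw [Real.sq_sqrt (by positivity)]
    field_simp
  · rw [Inputs.freshLaw, integral_fun_fst (f := fun v : MatVec dx du => inner ℝ (dir v) a),
      integral_inner_dir, smul_zero]
  · exact Finset.measurable_sum _ fun i' hi' => (measurable_fresh_dir c w G j i').mono
      (pathPast_mono c w G j (Finset.mem_range.1 hi')) le_rfl

/-- The gradient estimate of an epoch is accurate if the deviations are small. -/
lemma gradEst_error (h : Setting S c K₀ P w G N) {j : ℕ} {ω : Ω}
    (hg : ω ∈ goodEvent S c K₀ w G N j) (hw : ∀ t, euclNorm (w t ω) ≤ c.W)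
    (hm : c.m dx du j ≤ c.T)
    (hdev : ‖devSum S c K₀ P w G j (c.m dx du j) ω‖
      ≤ 2 * c.costBound * √(2 * (c.m dx du j : ℝ) * c.logTerm)) :
    frobNorm (gradEst S c (fun t => w t ω) (fun j' i => Matrix.of fun a b => G j' i a b ω) j
        (pathRun S c K₀ w G j ω).1 (pathRun S c K₀ w G j ω).2
      - S.grad N (pathRun S c K₀ w G j ω).1) ≤ c.ν / (16 * c.κ ^ 2) := by
  have hμ := h.inp.isProbabilityMeasure_noiseLaw
  have hmp : (0 : ℝ) < c.m dx du j := by exact_mod_cast h.m_pos j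
  have hdx : (0 : ℝ) < dx := by exact_mod_cast h.dx_pos
  have hdu : (0 : ℝ) < du := by exact_mod_cast h.du_pos
  have hr := h.r_pos j
  refine le_trans ?_ (h.grad_error_le hm)
  set g := vecE (S.grad N (pathRun S c K₀ w G j ω).1) with hgdef
  set q := (dx * du : ℝ) / ((c.m dx du j : ℝ) * c.r dx j) with hq
  have hq0 : 0 < q := by positivity
  set ε := c.α * c.κ ^ 6 * c.W ^ 2 / (6 * c.T)
    + 22 * c.ψ ^ 2 * c.κ ^ 7 * c.σ ^ 2 * c.r dx j ^ 2 / (dx * du) with hε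
  -- Each conditional mean is close to the same multiple of the gradient, although the state at the
  -- beginning of a sub-epoch depends on the preceding ones.
  have hbias : ∀ i, ‖meanVec S c P w j (pathPoint S c K₀ w G j i ω)
      - (c.r dx j / (dx * du : ℝ)) • g‖ ≤ ε := fun i => by
    refine (h.reg.norm_integral_obsVec_sub_le (s := c.τ - 1) (z := pathPoint S c K₀ w G j i ω)
      h.inp.noise_law h.dx_pos h.du_pos hr.le (h.r_small j) hg.1).trans ?_
    exact add_le_add_left (h.mixing_error_le (euclNorm_nonneg _) (h.pathPoint_le hg hw i)) _
  -- The scaling `q` is `dx du / (m_j r_j)`, so `m_j` copies of the ideal mean `(r_j / (dx du)) g`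
  -- add up to exactly the gradient.
  have e : vecE (gradEst S c (fun t => w t ω) (fun j' i => Matrix.of fun a b => G j' i a b ω) j
        (pathRun S c K₀ w G j ω).1 (pathRun S c K₀ w G j ω).2
      - S.grad N (pathRun S c K₀ w G j ω).1)
      = q • (devSum S c K₀ P w G j (c.m dx du j) ω
        + ∑ i ∈ Finset.range (c.m dx du j), (meanVec S c P w j (pathPoint S c K₀ w G j i ω)
          - (c.r dx j / (dx * du : ℝ)) • g)) := by
    have e1 : q • ((c.m dx du j : ℝ) • ((c.r dx j / (dx * du : ℝ)) • g)) = g := by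
      rw [smul_smul, smul_smul, hq]
      have : (dx * du : ℝ) / ((c.m dx du j : ℝ) * c.r dx j) * (c.m dx du j : ℝ)
          * (c.r dx j / (dx * du : ℝ)) = 1 := by field_simp
      rw [this, one_smul]
    rw [vecE_sub, gradEst, vecE_smul, vecE_sum, ← hgdef, devSum, ← Finset.sum_add_distrib]
    simp only [sub_add_sub_cancel]
    rw [Finset.sum_sub_distrib, Finset.sum_const, Finset.card_range, ← Nat.cast_smul_eq_nsmul ℝ,
      smul_sub, e1]
    congr 2
    refine Finset.sum_congr rfl fun i _ => ?_
    rw [finalCost_eq, vecE_smul, dir_vecE]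
    rfl
  rw [frobNorm_eq, e, norm_smul, Real.norm_of_nonneg hq0.le]
  refine mul_le_mul_of_nonneg_left ((norm_add_le _ _).trans (add_le_add hdev ?_)) hq0.le
  refine (norm_sum_le _ _).trans ((Finset.sum_le_sum fun i _ => hbias i).trans (le_of_eq ?_))
  rw [Finset.sum_const, Finset.card_range, nsmul_eq_mul]

/-- `step_mem` applies with the estimation error as perturbation of the gradient and with `K₀` as
comparator. The state bound is that of the last sub-epoch. -/
lemma good_succ (h : Setting S c K₀ P w G N) {j : ℕ} {ω : Ω}
    (hg : ω ∈ goodEvent S c K₀ w G N j) (hw : ∀ t, euclNorm (w t ω) ≤ c.W)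
    (hm : c.m dx du j ≤ c.T)
    (hdev : ‖devSum S c K₀ P w G j (c.m dx du j) ω‖
      ≤ 2 * c.costBound * √(2 * (c.m dx du j : ℝ) * c.logTerm)) :
    ω ∈ goodEvent S c K₀ w G N (j + 1) := by
  refine ⟨?_, h.pathPoint_le hg hw (c.m dx du j)⟩
  have h1 := h.reg.step_mem hg.1 h.init (η := c.η) rfl (h.gradEst_error hg hw hm hdev)
  rw [add_sub_cancel] at h1
  exact h1

/-- With high probability, all epochs begin with good controllers. -/
lemma measure_goodEvent_compl_le (h : Setting S c K₀ P w G N) {j : ℕ}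
    (hj : c.startTime dx du j 0 ≤ c.T) :
    P (goodEvent S c K₀ w G N j)ᶜ ≤ j * ENNReal.ofReal c.failProb := by
  induction j with
  | zero =>
    have e : goodEvent S c K₀ w G N 0 = Set.univ := by
      refine Set.eq_univ_of_forall fun ω => ⟨?_, ?_⟩
      · exact Regular.sublevel_mono (by linarith [h.reg.ν_pos]) h.init
      · have h1 := h.reg.κ_pos
        have h2 := h.W_pos
        have h3 : euclNorm (0 : Fin dx → ℝ) = 0 := by simp [euclNorm]
        change euclNorm (0 : Fin dx → ℝ) ≤ _
        rw [h3, Consts.stateBound]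
        positivity
    simp [e]
  | succ j ih =>
    have hj' : c.startTime dx du j 0 ≤ c.T := by
      refine le_trans ?_ hj
      rw [startTime_epoch]
      exact startTime_mono c dx du j (Nat.zero_le _)
    have hm := h.m_le hj (Nat.lt_succ_self j)
    have hle : P (goodEvent S c K₀ w G N (j + 1))ᶜ ≤ P ((goodEvent S c K₀ w G N j)ᶜ ∪
        (goodEvent S c K₀ w G N j ∩ {ω | 2 * c.costBound * √(2 * (c.m dx du j : ℝ) * c.logTerm)
          ≤ ‖devSum S c K₀ P w G j (c.m dx du j) ω‖})) := by
      -- The inclusion holds only almost surely, because it uses the bound on the noise.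
      refine measure_mono_ae ?_
      filter_upwards [h.ae_noise_le] with ω hω hbad
      by_contra hcon
      have hcon' : ¬(ω ∈ (goodEvent S c K₀ w G N j)ᶜ ∨
        ω ∈ (goodEvent S c K₀ w G N j ∩ {ω | 2 * c.costBound * √(2 * (c.m dx du j : ℝ) * c.logTerm)
          ≤ ‖devSum S c K₀ P w G j (c.m dx du j) ω‖})) := hcon
      push Not at hcon'
      have hgood : ω ∈ goodEvent S c K₀ w G N j := not_not.1 hcon'.1
      refine hbad (h.good_succ hgood hω hm ?_)
      by_contra hlt
      exact hcon'.2 ⟨hgood, (not_le.1 hlt).le⟩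
    refine (hle.trans (measure_union_le _ _)).trans
      ((add_le_add (ih hj') (h.measure_devSum_le j)).trans (le_of_eq ?_))
    push_cast
    ring

end Setting

/-! ### The cost of an epoch -/

section Quadratic

variable {n : ℕ}

/-- Testing `M` at `x - a M⁻¹ x` gives `2 a |x|² ≤ xᵀ M x + a² xᵀ M⁻¹ x`, and the last term is at
most `a |x|²`. -/
lemma le_dot_of_norm_inv_le {M : Matrix (Fin n) (Fin n) ℝ} (hM : M.PosDef) {a : ℝ} (ha : 0 < a)
    (hinv : ‖M⁻¹‖ ≤ 1 / a) (x : Fin n → ℝ) : a * (x ⬝ᵥ x) ≤ x ⬝ᵥ M *ᵥ x := by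
  have hu : IsUnit M.det := (Matrix.isUnit_iff_isUnit_det M).1 hM.isUnit
  have h1 := dot_nonneg hM.posSemidef (x - a • (M⁻¹ *ᵥ x))
  have hs := PosSemidef.symm' hM.posSemidef
  have e1 : M *ᵥ (M⁻¹ *ᵥ x) = x := by
    rw [Matrix.mulVec_mulVec, Matrix.mul_nonsing_inv _ hu, Matrix.one_mulVec]
  have e2 : (M⁻¹ *ᵥ x) ⬝ᵥ M *ᵥ x = x ⬝ᵥ x := by
    rw [dot_mulVec_symm hs, e1]
  rw [Matrix.mulVec_sub, Matrix.mulVec_smul, e1, sub_dotProduct, dotProduct_sub, dotProduct_sub,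
    smul_dotProduct, smul_dotProduct, dotProduct_smul, dotProduct_smul, e2,
    dotProduct_comm (M⁻¹ *ᵥ x) x] at h1
  simp only [smul_eq_mul] at h1
  have h2 := (le_abs_self _).trans (dot_le_norm M⁻¹ x)
  have h3 : 0 ≤ x ⬝ᵥ x := by rw [← euclNorm_sq]; positivity
  have h4 := h2.trans (mul_le_mul_of_nonneg_right hinv h3)
  have h5 := mul_le_mul_of_nonneg_left h4 (mul_pos ha ha).le
  have e3 : a * a * (1 / a * (x ⬝ᵥ x)) = a * (x ⬝ᵥ x) := by field_simp
  linarith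

lemma dot_le_of_one_sub {M : Matrix (Fin n) (Fin n) ℝ} (hM : (1 - M).PosSemidef)
    (x : Fin n → ℝ) : x ⬝ᵥ M *ᵥ x ≤ x ⬝ᵥ x := by
  have := dot_nonneg hM x
  rw [Matrix.sub_mulVec, dotProduct_sub, Matrix.one_mulVec] at this
  linarith

/-- Testing `M` at `x - M x` and using `M ⪯ I` at `M x` gives `|M x|² ≤ xᵀ M x ≤ |x|²`, without
diagonalization. -/
lemma norm_le_one_of_one_sub {M : Matrix (Fin n) (Fin n) ℝ} (h0 : M.PosSemidef)
    (hM : (1 - M).PosSemidef) : ‖M‖ ≤ 1 := by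
  refine norm_le_of_mulVec M zero_le_one fun x => ?_
  rw [one_mul]
  refine abs_le_of_sq_le_sq' ?_ (euclNorm_nonneg x) |>.2
  have h1 := dot_nonneg h0 (x - M *ᵥ x)
  have h2 := dot_le_of_one_sub hM (M *ᵥ x)
  have h3 := dot_le_of_one_sub hM x
  rw [Matrix.mulVec_sub, sub_dotProduct, dotProduct_sub, dotProduct_sub,
    dot_mulVec_symm (PosSemidef.symm' h0) x (M *ᵥ x)] at h1
  rw [euclNorm_sq, euclNorm_sq]
  have h4 : (M *ᵥ x) ⬝ᵥ M *ᵥ x = x ⬝ᵥ M *ᵥ (M *ᵥ x) :=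
    dot_mulVec_symm (PosSemidef.symm' h0) (M *ᵥ x) x
  linarith

end Quadratic

namespace Setting

variable {dx du : ℕ} {Ω : Type*} [MeasurableSpace Ω] {S : LQR dx du} {c : Consts}
  {K₀ : Matrix (Fin du) (Fin dx) ℝ} {P : Measure Ω} {w : ℕ → Ω → Fin dx → ℝ}
  {G : ℕ → ℕ → Fin du → Fin dx → Ω → ℝ} {N : Matrix (Fin dx) (Fin dx) ℝ}

/-- A weak form of `dim_le`, with `2¹⁷/448 ≥ 1`. It lets a term of order `r_j √m_j` be absorbed in
`r_j² m_j`. -/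
lemma one_le_r_mul_sqrt (h : Setting S c K₀ P w G N) (j : ℕ) :
    1 ≤ c.r dx j * √(c.m dx du j : ℝ) := by
  have h1 := h.dim_le j
  have hdx : (1 : ℝ) ≤ dx := by exact_mod_cast h.dx_pos
  have hdu : (1 : ℝ) ≤ du := by exact_mod_cast h.du_pos
  have hL : 1 ≤ √c.logTerm := Real.one_le_sqrt.2 h.one_le_logTerm
  have hκ := h.κ_pow_ge_one 10
  have hσ : 0 < c.σ ^ 2 := pow_pos h.reg.hσ 2
  have h2 : c.σ ^ 2 * 2 ^ 17 ≤ (dx * du : ℝ) * (2 ^ 17 * c.κ ^ 10 * c.W ^ 2 * √c.logTerm) := by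
    have e : (dx * du : ℝ) * (2 ^ 17 * c.κ ^ 10 * c.W ^ 2 * √c.logTerm)
        = c.W ^ 2 * 2 ^ 17 * (dx * du * (c.κ ^ 10 * √c.logTerm)) := by ring
    rw [e]
    have h3 : 1 ≤ (dx * du : ℝ) * (c.κ ^ 10 * √c.logTerm) :=
      one_le_mul_of_one_le_of_one_le (one_le_mul_of_one_le_of_one_le hdx hdu)
        (one_le_mul_of_one_le_of_one_le hκ hL)
    exact (mul_le_mul_of_nonneg_right h.σ_le (by norm_num)).trans
      (le_mul_of_one_le_right (by positivity) h3)
  have h4 : c.σ ^ 2 * 2 ^ 17 ≤ c.σ ^ 2 * (448 * (c.r dx j * √(c.m dx du j : ℝ))) := by linarith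
  have h5 := le_of_mul_le_mul_left h4 hσ
  linarith

/-- The root of `logTerm` is split into a constant and a multiple of `√(log (T/δ))`. The constant
part is absorbed in the `r_j² m_j` term by `one_le_r_mul_sqrt`, since `log (T/δ)` may vanish in the
limit; the other part fits into `ν √(m_j log (T/δ))` because `r_j` is small. -/
lemma regret_bound (h : Setting S c K₀ P w G N) (j : ℕ) :
    c.r dx j * (3 / 2 * (√c.α * c.ψ * c.κ ^ 4 * c.σ ^ 2)
        * √(2 * (c.m dx du j : ℝ) * c.logTerm))
      + (c.m dx du j : ℝ) * (22 * c.ψ ^ 2 * c.κ ^ 7 * c.σ ^ 2 * c.r dx j * c.r dx j)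
      ≤ 10 * (√(dx : ℝ) * c.ν * c.ψ ^ 2 * c.κ ^ 8 / c.α * c.r dx j ^ 2 * (c.m dx du j : ℝ)
        + c.ν * √((c.m dx du j : ℝ) * Real.log ((c.T : ℝ) / c.δ))) := by
  have h0 := h.reg.hα
  have h01 := h.reg.hα1
  have hκ := h.reg.κ_pos
  have hσ := h.reg.hσ
  have hψ := h.reg.hψ
  have hψ0 : 0 < c.ψ := by linarith
  have hr := h.r_pos j
  have hrm := h.r_mul_le j
  have hX := h.one_le_r_mul_sqrt j
  have hℓ := h.log_ratio_nonneg
  have hLle := h.logTerm_le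
  have hm0 : (0 : ℝ) < c.m dx du j := by exact_mod_cast h.m_pos j
  have hdx : 1 ≤ √(dx : ℝ) := Real.one_le_sqrt.2 (by exact_mod_cast h.dx_pos)
  set m : ℝ := (c.m dx du j : ℝ)
  set r := c.r dx j
  set ℓ := Real.log ((c.T : ℝ) / c.δ)
  set sm := √m with hsm
  have hsm0 : 0 ≤ sm := Real.sqrt_nonneg _
  have hsm2 : sm ^ 2 = m := Real.sq_sqrt hm0.le
  have hsℓ : √ℓ ^ 2 = ℓ := Real.sq_sqrt hℓ
  have hsℓ0 : 0 ≤ √ℓ := Real.sqrt_nonneg _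
  have hsa : √c.α ≤ 1 := Real.sqrt_le_one.2 h01
  have hsa0 : 0 ≤ √c.α := Real.sqrt_nonneg _
  -- By `logTerm_le`, `2 logTerm ≤ 12 + 8 ℓ ≤ (4 + 3 √ℓ)²`.
  have hroot : √(2 * m * c.logTerm) ≤ sm * (4 + 3 * √ℓ) := by
    rw [Real.sqrt_le_left (by positivity), mul_pow, hsm2]
    have : 2 * c.logTerm ≤ (4 + 3 * √ℓ) ^ 2 := by
      have e : (4 + 3 * √ℓ) ^ 2 = 16 + 24 * √ℓ + 9 * √ℓ ^ 2 := by ring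
      rw [e, hsℓ]
      linarith
    calc 2 * m * c.logTerm = m * (2 * c.logTerm) := by ring
      _ ≤ _ := mul_le_mul_of_nonneg_left this hm0.le
  rw [Real.sqrt_mul hm0.le]
  set F := c.κ ^ 10 * c.σ ^ 2 * c.ψ ^ 2 * r ^ 2 * m with hF
  have hF0 : 0 ≤ F := by positivity
  have first : F ≤ √(dx : ℝ) * c.ν * c.ψ ^ 2 * c.κ ^ 8 / c.α * r ^ 2 * m := by
    have e : √(dx : ℝ) * c.ν * c.ψ ^ 2 * c.κ ^ 8 / c.α * r ^ 2 * m = √(dx : ℝ) * F := by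
      rw [h.reg.hν, hF]
      field_simp
    rw [e]
    exact le_mul_of_one_le_left hF0 hdx
  have t1 : r * (3 / 2 * (√c.α * c.ψ * c.κ ^ 4 * c.σ ^ 2) * (sm * 4)) ≤ 6 * F := by
    have e : r * (3 / 2 * (√c.α * c.ψ * c.κ ^ 4 * c.σ ^ 2) * (sm * 4))
        = 6 * (c.κ ^ 4 * c.σ ^ 2 * c.ψ * (r * sm)) * √c.α := by ring
    have e2 : 6 * F = 6 * (c.κ ^ 4 * c.σ ^ 2 * c.ψ * (r * sm))
        * (c.κ ^ 6 * c.ψ * (r * sm)) := by rw [hF, ← hsm2]; ring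
    rw [e, e2]
    refine mul_le_mul_of_nonneg_left (hsa.trans ?_) (by positivity)
    exact one_le_mul_of_one_le_of_one_le
      (one_le_mul_of_one_le_of_one_le (h.κ_pow_ge_one 6) hψ) hX
  have t2 : r * (3 / 2 * (√c.α * c.ψ * c.κ ^ 4 * c.σ ^ 2) * (sm * (3 * √ℓ)))
      ≤ c.ν * (sm * √ℓ) := by
    have e : r * (3 / 2 * (√c.α * c.ψ * c.κ ^ 4 * c.σ ^ 2) * (sm * (3 * √ℓ)))
        = c.σ ^ 2 * (sm * √ℓ) * (r * (9 / 2 * (√c.α * c.ψ * c.κ ^ 4))) := by ring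
    have e2 : c.ν * (sm * √ℓ) = c.σ ^ 2 * (sm * √ℓ) * (c.κ ^ 2 * c.α) := by
      rw [h.reg.hν]
      ring
    rw [e, e2]
    refine mul_le_mul_of_nonneg_left ?_ (by positivity)
    have h3 : 9 / 2 * (√c.α * c.ψ * c.κ ^ 4) ≤ 448 * c.ψ ^ 2 * c.κ ^ 10 := by
      have h4 : √c.α * c.ψ * c.κ ^ 4 ≤ c.ψ ^ 2 * c.κ ^ 10 := by
        have e3 : c.ψ ^ 2 * c.κ ^ 10 = c.ψ * c.κ ^ 4 * (c.ψ * c.κ ^ 6) := by ring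
        have e4 : √c.α * c.ψ * c.κ ^ 4 = c.ψ * c.κ ^ 4 * √c.α := by ring
        rw [e3, e4]
        exact mul_le_mul_of_nonneg_left (hsa.trans
          (one_le_mul_of_one_le_of_one_le hψ (h.κ_pow_ge_one 6))) (by positivity)
      have h5 : 0 ≤ c.ψ ^ 2 * c.κ ^ 10 := by positivity
      linarith only [h4, h5]
    exact ((mul_le_mul_of_nonneg_left h3 hr.le).trans hrm).trans
      (le_mul_of_one_le_left h0.le (h.κ_pow_ge_one 2))
  have t3 : m * (22 * c.ψ ^ 2 * c.κ ^ 7 * c.σ ^ 2 * r * r) ≤ 3 * F := by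
    have h8 := h.reg.κ_pow_ge 3
    have e : m * (22 * c.ψ ^ 2 * c.κ ^ 7 * c.σ ^ 2 * r * r)
        = c.ψ ^ 2 * c.κ ^ 7 * c.σ ^ 2 * r ^ 2 * m * 22 := by ring
    have e2 : 3 * F = c.ψ ^ 2 * c.κ ^ 7 * c.σ ^ 2 * r ^ 2 * m * (3 * c.κ ^ 3) := by rw [hF]; ring
    rw [e, e2]
    exact mul_le_mul_of_nonneg_left (by linarith only [h8]) (by positivity)
  have t0 : r * (3 / 2 * (√c.α * c.ψ * c.κ ^ 4 * c.σ ^ 2) * √(2 * m * c.logTerm))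
      ≤ r * (3 / 2 * (√c.α * c.ψ * c.κ ^ 4 * c.σ ^ 2) * (sm * (4 + 3 * √ℓ))) :=
    mul_le_mul_of_nonneg_left (mul_le_mul_of_nonneg_left hroot (by positivity)) hr.le
  have hν0 := h.reg.ν_pos
  have t4 : 0 ≤ c.ν * (sm * √ℓ) := by positivity
  linarith only [t0, t1, t2, t3, t4, first, hF0]

/-- The regret of the exploration in a good epoch. -/
lemma sum_cost_sub_le (h : Setting S c K₀ P w G N) {j : ℕ} {ω : Ω}
    (hg : ω ∈ goodEvent S c K₀ w G N j)
    (hdir : ‖dirSum c w G j (c.m dx du j) ω‖ ≤ √(2 * (c.m dx du j : ℝ) * c.logTerm)) :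
    ∑ i ∈ Finset.range (c.m dx du j),
      (S.cost N (perturb c j (pathRun S c K₀ w G j ω).1 (Matrix.of fun a b => G j i a b ω))
        - S.cost N (pathRun S c K₀ w G j ω).1)
      ≤ 10 * (√(dx : ℝ) * c.ν * c.ψ ^ 2 * c.κ ^ 8 / c.α * c.r dx j ^ 2 * (c.m dx du j : ℝ)
        + c.ν * √((c.m dx du j : ℝ) * Real.log ((c.T : ℝ) / c.δ))) := by
  refine le_trans ?_ (h.regret_bound j)
  set K := (pathRun S c K₀ w G j ω).1 with hK
  set g := vecE (S.grad N K) with hgd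
  have hr := h.r_pos j
  have hterm : ∀ i, S.cost N (perturb c j K (Matrix.of fun a b => G j i a b ω)) - S.cost N K
      ≤ c.r dx j * inner ℝ g (dir (pathFresh c w G j i ω).1)
        + 22 * c.ψ ^ 2 * c.κ ^ 7 * c.σ ^ 2 * c.r dx j * c.r dx j := fun i => by
    have e : perturb c j K (Matrix.of fun a b => G j i a b ω)
        = matE (vecE K + c.r dx j • dir (pathFresh c w G j i ω).1) := perturb_eq c j K _
    have h1 := frobNorm_matE_add_smul_dir_sub hr.le (vecE K) _
      (norm_dir_le (pathFresh c w G j i ω).1)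
    rw [← e, matE_vecE] at h1
    have h2 := h.reg.cost_linearization hg.1 h1 (K₂ := K)
      (by rw [sub_self, frobNorm_zero]; exact hr.le) (h.r_small j)
    have h3 : fip (S.grad N K) (perturb c j K (Matrix.of fun a b => G j i a b ω) - K)
        = c.r dx j * inner ℝ g (dir (pathFresh c w G j i ω).1) := by
      rw [fip_eq, vecE_sub, e, vecE_matE, add_sub_cancel_left, inner_smul_right]
    rw [h3] at h2
    have hψ := h.reg.hψ
    have hκ := h.reg.κ_pos
    have h4 := mul_le_mul_of_nonneg_left h1
      (by positivity : 0 ≤ 22 * c.ψ ^ 2 * c.κ ^ 7 * c.σ ^ 2 * c.r dx j)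
    linarith [(abs_le.1 h2).2]
  refine (Finset.sum_le_sum fun i _ => hterm i).trans ?_
  rw [Finset.sum_add_distrib, Finset.sum_const, Finset.card_range, nsmul_eq_mul, ← Finset.mul_sum,
    ← inner_sum]
  refine add_le_add_left (mul_le_mul_of_nonneg_left ?_ hr.le) _
  -- The gradient is common to all sub-epochs, so the first-order terms collapse to its inner
  -- product with `dirSum`. Cauchy-Schwarz keeps the estimate free of a union over possible
  -- gradients.
  refine (real_inner_le_norm _ _).trans (mul_le_mul ?_ hdir (norm_nonneg _) ?_)
  · rw [hgd, ← frobNorm_eq]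
    exact h.reg.frobNorm_grad_le hg.1
  · have hψ := h.reg.hψ
    have hκ := h.reg.κ_pos
    positivity

/-- The regret bound holds with high probability. -/
lemma prob_regret [IsProbabilityMeasure P] (h : Setting S c K₀ P w G N) {j : ℕ}
    (hj : c.startTime dx du j 0 ≤ c.T) {E : Set Ω}
    (hE : ∀ ω, ω ∈ goodEvent S c K₀ w G N j →
      ‖dirSum c w G j (c.m dx du j) ω‖ ≤ √(2 * (c.m dx du j : ℝ) * c.logTerm) → ω ∈ E) :
    1 - c.δ / (4 * (c.T : ℝ)) ≤ P.real E := by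
  have h1 : P Eᶜ ≤ ((j + 1 : ℕ) : ℝ≥0∞) * ENNReal.ofReal c.failProb := by
    have hsub : Eᶜ ⊆ (goodEvent S c K₀ w G N j)ᶜ ∪
        {ω | √(2 * (c.m dx du j : ℝ) * c.logTerm) ≤ ‖dirSum c w G j (c.m dx du j) ω‖} := by
      intro ω hω
      by_contra hcon
      rw [Set.mem_union, not_or] at hcon
      exact hω (hE ω (not_not.1 hcon.1) (not_le.1 hcon.2).le)
    refine ((measure_mono hsub).trans (measure_union_le _ _)).trans
      ((add_le_add (h.measure_goodEvent_compl_le hj) (h.measure_dirSum_le j)).trans (le_of_eq ?_))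
    push_cast
    ring
  have h2 : P.real Eᶜ ≤ c.δ / (4 * c.T) := by
    refine le_trans ?_ h.failProb_le
    have h3 := ENNReal.toReal_mono (by finiteness) h1
    rw [ENNReal.toReal_mul, ENNReal.toReal_natCast,
      ENNReal.toReal_ofReal (failProb_nonneg c)] at h3
    refine h3.trans (mul_le_mul_of_nonneg_right ?_ (failProb_nonneg c))
    have := h.epoch_le hj
    push_cast
    have h4 : (j : ℝ) ≤ c.T := by exact_mod_cast this
    linarith
  -- Subadditivity suffices for the lower bound, so `E` need not be measurable.
  have h5 := measureReal_union_le (μ := P) E Eᶜ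
  rw [Set.union_compl_self, probReal_univ] at h5
  linarith

end Setting

/-- The hypotheses on the system, the noise and the initial controller yield a `Setting`. -/
lemma Setting.of_hypotheses {dx du : ℕ} (hdx : 0 < dx) (hdu : 0 < du) {S : LQR dx du} {c : Consts}
    {K₀ : Matrix (Fin du) (Fin dx) ℝ} (hQ : S.Q.PosDef) (hQ1 : (1 - S.Q).PosSemidef)
    (hR : S.R.PosDef) (hR1 : (1 - S.R).PosSemidef) (hα : 0 < c.α) (hψ : 1 ≤ c.ψ) (hν : 0 < c.ν)
    (hσ : 0 < c.σ) (hW : 0 < c.W) (hδ : 0 < c.δ) (hδ1 : c.δ < 1) (hT : 0 < c.T)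
    (hQi : specNorm S.Q⁻¹ ≤ 1 / c.α) (hRi : specNorm S.R⁻¹ ≤ 1 / c.α) (hB : specNorm S.B ≤ c.ψ)
    {Ω : Type*} [MeasurableSpace Ω] {P : Measure Ω} [IsProbabilityMeasure P]
    {w : ℕ → Ω → Fin dx → ℝ} {G : ℕ → ℕ → Fin du → Fin dx → Ω → ℝ}
    {N : Matrix (Fin dx) (Fin dx) ℝ} (hin : Inputs P w G N c.W)
    (hN : (N - c.σ ^ 2 • (1 : Matrix (Fin dx) (Fin dx) ℝ)).PosDef)
    (hJ : S.J P w K₀ ≤ ENNReal.ofReal (c.ν / 4)) : Setting S c K₀ P w G N := by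
  have hQ' := le_dot_of_norm_inv_le hQ hα (by rwa [← specNorm_eq])
  have hR' := le_dot_of_norm_inv_le hR hα (by rwa [← specNorm_eq])
  set e : Fin dx → ℝ := Pi.single ⟨0, hdx⟩ 1 with he
  have hee : e ⬝ᵥ e = 1 := by simp [he]
  have hα1 : c.α ≤ 1 := by
    have := (hQ' e).trans (dot_le_of_one_sub hQ1 e)
    rwa [hee, mul_one] at this
  have hN' : ∀ x : Fin dx → ℝ, c.σ ^ 2 * (x ⬝ᵥ x) ≤ x ⬝ᵥ N *ᵥ x := fun x => by
    have := dot_nonneg hN.posSemidef x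
    rw [Matrix.sub_mulVec, dotProduct_sub, Matrix.smul_mulVec, Matrix.one_mulVec, dotProduct_smul,
      smul_eq_mul] at this
    linarith
  have hNs : Nᵀ = N := by
    have := PosSemidef.symm' hN.posSemidef
    rw [Matrix.transpose_sub, Matrix.transpose_smul, Matrix.transpose_one, sub_left_inj] at this
    exact this
  have mk : ∀ κ ν, 2 ≤ κ → ν = κ ^ 2 * (c.α * c.σ ^ 2) → Regular S N c.α c.ψ c.σ κ ν :=
    fun κ ν hκ hν => ⟨hα, hα1, hψ, hσ, hκ, hν, PosSemidef.symm' hQ.posSemidef,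
      PosSemidef.symm' hR.posSemidef, hNs, hQ', hR', hN',
      norm_le_one_of_one_sub hR.posSemidef hR1, by rwa [← specNorm_eq]⟩
  -- A provisional choice `κ = 2`, `ν = 4 α σ²`: the link between `J` and the sublevel sets involves
  -- neither constant, but `κ ≥ 2` for the true ones is known only after `J(K₀)` has been bounded
  -- from below.
  have h2 := mk 2 _ le_rfl rfl
  have hinit := hin.noise.mem_sublevel_of_J_le h2 (by positivity) hJ
  -- The expected cost at time `1` is already at least `α σ²`, and it is at most `J(K₀) ≤ ν/4`.
  have hασ : c.α * c.σ ^ 2 ≤ c.ν / 4 := by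
    have h3 := h2.term_ge K₀ 1
    have h4 : S.costN N K₀ 1 ≤ c.ν / 4 := hinit 1
    rw [LQR.costN, Finset.sum_range_one, pow_zero] at h4
    have : Nonempty (Fin dx) := ⟨⟨0, hdx⟩⟩
    have h5 : ‖(1 : Matrix (Fin dx) (Fin dx) ℝ)‖ = 1 := norm_one
    rw [h5] at h3
    linarith
  have hpos : 0 < c.α * c.σ ^ 2 := by positivity
  have hκ : 2 ≤ c.κ := by
    refine Real.le_sqrt_of_sq_le ?_
    rw [le_div_iff₀ hpos]
    linarith
  have hκν : c.ν = c.κ ^ 2 * (c.α * c.σ ^ 2) := by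
    rw [Consts.κ, Real.sq_sqrt (by positivity)]
    field_simp
  refine ⟨hdx, hdu, mk _ _ hκ hκν, hin, hW, ?_, hδ, hδ1, hT, hinit⟩
  -- A diagonal entry of the covariance is at least `σ²`, and it is the mean square of a coordinate
  -- that is bounded by `W`.
  have h6 : c.σ ^ 2 ≤ N ⟨0, hdx⟩ ⟨0, hdx⟩ := by
    have := hN' e
    rw [hee, mul_one] at this
    simpa [he] using this
  refine h6.trans ?_
  rw [← hin.noise.cov 0]
  have h7 : ∀ᵐ ω ∂P, ‖w 0 ω ⟨0, hdx⟩ * w 0 ω ⟨0, hdx⟩‖ ≤ c.W ^ 2 := by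
    filter_upwards [hin.noise.bdd 0] with ω hω
    have h8 := (abs_coord_le (w 0 ω) ⟨0, hdx⟩).trans hω
    rw [norm_mul, Real.norm_eq_abs, ← pow_two]
    exact pow_le_pow_left₀ (abs_nonneg _) h8 2
  have h9 := norm_integral_le_of_norm_le_const h7
  rw [probReal_univ, mul_one] at h9
  exact (Real.le_norm_self _).trans h9

end OnlineLQR

end

theorem lemma3 :
    ∃ C : ℝ, 0 < C ∧
      ∀ (dx du : ℕ) (_ : 0 < dx) (_ : 0 < du)
        (S : OnlineLQR.LQR dx du) (c : OnlineLQR.Consts)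
        (K₀ : Matrix (Fin du) (Fin dx) ℝ)
        -- costs: `0 ≺ Q, R ⪯ I`
        (_ : S.Q.PosDef) (_ : (1 - S.Q).PosSemidef)
        (_ : S.R.PosDef) (_ : (1 - S.R).PosSemidef)
        -- known constants
        (_ : 0 < c.α) (_ : 1 ≤ c.ψ) (_ : 0 < c.ν) (_ : 0 < c.σ) (_ : 0 < c.W)
        (_ : 0 < c.δ) (_ : c.δ < 1) (_ : 0 < c.T)
        (_ : OnlineLQR.specNorm S.Q⁻¹ ≤ 1 / c.α) (_ : OnlineLQR.specNorm S.R⁻¹ ≤ 1 / c.α)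
        (_ : OnlineLQR.specNorm S.B ≤ c.ψ)
        -- randomness: the noise `w t` and the entries `G j i a b` of the Gaussian matrices
        (Ω : Type*) (_ : MeasurableSpace Ω) (P : Measure Ω) (_ : IsProbabilityMeasure P)
        (w : ℕ → Ω → Fin dx → ℝ)
        (G : ℕ → ℕ → Fin du → Fin dx → Ω → ℝ)
        -- the noise is i.i.d., bounded, centred, with covariance `≻ σ² I`
        (_ : ∀ t, Measurable (w t))
        (_ : iIndepFun w P)
        (_ : ∀ t, IdentDistrib (w t) (w 0) P P)
        (_ : ∀ t, ∀ᵐ ω ∂P, OnlineLQR.euclNorm (w t ω) ≤ c.W)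
        (_ : ∀ t a, ∫ ω, w t ω a ∂P = 0)
        (_ : ∀ t, (OnlineLQR.secondMoment P (w t)
            - (c.σ ^ 2) • (1 : Matrix (Fin dx) (Fin dx) ℝ)).PosDef)
        -- the entries of all Gaussian matrices are i.i.d. standard normal
        (_ : ∀ j i a b, Measurable (G j i a b))
        (_ : ∀ j i a b, P.map (G j i a b) = gaussianReal 0 1)
        (_ : iIndepFun (fun (p : ℕ × ℕ × Fin du × Fin dx) =>
            G p.1 p.2.1 p.2.2.1 p.2.2.2) P)
        -- the noise and the Gaussian matrices are independent
        (_ : IndepFun (fun ω t => w t ω)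
          (fun ω (p : ℕ × ℕ × Fin du × Fin dx) => G p.1 p.2.1 p.2.2.1 p.2.2.2 ω) P)
        -- the initial controller satisfies `J(K₀) ≤ ν / 4`
        (_ : S.J P w K₀ ≤ ENNReal.ofReal (c.ν / 4))
        -- an epoch that begins within the `T` rounds
        (j : ℕ) (_ : c.startTime dx du j 0 ≤ c.T),
        1 - c.δ / (4 * (c.T : ℝ)) ≤ P.real {ω |
          let Kj := OnlineLQR.ctrl S c K₀ (fun t => w t ω)
            (fun j' i => Matrix.of fun a b => G j' i a b ω) j
          let Kji := OnlineLQR.subCtrl S c K₀ (fun t => w t ω)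
            (fun j' i => Matrix.of fun a b => G j' i a b ω) j
          S.J P w Kj < ⊤ ∧
          (∀ i < c.m dx du j, S.J P w (Kji i) < ⊤) ∧
          ∑ i ∈ Finset.range (c.m dx du j), ((S.J P w (Kji i)).toReal - (S.J P w Kj).toReal)
            ≤ C * (Real.sqrt (dx : ℝ) * c.ν * c.ψ ^ 2 * c.κ ^ 8 / c.α
                    * c.r dx j ^ 2 * (c.m dx du j : ℝ)
                  + c.ν * Real.sqrt ((c.m dx du j : ℝ) * Real.log ((c.T : ℝ) / c.δ)))} := by

  refine ⟨10, by norm_num, ?_⟩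
  intro dx du hdx hdu S c K₀ hQ hQ1 hR hR1 hα hψ hν hσ hW hδ hδ1 hT hQi hRi hB Ω mΩ P hP w G hwm
    hwi hid hbd hmean hcov hGm hGl hGi hind hJ j hj
  have hin : OnlineLQR.Inputs P w G (OnlineLQR.secondMoment P (w 0)) c.W := by
    refine ⟨⟨hwm, hwi, hbd, hmean, fun t a b => ?_⟩, hid, hGm, hGl, hGi, hind⟩
    have hm : Measurable fun v : Fin dx → ℝ => v a * v b :=
      (measurable_pi_apply a).mul (measurable_pi_apply b)
    exact ((hid t).comp hm).integral_eq
  have h := OnlineLQR.Setting.of_hypotheses hdx hdu hQ hQ1 hR hR1 hα hψ hν hσ hW hδ hδ1 hT hQi hRi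
    hB hin (hcov 0) hJ
  refine h.prob_regret hj fun ω hg hdir => ?_
  have hK := h.reg.sublevel_half hg.1
  have hKi : ∀ i, OnlineLQR.perturb c j (OnlineLQR.pathRun S c K₀ w G j ω).1
      (Matrix.of fun a b => G j i a b ω)
      ∈ S.sublevel (OnlineLQR.secondMoment P (w 0)) c.ν := fun i => by
    rw [OnlineLQR.perturb_eq]
    exact h.reg.explore_mem (v := OnlineLQR.vecE (OnlineLQR.pathRun S c K₀ w G j ω).1)
      (h.r_pos j).le (h.r_small j) hg.1 (OnlineLQR.norm_dir_le _)
  -- On the sublevel set of `ν` the extended cost is the real number `cost`, so passing through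
  -- `toReal` loses nothing.
  have hJ' : ∀ {K}, K ∈ S.sublevel (OnlineLQR.secondMoment P (w 0)) c.ν →
      S.J P w K < ⊤ ∧ (S.J P w K).toReal = S.cost (OnlineLQR.secondMoment P (w 0)) K := by
    intro K hK
    have hst := (h.reg.mem_sublevel.1 hK).1
    rw [hin.noise.J_of_stable h.reg hst]
    exact ⟨ENNReal.ofReal_lt_top, ENNReal.toReal_ofReal (h.reg.costN_le_cost hst 0)⟩
  refine ⟨(hJ' hK).1, fun i _ => (hJ' (hKi i)).1, ?_⟩
  refine le_trans (le_of_eq (Finset.sum_congr rfl fun i _ => ?_)) (h.sum_cost_sub_le hg hdir)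
  exact congrArg₂ (· - ·) (hJ' (hKi i)).2 (hJ' hK).2
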